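/- **Setup.** For $t\in\mathbb R$ let $$H_t(z)=\int_0^\infty e^{tu^2}\Phi(u)\cos(zu)\,du,\qquad \Phi(u)=\sum_{n=1}^\infty\bigl(2\pi^2n^4e^{9u}-3\pi n^2e^{5u}\bigr)\exp(-\pi n^2e^{4u}),$$ and let $\Lambda$ be the De Bruijn–Newman constant, i.e. the infimum of all $t\in\mathbb R$ such that all zeros of $H_t$ are real. Put $\log_+x=\log(2+|x|)$ and $\Psi(T)=\frac{T}{4\pi}\log\frac{T}{4\pi}-\frac{T}{4\pi}$. For $j\ge1$ let $\xi_j$ be the unique number in $(1,\infty)$ with $\Psi(\xi_j)=j$, and put $\xi_{-j}=-\xi_j$. **Corollary 3.3 (macroscopic structure of zeros).** Assume $\Lambda<0$. For $\Lambda<t\le0$ the zeros of $H_t$ are all real, simple and nonzero, and can be listed as $(x_j(t))_{j\in\mathbb Z\setminus\{0\}}$ with $0<x_1(t)<x_2(t)<\cdots$ and $x_{-j}(t)=-x_j(t)$. Moreover, with implied constants and decay rates that do not depend on $t$, $j$, $k$: 1. $x_j(t)=\xi_j+O(\log_+\xi_j)$ for all $\Lambda<t\le 0$ and all nonzero integers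 $j$; 2. $x_j(t)\asymp\dfrac{j}{\log_+\xi_j}\asymp\dfrac{j}{\log_+j}$ for all $\Lambda<t\le0$ and all $j\ge1$; 3. $x_k(t)-x_j(t)=\dfrac{4\pi(k-j)}{\log_+\xi_j}+o_{j\to\infty}(\log_+\xi_j)$ for all $\Lambda<t\le0$ and all integers $j,k$ with $1\le j<k\le j+\log_+^2\xi_j$; that is, there is a sequence $\delta(j)\to0$, independent of $t$ and $k$, such that the difference of the two sides is at most $\delta(j)\log_+\xi_j$ in absolute value. -/

import Mathlib

namespace DBN

noncomputable section

/-- The super-exponentially decaying function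
`Φ(u) = ∑_{n ≥ 1} (2π² n⁴ e^{9u} - 3π n² e^{5u}) exp(-π n² e^{4u})`
(the summation index `n : ℕ` below stands for `n + 1`). -/
def Phi (u : ℝ) : ℝ :=
  ∑' n : ℕ, (2 * Real.pi ^ 2 * ((n : ℝ) + 1) ^ 4 * Real.exp (9 * u)
      - 3 * Real.pi * ((n : ℝ) + 1) ^ 2 * Real.exp (5 * u))
    * Real.exp (-(Real.pi * ((n : ℝ) + 1) ^ 2 * Real.exp (4 * u)))

/-- De Bruijn's family `H_t(z) = ∫_0^∞ e^{t u²} Φ(u) cos(z u) du`. -/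
def H (t : ℝ) (z : ℂ) : ℂ :=
  ∫ u in Set.Ioi (0 : ℝ), (Real.exp (t * u ^ 2) : ℂ) * (Phi u : ℂ) * Complex.cos (z * (u : ℂ))

/-- The De Bruijn-Newman constant: the infimum of the `t` for which all zeros of `H_t` are real. -/
def deBruijnNewman : ℝ :=
  sInf {t : ℝ | ∀ z : ℂ, H t z = 0 → z.im = 0}

/-- The modified logarithm `log_+ x = log (2 + |x|)`. -/
def logPlus (x : ℝ) : ℝ := Real.log (2 + |x|)

/-- `Ψ(T) = (T / 4π) log (T / 4π) - T / 4π`. -/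
def Psi (T : ℝ) : ℝ :=
  T / (4 * Real.pi) * Real.log (T / (4 * Real.pi)) - T / (4 * Real.pi)

theorem existsUnique_Psi (y : ℝ) (hy : 0 ≤ y) : ∃! s : ℝ, 1 < s ∧ Psi s = y := by
  have hpi : (0 : ℝ) < 4 * Real.pi := by positivity
  have key : ∀ a : ℝ, 1 < a → 0 ≤ Psi a → 1 ≤ Real.log (a / (4 * Real.pi)) := by
    intro a ha h
    have hu : 0 < a / (4 * Real.pi) := by positivity
    unfold Psi at h
    by_contra hlt
    push Not at hlt
    nlinarith
  have mono : ∀ a b : ℝ, 1 < a → 0 ≤ Psi a → a < b → Psi a < Psi b := by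
    intro a b ha h hab
    have h1 := key a ha h
    have hu : 0 < a / (4 * Real.pi) := by positivity
    have huv : a / (4 * Real.pi) < b / (4 * Real.pi) := by gcongr
    have hl := Real.log_lt_log hu huv
    unfold Psi
    nlinarith
  have hex : ∃ s : ℝ, 1 < s ∧ Psi s = y := by
    have he : (1 : ℝ) ≤ Real.exp y := Real.one_le_exp hy
    have h1 : 4 * Real.pi * Real.exp 1 ≤ 4 * Real.pi * Real.exp (1 + y) := by
      gcongr
      linarith
    have hc : ContinuousOn Psi
        (Set.Icc (4 * Real.pi * Real.exp 1) (4 * Real.pi * Real.exp (1 + y))) := by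
      intro s hs
      have hs0 : 0 < s := lt_of_lt_of_le (by positivity) hs.1
      have hne : s / (4 * Real.pi) ≠ 0 := by positivity
      unfold Psi
      apply ContinuousAt.continuousWithinAt
      fun_prop (disch := assumption)
    have hval : ∀ w : ℝ, Psi (4 * Real.pi * Real.exp w) = Real.exp w * w - Real.exp w := by
      intro w
      unfold Psi
      have : 4 * Real.pi * Real.exp w / (4 * Real.pi) = Real.exp w := by field_simp
      rw [this, Real.log_exp]
    have hmem : y ∈ Set.Icc (Psi (4 * Real.pi * Real.exp 1))
        (Psi (4 * Real.pi * Real.exp (1 + y))) := by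
      rw [hval, hval]
      have h2 : (1 : ℝ) ≤ Real.exp (1 + y) := Real.one_le_exp (by linarith)
      constructor
      · linarith
      · nlinarith
    obtain ⟨s, hs, hsy⟩ := intermediate_value_Icc h1 hc hmem
    refine ⟨s, ?_, hsy⟩
    have h3 : (1 : ℝ) ≤ Real.exp 1 := Real.one_le_exp (by norm_num)
    have h4 := Real.pi_gt_three
    have := hs.1
    nlinarith
  obtain ⟨s, hs, hsy⟩ := hex
  refine ⟨s, ⟨hs, hsy⟩, ?_⟩
  rintro r ⟨hr, hry⟩
  rcases lt_trichotomy r s with h | h | h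
  · have := mono r s hr (by linarith) h
    linarith
  · exact h
  · have := mono s r hs (by linarith) h
    linarith

/-- For a natural number `n`, the unique `s` in `(1, ∞)` with `Ψ(s) = n`. -/
def classicalLocationNat (n : ℕ) : ℝ :=
  (existsUnique_Psi (n : ℝ) (Nat.cast_nonneg n)).choose

/-- The classical locations `ξ_j`: for `j ≥ 1` the unique `ξ_j` in `(1, ∞)` with `Ψ(ξ_j) = j`,
and `ξ_{-j} = -ξ_j`.  (The unused value at `j = 0` is `0`.) -/
def classicalLocation (j : ℤ) : ℝ :=
  (j.sign : ℝ) * classicalLocationNat j.natAbs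

/-- The positive zeros of `H_t` in increasing order, starting with index `1`: the next one is the
least zero of `H_t` exceeding the previous one.  (Index `0` carries the auxiliary value `0`.) -/
def posZero (t : ℝ) : ℕ → ℝ
  | 0 => 0
  | n + 1 => sInf {y : ℝ | posZero t n < y ∧ H t (y : ℂ) = 0}

/-- The zeros `x_j(t)` of `H_t`, indexed by the nonzero integers: `0 < x_1(t) < x_2(t) < ⋯` are the
positive zeros in increasing order, and `x_{-j}(t) = -x_j(t)`.
(The unused value at `j = 0` is `0`.) -/
def zeroAt (t : ℝ) (j : ℤ) : ℝ :=
  (j.sign : ℝ) * posZero t j.natAbs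

/-- `x` lists the zeros of `f : ℂ → ℂ`, which are all real, simple and nonzero, as
`(x_j)_{j ≠ 0}` with `0 < x_1 < x_2 < ⋯` and `x_{-j} = -x_j`. -/
structure IsZeroEnumeration (f : ℂ → ℂ) (x : ℤ → ℝ) : Prop where
  pos : 0 < x 1
  lt : ∀ j k : ℤ, 1 ≤ j → j < k → x j < x k
  neg : ∀ j : ℤ, j ≠ 0 → x (-j) = -x j
  zero_iff : ∀ z : ℂ, f z = 0 ↔ ∃ j : ℤ, j ≠ 0 ∧ z = (x j : ℂ)
  simple : ∀ j : ℤ, j ≠ 0 → deriv f (x j : ℂ) ≠ 0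

end

end DBN

/-!
# Macroscopic structure of the zeros of `H_t` below time zero

Suppose that `Λ < 0`. Some `H_{t'}` with `t'` arbitrarily close to `Λ` has only real zeros, and De
Bruijn's theory propagates this forward in time: `H_{t'}` is an even entire function of order less
than two, so a locally uniform limit of real-rooted polynomials; averaging a real-rooted polynomial
over the shifts by `± i a` keeps it real-rooted, while on cosine transforms it multiplies the density
by `cosh (a u)`. Since `cosh (√(2c/N) u) ^ N → exp (c u²)`, each later `H_s` (and each of its
derivatives) inherits the property that `|f (x + i y)|` increases with `|y|` (`vertMono_heatInt`).
This forces real zeros, and a comparison along the parabola `s = t - y²/2`, on which the leading term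
at a multiple zero cancels by the heat equation, excludes multiple ones (`heatInt_one_ne_zero`).
So all zeros are real and simple throughout `(Λ, 0]` (`zeros_real_simple`).

For such `t` let `u = H_t'/H_t`. It is the sum of `1/(z - ρ) + 1/(z + ρ)` over the positive zeros
(`SimpleRealZeroEven.hasSum_logDeriv`), so `-Im u` is a Poisson extension of the zero counting
measure. Two facts follow. The number of zeros in `(0, T]` is read off from `u` at any height `y > 0`,
with an error of at most `5 y (-Im u(T + i y))` in `π N` (`SimpleRealZeroEven.abs_zeroCount_sub_le`).
And `u` maps the upper half-plane into the lower one, whence, by Borel-Carathéodory and Cauchy,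
`|u'| ≤ 32 |u| / y` and `|u''| ≤ 32 |u| / y²` (`RealSimpleAt.norm_heatLog₁_le`).

The backward heat equation `∂_t H = -H''` gives `∂_t u = -(u'' + 2 u u')`. By the bounds just
mentioned the right-hand side is `O(|u|/y² + |u|²/y)`. As `u = O(log T)` at time zero, an a priori
estimate keeps `u = O(log T)` for all times in `(Λ, 0]`, at height a large multiple of `log T`
(`norm_heatLog_le_two_mul`, `exists_norm_heatLog_le`). At time zero, `H_0` is Riemann's `ξ` up to a
change of variable (`heatInt_zero_eq`), and Stirling's formula evaluates `H_0'/H_0`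
(`exists_norm_heatLog_zero_add_le`). Since `∂_t u` is the `z`-derivative of `-(u' + u²)`, its integral
over a horizontal segment consists of two boundary terms of size `O(log² T)`, and therefore
`N_t(T) = Ψ(T) + O(log² T)` for every `t` (`exists_abs_zeroCount_sub_Psi_le`). As the density of the
`ξ_j` at `T` is of order `log T`, inverting this relation displaces the zeros by `O(log ξ_j)` only:
this is `x_j = ξ_j + O(log ξ_j)` (`exists_abs_posZero_sub_le`), and the orders of magnitude follow.

For gaps of size `O(log X)` the error `O(log² T)` is as large as the main term, so a local argument is
needed. Along straight characteristics Gronwall's inequality shows that at height `K log X` near `X`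
the function `u` is within `O(1)` of `-(i/4) log X` (`exists_norm_heatLog_add_le`). At height
`η log X` only `u = O(log X)` is known; but after rescaling by `log X` a bounded holomorphic function
which is very small on a fixed disc is small on every compact part of the domain
(`exists_small_on_closedBall`), so `u = -(i/4) log X + o(log X)` at height `η log X` too. Counting
zeros at that height, with `η → 0`, shows that they have density `log X / 4π` up to `o(log² X)` zeros
at the scale `log X` (`eventually_abs_zeroCount_sub_le`), which is the asymptotic formula for the gaps.
-/

namespace DBN

noncomputable section

open Real Set Filter Topology MeasureTheory

/-! ### The kernel `Φ`: convergence, symmetry and decay -/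

/-- The quantity `π (n+1)² e^{4u}` that governs the `n`-th term of `Φ`. -/
def thetaExponent (n : ℕ) (u : ℝ) : ℝ := π * ((n : ℝ) + 1) ^ 2 * exp (4 * u)

lemma thetaExponent_pos (n : ℕ) (u : ℝ) : 0 < thetaExponent n u := by
  unfold thetaExponent; positivity

lemma hasDerivAt_thetaExponent (n : ℕ) (u : ℝ) :
    HasDerivAt (thetaExponent n) (4 * thetaExponent n u) u := by
  have h : HasDerivAt (fun u : ℝ => exp (4 * u)) (exp (4 * u) * 4) u := by
    simpa using ((hasDerivAt_id u).const_mul 4).exp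
  have := h.const_mul (π * ((n : ℝ) + 1) ^ 2)
  unfold thetaExponent
  exact this.congr_deriv (by ring)

lemma thetaExponent_ge (n : ℕ) (u : ℝ) : 3 * exp (4 * u) * ((n : ℝ) + 1) ≤ thetaExponent n u := by
  unfold thetaExponent
  have h1 : ((n : ℝ) + 1) ≤ ((n : ℝ) + 1) ^ 2 := by
    have : (0 : ℝ) ≤ n := Nat.cast_nonneg n
    nlinarith
  have h3 : (3 : ℝ) ≤ π := Real.pi_gt_three.le
  calc 3 * exp (4 * u) * ((n : ℝ) + 1) ≤ π * exp (4 * u) * ((n : ℝ) + 1) ^ 2 := by gcongr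
    _ = _ := by ring

/-- The `n`-th term of `Φ` expressed through `q = π (n+1)² e^{4u}`. -/
lemma Phi_term_eq (n : ℕ) (u : ℝ) :
    (2 * π ^ 2 * ((n : ℝ) + 1) ^ 4 * exp (9 * u) - 3 * π * ((n : ℝ) + 1) ^ 2 * exp (5 * u))
      * exp (-(π * ((n : ℝ) + 1) ^ 2 * exp (4 * u)))
    = (2 * thetaExponent n u ^ 2 - 3 * thetaExponent n u) * exp (u - thetaExponent n u) := by
  have h9 : exp (9 * u) = exp (4 * u) ^ 2 * exp u := by
    rw [← Real.exp_nat_mul, ← Real.exp_add]; congr 1; push_cast; ring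
  have h5 : exp (5 * u) = exp (4 * u) * exp u := by
    rw [← Real.exp_add]; congr 1; ring
  rw [sub_eq_add_neg u, Real.exp_add, h9, h5]
  unfold thetaExponent
  ring

lemma Phi_eq_tsum (u : ℝ) : Phi u =
    ∑' n : ℕ, (2 * thetaExponent n u ^ 2 - 3 * thetaExponent n u) * exp (u - thetaExponent n u) := by
  unfold Phi
  exact tsum_congr fun n => Phi_term_eq n u

/-- Polynomials of degree two in `q` are absorbed by `exp (-q)`, with a factor `q⁻²` to spare. -/
lemma quadratic_mul_exp_neg_le {q : ℝ} (hq : 0 < q) :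
    (1 + 24 * q + 16 * q ^ 2) * exp (-q) ≤ 530 / q ^ 2 := by
  have h2 := Real.pow_div_factorial_le_exp q hq.le 2
  have h3 := Real.pow_div_factorial_le_exp q hq.le 3
  have h4 := Real.pow_div_factorial_le_exp q hq.le 4
  rw [Real.exp_neg, ← div_eq_mul_inv, div_le_div_iff₀ (Real.exp_pos q) (by positivity)]
  norm_num [Nat.factorial] at h2 h3 h4
  nlinarith

lemma summable_inv_succ_sq : Summable fun n : ℕ => (1 : ℝ) / ((n : ℝ) + 1) ^ 2 := by
  have := (summable_nat_add_iff 1).2 (Real.summable_one_div_nat_pow.2 (le_refl 2))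
  simpa using this

lemma inv_thetaExponent_sq_le {R u : ℝ} (hu : -R ≤ u) (n : ℕ) :
    530 / thetaExponent n u ^ 2 ≤ 530 * exp (8 * R) * (1 / ((n : ℝ) + 1) ^ 2) := by
  have h := thetaExponent_ge n u
  have hn : (0 : ℝ) < (n : ℝ) + 1 := by positivity
  have h1 : exp (-(4 * R)) * ((n : ℝ) + 1) ≤ thetaExponent n u := by
    refine le_trans ?_ h
    have : exp (-(4 * R)) ≤ exp (4 * u) := Real.exp_le_exp.2 (by linarith)
    have := Real.exp_pos (4 * u)
    nlinarith
  calc 530 / thetaExponent n u ^ 2 ≤ 530 / (exp (-(4 * R)) * ((n : ℝ) + 1)) ^ 2 := by gcongr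
    _ = 530 * exp (8 * R) * (1 / ((n : ℝ) + 1) ^ 2) := by
      have : exp (8 * R) * exp (-(4 * R)) ^ 2 = 1 := by
        rw [← Real.exp_nat_mul, ← Real.exp_add]; simp; ring_nf
      rw [mul_pow, mul_one_div, div_eq_div_iff (by positivity) (by positivity)]
      linear_combination (-530 * ((n : ℝ) + 1) ^ 2) * this

/-- A locally uniform summable bound for the theta-like series and its derivatives. -/
lemma abs_theta_term_le {R u a b c : ℝ} (hu : u ∈ Ioo (-R) R) (ha : |a| ≤ 1) (hb : |b| ≤ 24)
    (hc : |c| ≤ 16) (n : ℕ) :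
    ‖(a + b * thetaExponent n u + c * thetaExponent n u ^ 2) * exp (u - thetaExponent n u)‖
      ≤ exp R * (530 * exp (8 * R)) * (1 / ((n : ℝ) + 1) ^ 2) := by
  have hq := thetaExponent_pos n u
  rw [norm_mul, Real.norm_eq_abs, Real.norm_of_nonneg (Real.exp_pos _).le, sub_eq_add_neg,
    Real.exp_add]
  have h1 : |a + b * thetaExponent n u + c * thetaExponent n u ^ 2|
      ≤ 1 + 24 * thetaExponent n u + 16 * thetaExponent n u ^ 2 := by
    refine (abs_add_le _ _).trans (add_le_add ((abs_add_le _ _).trans (add_le_add ha ?_)) ?_)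
    · rw [abs_mul, abs_of_pos hq]; gcongr
    · rw [abs_mul, abs_of_pos (pow_pos hq 2)]; gcongr
  have h2 := (quadratic_mul_exp_neg_le hq).trans (inv_thetaExponent_sq_le hu.1.le n)
  have h3 : exp u ≤ exp R := Real.exp_le_exp.2 hu.2.le
  calc _ ≤ (1 + 24 * thetaExponent n u + 16 * thetaExponent n u ^ 2)
        * (exp R * exp (-thetaExponent n u)) := by gcongr
    _ = exp R * ((1 + 24 * thetaExponent n u + 16 * thetaExponent n u ^ 2)
        * exp (-thetaExponent n u)) := by ring
    _ ≤ exp R * (530 * exp (8 * R) * (1 / ((n : ℝ) + 1) ^ 2)) := by gcongr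
    _ = _ := by ring

lemma summable_theta_term (u : ℝ) {a b c : ℝ} (ha : |a| ≤ 1) (hb : |b| ≤ 24) (hc : |c| ≤ 16) :
    Summable fun n : ℕ =>
      (a + b * thetaExponent n u + c * thetaExponent n u ^ 2) * exp (u - thetaExponent n u) := by
  have hu : u ∈ Ioo (-(|u| + 1)) (|u| + 1) := by
    constructor <;> cases abs_cases u <;> linarith
  exact Summable.of_norm_bounded (summable_inv_succ_sq.mul_left _)
    fun n => abs_theta_term_le hu ha hb hc n

lemma hasDerivAt_theta_term (n : ℕ) (a b u : ℝ) :
    HasDerivAt (fun u => (a + b * thetaExponent n u) * exp (u - thetaExponent n u))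
      ((a + (5 * b - 4 * a) * thetaExponent n u + (-4 * b) * thetaExponent n u ^ 2)
        * exp (u - thetaExponent n u)) u := by
  have hq := hasDerivAt_thetaExponent n u
  have h1 := (hq.const_mul b).const_add a
  have h2 := ((hasDerivAt_id u).sub hq).exp
  refine (h1.mul h2).congr_deriv ?_
  simp only [id_eq, Pi.sub_apply]
  ring

/-- Termwise differentiation of the theta-like series. -/
lemma hasDerivAt_tsum_theta {a b : ℝ} (ha : |a| ≤ 1) (hb : |b| ≤ 4) (u : ℝ) :
    HasDerivAt (fun u => ∑' n : ℕ, (a + b * thetaExponent n u) * exp (u - thetaExponent n u))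
      (∑' n : ℕ, (a + (5 * b - 4 * a) * thetaExponent n u + (-4 * b) * thetaExponent n u ^ 2)
        * exp (u - thetaExponent n u)) u := by
  have hu : u ∈ Ioo (-(|u| + 1)) (|u| + 1) := by
    constructor <;> cases abs_cases u <;> linarith
  have hb' := abs_le.1 hb
  have ha' := abs_le.1 ha
  refine hasDerivAt_tsum_of_isPreconnected (summable_inv_succ_sq.mul_left
    (exp (|u| + 1) * (530 * exp (8 * (|u| + 1))))) isOpen_Ioo isPreconnected_Ioo
    (fun n v _ => hasDerivAt_theta_term n a b v) (fun n v hv => ?_) hu ?_ hu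
  · refine abs_theta_term_le hv ha (abs_le.2 ⟨?_, ?_⟩) (abs_le.2 ⟨?_, ?_⟩) n <;> linarith
  · simpa using summable_theta_term (c := 0) u ha (hb.trans (by norm_num)) (by norm_num)

/-- `e^u θ(e^{4u})` for the Jacobi theta function `θ(x) = ∑_{n ∈ ℤ} exp (-π n² x)`. -/
def symTheta (u : ℝ) : ℝ := exp u * ∑' n : ℤ, exp (-π * exp (4 * u) * (n : ℝ) ^ 2)

/-- Jacobi's identity `θ(1/x) = √x θ(x)`. -/
lemma symTheta_neg (u : ℝ) : symTheta (-u) = symTheta u := by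
  unfold symTheta
  have h := Real.tsum_exp_neg_mul_int_sq (Real.exp_pos (4 * u))
  rw [h]
  have h1 : (1 : ℝ) / exp (4 * u) ^ ((1 : ℝ) / 2) = exp (-(2 * u)) := by
    rw [← Real.exp_mul, one_div, ← Real.exp_neg]; congr 1; ring
  rw [h1, ← mul_assoc, ← Real.exp_add]
  congr 1
  · congr 1; ring
  · refine tsum_congr fun n => ?_
    congr 1
    rw [mul_neg, Real.exp_neg]
    field_simp

lemma symTheta_eq (u : ℝ) :
    symTheta u = exp u + 2 * ∑' n : ℕ, (1 + 0 * thetaExponent n u) * exp (u - thetaExponent n u) := by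
  have hs : Summable fun n : ℕ => (1 + 0 * thetaExponent n u) * exp (u - thetaExponent n u) := by
    simpa using summable_theta_term (a := 1) (b := 0) (c := 0) u (by norm_num) (by norm_num)
      (by norm_num)
  have hs' : Summable fun n : ℕ => exp (-π * exp (4 * u) * ((n : ℝ) + 1) ^ 2) := by
    refine (hs.mul_left (exp (-u))).congr fun n => ?_
    simp only [zero_mul, add_zero, one_mul]
    rw [← Real.exp_add]; congr 1; unfold thetaExponent; ring
  unfold symTheta
  have hz : HasSum (fun n : ℤ => exp (-π * exp (4 * u) * (n : ℝ) ^ 2))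
      ((∑' n : ℕ, exp (-π * exp (4 * u) * ((n : ℝ) + 1) ^ 2)) + 1
        + ∑' n : ℕ, exp (-π * exp (4 * u) * ((n : ℝ) + 1) ^ 2)) := by
    have := HasSum.of_add_one_of_neg_add_one
      (f := fun n : ℤ => exp (-π * exp (4 * u) * (n : ℝ) ^ 2))
      (m := ∑' n : ℕ, exp (-π * exp (4 * u) * ((n : ℝ) + 1) ^ 2))
      (m' := ∑' n : ℕ, exp (-π * exp (4 * u) * ((n : ℝ) + 1) ^ 2))
      (by simpa using hs'.hasSum) (by
        refine hs'.hasSum.congr_fun fun n => ?_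
        congr 2
        push_cast
        ring)
    simpa using this
  rw [hz.tsum_eq]
  have : ∑' n : ℕ, (1 + 0 * thetaExponent n u) * exp (u - thetaExponent n u)
      = exp u * ∑' n : ℕ, exp (-π * exp (4 * u) * ((n : ℝ) + 1) ^ 2) := by
    rw [← tsum_mul_left]
    refine tsum_congr fun n => ?_
    simp only [zero_mul, add_zero, one_mul]
    rw [← Real.exp_add]; congr 1; unfold thetaExponent; ring
  rw [this]; ring

/-- `ω'' - ω = 16 Φ` for `ω(u) = e^u θ(e^{4u})`. -/
lemma hasDerivAt_symTheta :
    ∃ ω' : ℝ → ℝ, (∀ u, HasDerivAt symTheta (ω' u) u) ∧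
      ∀ u, HasDerivAt ω' (symTheta u + 16 * Phi u) u := by
  refine ⟨fun u => exp u + 2 * ∑' n : ℕ, (1 + (-4) * thetaExponent n u) *
    exp (u - thetaExponent n u), fun u => ?_, fun u => ?_⟩
  · have h := (Real.hasDerivAt_exp u).add
      ((hasDerivAt_tsum_theta (a := 1) (b := 0) (by norm_num) (by norm_num) u).const_mul 2)
    have he : symTheta = fun u => exp u + 2 * ∑' n : ℕ, (1 + 0 * thetaExponent n u) *
        exp (u - thetaExponent n u) := funext symTheta_eq
    rw [he]
    refine h.congr_deriv ?_
    norm_num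
  · have h := (Real.hasDerivAt_exp u).add
      ((hasDerivAt_tsum_theta (a := 1) (b := -4) (by norm_num) (by norm_num) u).const_mul 2)
    refine h.congr_deriv ?_
    rw [symTheta_eq, Phi_eq_tsum, add_assoc, ← tsum_mul_left, ← tsum_mul_left, ← tsum_mul_left]
    congr 1
    have s1 : Summable fun n : ℕ => 2 * ((1 + 0 * thetaExponent n u) *
        exp (u - thetaExponent n u)) := by
      refine Summable.mul_left _ ?_
      simpa using summable_theta_term (a := 1) (b := 0) (c := 0) u (by norm_num) (by norm_num)
        (by norm_num)
    have s2 : Summable fun n : ℕ => 16 * ((2 * thetaExponent n u ^ 2 - 3 * thetaExponent n u) *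
        exp (u - thetaExponent n u)) := by
      refine Summable.mul_left _ ?_
      refine (summable_theta_term (a := 0) (b := -3) (c := 2) u (by norm_num) (by norm_num)
        (by norm_num)).congr fun n => by ring
    rw [← s1.tsum_add s2]
    refine tsum_congr fun n => by ring

/-- `Φ` is even: the functional equation of the theta function. -/
lemma Phi_neg (u : ℝ) : Phi (-u) = Phi u := by
  obtain ⟨ω', h1, h2⟩ := hasDerivAt_symTheta
  have hodd : ∀ u, ω' (-u) = -ω' u := by
    intro u
    have ha := (h1 (-u)).comp u (hasDerivAt_neg u)
    have hb : symTheta ∘ Neg.neg = symTheta := funext symTheta_neg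
    have hc : (symTheta ∘ fun x => -x) = symTheta := funext symTheta_neg
    rw [hc] at ha
    have := ha.unique (h1 u)
    linarith
  have ha := (h2 (-u)).comp u (hasDerivAt_neg u)
  have hc : (ω' ∘ fun x => -x) = fun u => -ω' u := funext hodd
  rw [hc] at ha
  have := ha.unique (h2 u).neg
  rw [symTheta_neg] at this
  linarith

lemma summable_Phi (u : ℝ) : Summable fun n : ℕ =>
    (2 * thetaExponent n u ^ 2 - 3 * thetaExponent n u) * exp (u - thetaExponent n u) :=
  (summable_theta_term (a := 0) (b := -3) (c := 2) u (by norm_num) (by norm_num)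
    (by norm_num)).congr fun n => by ring

lemma continuous_Phi : Continuous Phi := by
  rw [continuous_iff_continuousAt]
  intro u
  have hu : u ∈ Ioo (-(|u| + 1)) (|u| + 1) := by
    constructor <;> cases abs_cases u <;> linarith
  have h : ContinuousOn (fun u => ∑' n : ℕ, (0 + (-3) * thetaExponent n u
      + 2 * thetaExponent n u ^ 2) * exp (u - thetaExponent n u))
      (Ioo (-(|u| + 1)) (|u| + 1)) := by
    refine continuousOn_tsum (fun n => ?_) (summable_inv_succ_sq.mul_left
      (exp (|u| + 1) * (530 * exp (8 * (|u| + 1))))) (fun n v hv =>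
        abs_theta_term_le hv (by norm_num) (by norm_num) (by norm_num) n)
    unfold thetaExponent
    fun_prop
  refine (h.continuousAt (isOpen_Ioo.mem_nhds hu)).congr (Eventually.of_forall fun v => ?_)
  rw [Phi_eq_tsum]
  exact tsum_congr fun n => by ring

lemma Phi_pos {u : ℝ} (hu : 0 ≤ u) : 0 < Phi u := by
  rw [Phi_eq_tsum]
  have hterm : ∀ n : ℕ, 0 < (2 * thetaExponent n u ^ 2 - 3 * thetaExponent n u) *
      exp (u - thetaExponent n u) := by
    intro n
    have h := thetaExponent_ge n u
    have h1 : (1 : ℝ) ≤ exp (4 * u) := Real.one_le_exp (by linarith)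
    have h2 : (0 : ℝ) ≤ n := Nat.cast_nonneg n
    have h3 : 3 ≤ thetaExponent n u := by nlinarith
    have : 0 < 2 * thetaExponent n u ^ 2 - 3 * thetaExponent n u := by nlinarith
    positivity
  exact (summable_Phi u).tsum_pos (fun n => (hterm n).le) 0 (hterm 0)

/-- `Φ` decays super-exponentially; the bound `exp (-u⁴)` suffices for all the integrals. -/
lemma exists_Phi_le : ∃ C : ℝ, 0 < C ∧ ∀ u, 0 ≤ u → Phi u ≤ C * exp (-u ^ 4) := by
  have key : ∀ u : ℝ, 0 ≤ u → ∀ n : ℕ,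
      (2 * thetaExponent n u ^ 2 - 3 * thetaExponent n u) * exp (u - thetaExponent n u)
        ≤ 530 * (1 / ((n : ℝ) + 1) ^ 2) * exp (-u ^ 4) := by
    intro u hu n
    have hq := thetaExponent_pos n u
    have hge := thetaExponent_ge n u
    have hn : (0 : ℝ) ≤ n := Nat.cast_nonneg n
    have h4 := Real.pow_div_factorial_le_exp (4 * u) (by linarith) 4
    have h1 := Real.add_one_le_exp (4 * u)
    norm_num [Nat.factorial] at h4
    have hE : u + u ^ 4 ≤ thetaExponent n u / 2 := by
      have : exp (4 * u) ≤ exp (4 * u) * ((n : ℝ) + 1) := by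
        have := Real.exp_pos (4 * u)
        nlinarith
      nlinarith
    have hb := quadratic_mul_exp_neg_le (q := thetaExponent n u / 2) (by positivity)
    have h3 : 530 / (thetaExponent n u / 2) ^ 2 ≤ 530 * (1 / ((n : ℝ) + 1) ^ 2) := by
      rw [← div_eq_mul_one_div]
      have : (n : ℝ) + 1 ≤ thetaExponent n u / 2 := by
        have : (1 : ℝ) ≤ exp (4 * u) := Real.one_le_exp (by linarith)
        nlinarith
      gcongr
    calc (2 * thetaExponent n u ^ 2 - 3 * thetaExponent n u) * exp (u - thetaExponent n u)
        ≤ ((1 + 24 * (thetaExponent n u / 2) + 16 * (thetaExponent n u / 2) ^ 2)) *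
          exp (-(thetaExponent n u / 2) + -u ^ 4) := by
          gcongr
          · nlinarith
          · linarith
      _ = ((1 + 24 * (thetaExponent n u / 2) + 16 * (thetaExponent n u / 2) ^ 2) *
          exp (-(thetaExponent n u / 2))) * exp (-u ^ 4) := by rw [Real.exp_add]; ring
      _ ≤ _ := by
          have := hb.trans h3
          gcongr
  refine ⟨530 * (∑' n : ℕ, 1 / ((n : ℝ) + 1) ^ 2) + 1, ?_, fun u hu => ?_⟩
  · have : 0 ≤ ∑' n : ℕ, (1 : ℝ) / ((n : ℝ) + 1) ^ 2 := tsum_nonneg fun n => by positivity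
    positivity
  · rw [Phi_eq_tsum]
    have hs := (summable_inv_succ_sq.mul_left 530).mul_right (exp (-u ^ 4))
    refine ((summable_Phi u).tsum_le_tsum (key u hu) hs).trans ?_
    rw [tsum_mul_right, tsum_mul_left]
    have := Real.exp_pos (-u ^ 4)
    nlinarith

/-! ### The heat flow `H_t` as an entire function of `(t, z)` -/

/-- The integrand of `heatInt`. -/
def heatIntegrand (k : ℕ) (p : ℂ × ℂ) (u : ℝ) : ℂ :=
  Complex.exp (p.1 * u ^ 2) * Phi u * u ^ k * Complex.cos (p.2 * u + k * (π / 2))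

/-- The `k`-th `z`-derivative of `H_t(z)`, as an integral, with complex time `t`:
`∫_0^∞ e^{t u²} Φ(u) u^k cos(z u + k π / 2) du`. -/
def heatInt (k : ℕ) (t z : ℂ) : ℂ := ∫ u in Ioi (0 : ℝ), heatIntegrand k (t, z) u

lemma H_eq_heatInt (t : ℝ) (z : ℂ) : H t z = heatInt 0 t z := by
  unfold H heatInt heatIntegrand
  refine integral_congr_ae (Eventually.of_forall fun u => ?_)
  simp

lemma norm_cos_le (w : ℂ) : ‖Complex.cos w‖ ≤ exp |w.im| := by
  rw [Complex.cos, norm_div, Complex.norm_ofNat]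
  have h := norm_add_le (Complex.exp (w * Complex.I)) (Complex.exp (-w * Complex.I))
  rw [Complex.norm_exp, Complex.norm_exp] at h
  have h1 : exp (w * Complex.I).re ≤ exp |w.im| := by
    apply Real.exp_le_exp.2; simpa using neg_le_abs w.im
  have h2 : exp (-w * Complex.I).re ≤ exp |w.im| := by
    apply Real.exp_le_exp.2; simpa using le_abs_self w.im
  linarith

lemma integrableOn_majorant (k : ℕ) (A B : ℝ) :
    IntegrableOn (fun u : ℝ => u ^ k * exp (A * u ^ 2 + B * u - u ^ 4)) (Ioi 0) := by
  set a : ℝ := |A| + |B| + 2 with ha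
  have hI : IntegrableOn (fun u : ℝ => (k.factorial : ℝ) * exp (a ^ 2 + a) * exp (-u)) (Ioi 0) :=
    (integrableOn_exp_neg_Ioi 0).const_mul _
  refine Integrable.mono' hI (by fun_prop) ?_
  refine (ae_restrict_iff' measurableSet_Ioi).2 (Eventually.of_forall fun u (hu : 0 < u) => ?_)
  have h1 := Real.pow_div_factorial_le_exp u hu.le k
  have h2 : u ^ k ≤ k.factorial * exp u := by
    rw [div_le_iff₀ (by positivity)] at h1; linarith
  rw [Real.norm_of_nonneg (by positivity)]
  have h3 : A * u ^ 2 + B * u - u ^ 4 + u ≤ a ^ 2 + a - u := by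
    have e1 : A * u ^ 2 ≤ |A| * u ^ 2 := by gcongr; exact le_abs_self A
    have e2 : B * u ≤ |B| * (1 + u ^ 2) := by
      have : B * u ≤ |B| * u := by gcongr; exact le_abs_self B
      have h5 : u ≤ 1 + u ^ 2 := by nlinarith [sq_nonneg (u - 1)]
      have := mul_le_mul_of_nonneg_left h5 (abs_nonneg B)
      linarith
    have e3 : 2 * u ≤ 1 + u ^ 2 := by nlinarith [sq_nonneg (u - 1)]
    have e5 := abs_nonneg A
    have e6 := abs_nonneg B
    have e4 : a * u ^ 2 - u ^ 4 ≤ a ^ 2 := by nlinarith [sq_nonneg (u ^ 2 - a / 2), sq_nonneg a]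
    have e7 : a * u ^ 2 = |A| * u ^ 2 + |B| * u ^ 2 + 2 * u ^ 2 := by rw [ha]; ring
    nlinarith [sq_nonneg u]
  calc u ^ k * exp (A * u ^ 2 + B * u - u ^ 4)
      ≤ (k.factorial * exp u) * exp (A * u ^ 2 + B * u - u ^ 4) := by gcongr
    _ = k.factorial * exp (A * u ^ 2 + B * u - u ^ 4 + u) := by rw [Real.exp_add]; ring
    _ ≤ k.factorial * exp (a ^ 2 + a - u) := by gcongr
    _ = _ := by rw [sub_eq_add_neg, Real.exp_add]; ring

lemma continuous_heatIntegrand (k : ℕ) (p : ℂ × ℂ) : Continuous (heatIntegrand k p) := by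
  have := continuous_Phi
  unfold heatIntegrand
  fun_prop

lemma norm_heatIntegrand_le {C : ℝ} (hC : ∀ u, 0 ≤ u → Phi u ≤ C * exp (-u ^ 4)) (k : ℕ)
    (p : ℂ × ℂ) {u : ℝ} (hu : 0 < u) {A B : ℝ} (hA : p.1.re ≤ A) (hB : |p.2.im| ≤ B) :
    ‖heatIntegrand k p u‖ ≤ C * (u ^ k * exp (A * u ^ 2 + B * u - u ^ 4)) := by
  have hP := (Phi_pos hu.le).le
  unfold heatIntegrand
  rw [norm_mul, norm_mul, norm_mul, Complex.norm_exp, norm_pow, Complex.norm_real,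
    Complex.norm_real, Real.norm_of_nonneg hu.le, Real.norm_of_nonneg hP]
  have h1 : (p.1 * (u : ℂ) ^ 2).re ≤ A * u ^ 2 := by
    have : (p.1 * (u : ℂ) ^ 2).re = p.1.re * u ^ 2 := by
      rw [← Complex.ofReal_pow, Complex.re_mul_ofReal]
    rw [this]; gcongr
  have h2 : ‖Complex.cos (p.2 * u + k * (π / 2))‖ ≤ exp (B * u) := by
    refine (norm_cos_le _).trans (Real.exp_le_exp.2 ?_)
    have : (p.2 * (u : ℂ) + k * (π / 2)).im = p.2.im * u := by
      have : (k : ℂ) * (π / 2) = ((k * (π / 2) : ℝ) : ℂ) := by push_cast; ring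
      rw [this, Complex.add_im, Complex.ofReal_im, Complex.im_mul_ofReal, add_zero]
    rw [this, abs_mul, abs_of_pos hu]; gcongr
  calc _ ≤ exp (A * u ^ 2) * (C * exp (-u ^ 4)) * u ^ k * exp (B * u) := by
        have h0 : 0 ≤ C * exp (-u ^ 4) := hP.trans (hC u hu.le)
        gcongr
        exact hC u hu.le
    _ = C * (u ^ k * exp (A * u ^ 2 + B * u - u ^ 4)) := by
        rw [sub_eq_add_neg, Real.exp_add, Real.exp_add]; ring

lemma integrable_heatIntegrand (k : ℕ) (p : ℂ × ℂ) :
    IntegrableOn (heatIntegrand k p) (Ioi 0) := by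
  obtain ⟨C, -, hC⟩ := exists_Phi_le
  refine Integrable.mono' ((integrableOn_majorant k p.1.re |p.2.im|).const_mul C)
    (continuous_heatIntegrand k p).aestronglyMeasurable ?_
  exact (ae_restrict_iff' measurableSet_Ioi).2 (Eventually.of_forall fun u (hu : 0 < u) =>
    norm_heatIntegrand_le hC k p hu le_rfl le_rfl)

lemma hasFDerivAt_heatIntegrand (k : ℕ) (p : ℂ × ℂ) (u : ℝ) :
    HasFDerivAt (fun p => heatIntegrand k p u)
      ((-heatIntegrand (k + 2) p u) • ContinuousLinearMap.fst ℂ ℂ ℂ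
        + heatIntegrand (k + 1) p u • ContinuousLinearMap.snd ℂ ℂ ℂ) p := by
  have h1 : HasFDerivAt (fun p : ℂ × ℂ => p.1 * (u : ℂ) ^ 2)
      (((u : ℂ) ^ 2) • ContinuousLinearMap.fst ℂ ℂ ℂ) p := hasFDerivAt_fst.mul_const _
  have h2 : HasFDerivAt (fun p : ℂ × ℂ => p.2 * (u : ℂ) + k * (π / 2))
      ((u : ℂ) • ContinuousLinearMap.snd ℂ ℂ ℂ) p :=
    (hasFDerivAt_snd.mul_const _).add_const _
  have h3 := (((h1.cexp).mul_const (Phi u : ℂ)).mul_const ((u : ℂ) ^ k)).mul h2.ccos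
  refine h3.congr_fderiv ?_
  have c1 : Complex.cos (p.2 * u + ((k + 1 : ℕ) : ℂ) * (π / 2))
      = -Complex.sin (p.2 * u + k * (π / 2)) := by
    rw [← Complex.cos_add_pi_div_two]; congr 1; push_cast; ring
  have c2 : Complex.cos (p.2 * u + ((k + 2 : ℕ) : ℂ) * (π / 2))
      = -Complex.cos (p.2 * u + k * (π / 2)) := by
    rw [← Complex.cos_add_pi]; congr 1; push_cast; ring
  ext <;> simp [heatIntegrand, c1, c2, -Nat.cast_add] <;> ring

lemma hasFDerivAt_heatInt (k : ℕ) (p : ℂ × ℂ) :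
    HasFDerivAt (fun p : ℂ × ℂ => heatInt k p.1 p.2)
      ((-heatInt (k + 2) p.1 p.2) • ContinuousLinearMap.fst ℂ ℂ ℂ
        + heatInt (k + 1) p.1 p.2 • ContinuousLinearMap.snd ℂ ℂ ℂ) p := by
  obtain ⟨C, hC0, hC⟩ := exists_Phi_le
  have hs : Metric.ball p 1 ∈ 𝓝 p := Metric.ball_mem_nhds p one_pos
  set A : ℝ := ‖p.1‖ + 1
  set B : ℝ := ‖p.2‖ + 1
  have hI : ∀ k, IntegrableOn (fun u : ℝ => C * (u ^ k * exp (A * u ^ 2 + B * u - u ^ 4)))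
      (Ioi 0) := fun k => (integrableOn_majorant k A B).const_mul C
  have hb : ∀ k, ∀ q ∈ Metric.ball p 1, ∀ u : ℝ, 0 < u → ‖heatIntegrand k q u‖
      ≤ C * (u ^ k * exp (A * u ^ 2 + B * u - u ^ 4)) := by
    intro k q hq u hu
    rw [mem_ball_iff_norm] at hq
    refine norm_heatIntegrand_le hC k q hu ?_ ?_
    · have h1 : ‖q.1 - p.1‖ ≤ 1 := (norm_fst_le (q - p)).trans hq.le
      have h2 := norm_le_norm_add_norm_sub' q.1 p.1
      have h3 := Complex.re_le_norm q.1
      linarith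
    · have h1 : ‖q.2 - p.2‖ ≤ 1 := (norm_snd_le (q - p)).trans hq.le
      have h2 := norm_le_norm_add_norm_sub' q.2 p.2
      have h3 := Complex.abs_im_le_norm q.2
      linarith
  have key := hasFDerivAt_integral_of_dominated_of_fderiv_le (𝕜 := ℂ)
    (μ := volume.restrict (Ioi (0 : ℝ))) (F := fun p u => heatIntegrand k p u)
    (F' := fun p u => (-heatIntegrand (k + 2) p u) • ContinuousLinearMap.fst ℂ ℂ ℂ
        + heatIntegrand (k + 1) p u • ContinuousLinearMap.snd ℂ ℂ ℂ)
    (bound := fun u : ℝ => C * (u ^ (k + 2) * exp (A * u ^ 2 + B * u - u ^ 4))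
      + C * (u ^ (k + 1) * exp (A * u ^ 2 + B * u - u ^ 4))) hs
    (Eventually.of_forall fun q => (continuous_heatIntegrand k q).aestronglyMeasurable)
    (integrable_heatIntegrand k p) ?_ ?_ ((hI _).add (hI _))
    (Eventually.of_forall fun u q _ => hasFDerivAt_heatIntegrand k q u)
  · refine key.congr_fderiv ?_
    have i1 : IntegrableOn (fun u => -heatIntegrand (k + 2) p u) (Ioi 0) :=
      (integrable_heatIntegrand (k + 2) p).neg
    have i2 := integrable_heatIntegrand (k + 1) p
    rw [integral_add (i1.smul_const _) (i2.smul_const _), integral_smul_const, integral_smul_const,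
      integral_neg]
    rfl
  · refine Continuous.aestronglyMeasurable ?_
    have h1 := continuous_heatIntegrand (k + 2) p
    have h2 := continuous_heatIntegrand (k + 1) p
    exact (h1.neg.smul continuous_const).add (h2.smul continuous_const)
  · refine (ae_restrict_iff' measurableSet_Ioi).2 (Eventually.of_forall fun u hu q hq => ?_)
    refine (norm_add_le _ _).trans (add_le_add ?_ ?_)
    · rw [norm_smul, norm_neg]
      exact (mul_le_of_le_one_right (norm_nonneg _) (ContinuousLinearMap.norm_fst_le ..)).trans
        (hb _ q hq u hu)
    · rw [norm_smul]
      exact (mul_le_of_le_one_right (norm_nonneg _) (ContinuousLinearMap.norm_snd_le ..)).trans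
        (hb _ q hq u hu)

/-- Chain rule along a real curve in the `(t, z)`-space; it contains the backward heat equation
`∂_t H_t = -H_t''`. -/
lemma hasDerivAt_heatInt_curve (k : ℕ) {α β : ℝ → ℂ} {α' β' : ℂ} {s : ℝ} (hα : HasDerivAt α α' s)
    (hβ : HasDerivAt β β' s) :
    HasDerivAt (fun s => heatInt k (α s) (β s))
      (-heatInt (k + 2) (α s) (β s) * α' + heatInt (k + 1) (α s) (β s) * β') s := by
  have h := (hasFDerivAt_heatInt k (α s, β s)).restrictScalars ℝ
  have := h.comp_hasDerivAt s (hα.prodMk hβ)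
  exact this.congr_deriv (by simp)

lemma hasDerivAt_heatInt (k : ℕ) (t z : ℂ) :
    HasDerivAt (heatInt k t) (heatInt (k + 1) t z) z := by
  have := (hasFDerivAt_heatInt k (t, z)).comp_hasDerivAt z
    ((hasDerivAt_const z t).prodMk (hasDerivAt_id z))
  exact this.congr_deriv (by simp)

lemma continuous_heatInt (k : ℕ) : Continuous fun p : ℂ × ℂ => heatInt k p.1 p.2 :=
  continuous_iff_continuousAt.2 fun p => (hasFDerivAt_heatInt k p).continuousAt

lemma differentiable_heatInt (k : ℕ) (t : ℂ) : Differentiable ℂ (heatInt k t) :=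
  fun z => (hasDerivAt_heatInt k t z).differentiableAt

lemma deriv_heatInt (k : ℕ) (t : ℂ) : deriv (heatInt k t) = heatInt (k + 1) t :=
  funext fun z => (hasDerivAt_heatInt k t z).deriv

lemma heatInt_zero_neg (t z : ℂ) : heatInt 0 t (-z) = heatInt 0 t z := by
  unfold heatInt heatIntegrand
  simp

/-- `H_t(z)` has order at most `3/2` for `t ≤ 0` (in fact it has order one). -/
lemma exists_norm_heatInt_le : ∃ C : ℝ, 0 < C ∧ ∀ t : ℝ, t ≤ 0 → ∀ z : ℂ, ∀ R : ℝ, 1 ≤ R →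
    ‖z‖ ≤ R ^ 2 → ‖heatInt 0 t z‖ ≤ C * exp (R ^ 3) := by
  obtain ⟨C, hC0, hC⟩ := exists_Phi_le
  have hI : IntegrableOn (fun u : ℝ => C * exp (u ^ 3 - u ^ 4)) (Ioi 0) := by
    refine Integrable.mono' ((integrableOn_exp_neg_Ioi 0).const_mul (C * exp 1))
      (by fun_prop) ((ae_restrict_iff' measurableSet_Ioi).2
        (Eventually.of_forall fun u (hu : 0 < u) => ?_))
    rw [Real.norm_of_nonneg (by positivity), mul_assoc, ← Real.exp_add]
    have : u ^ 3 - u ^ 4 ≤ 1 + -u := by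
      nlinarith [mul_nonneg (sq_nonneg (u - 1)) (by positivity : 0 ≤ u ^ 2 + u + 1)]
    gcongr
  refine ⟨(∫ u in Ioi (0 : ℝ), C * exp (u ^ 3 - u ^ 4)) + 1, ?_, fun t ht z R hR hz => ?_⟩
  · have : 0 ≤ ∫ u in Ioi (0 : ℝ), C * exp (u ^ 3 - u ^ 4) :=
      integral_nonneg fun u => by positivity
    linarith
  · unfold heatInt
    have h1 : ‖∫ u in Ioi (0 : ℝ), heatIntegrand 0 (t, z) u‖
        ≤ ∫ u in Ioi (0 : ℝ), exp (R ^ 3) * (C * exp (u ^ 3 - u ^ 4)) := by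
      refine norm_integral_le_of_norm_le (hI.const_mul _) ?_
      refine (ae_restrict_iff' measurableSet_Ioi).2 (Eventually.of_forall fun u (hu : 0 < u) => ?_)
      refine (norm_heatIntegrand_le hC 0 ((t : ℂ), z) hu (A := 0) (B := R ^ 2) (by simpa using ht)
        ((Complex.abs_im_le_norm z).trans hz)).trans ?_
      have h2 : R ^ 2 * u ≤ R ^ 3 + u ^ 3 := by
        rcases le_total u R with h | h
        · have : R ^ 2 * u ≤ R ^ 2 * R := by gcongr
          nlinarith [pow_pos hu 3]
        · have : R ^ 2 * u ≤ u ^ 2 * u := by gcongr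
          nlinarith [pow_pos (lt_of_lt_of_le one_pos hR) 3]
      have h3 : exp (0 * u ^ 2 + R ^ 2 * u - u ^ 4) ≤ exp (R ^ 3) * exp (u ^ 3 - u ^ 4) := by
        rw [← Real.exp_add]; apply Real.exp_le_exp.2; linarith
      calc C * (u ^ 0 * exp (0 * u ^ 2 + R ^ 2 * u - u ^ 4))
          ≤ C * (u ^ 0 * (exp (R ^ 3) * exp (u ^ 3 - u ^ 4))) := by gcongr
        _ = _ := by ring
    rw [integral_const_mul] at h1
    have := Real.exp_pos (R ^ 3)
    nlinarith

lemma heatInt_zero_pos (t : ℝ) : 0 < (heatInt 0 t 0).re := by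
  have h := integrable_heatIntegrand 0 ((t : ℂ), 0)
  have he : heatInt 0 t 0 = ((∫ u in Ioi (0 : ℝ), exp (t * u ^ 2) * Phi u : ℝ) : ℂ) := by
    unfold heatInt
    rw [← integral_complex_ofReal]
    refine integral_congr_ae (Eventually.of_forall fun u => ?_)
    simp [heatIntegrand]
  rw [he, Complex.ofReal_re]
  have hI : IntegrableOn (fun u : ℝ => exp (t * u ^ 2) * Phi u) (Ioi 0) := by
    have := h.re
    refine this.congr (Eventually.of_forall fun u => ?_)
    simp [heatIntegrand, ← Complex.ofReal_pow, ← Complex.ofReal_mul, ← Complex.ofReal_exp]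
  refine (setIntegral_pos_iff_support_of_nonneg_ae ?_ hI).2 ?_
  · exact (ae_restrict_iff' measurableSet_Ioi).2 (Eventually.of_forall fun u (hu : 0 < u) =>
      (mul_pos (Real.exp_pos _) (Phi_pos hu.le)).le)
  · have : (Function.support fun u : ℝ => exp (t * u ^ 2) * Phi u) ∩ Ioi 0 = Ioi 0 := by
      refine inter_eq_right.2 fun u hu => ?_
      exact (mul_pos (Real.exp_pos _) (Phi_pos (le_of_lt hu))).ne'
    rw [this]; simp

/-! ### Real-rooted polynomials and imaginary averages -/

/-- All zeros of the polynomial are real (the zero polynomial is admitted). -/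
def RealRooted (p : Polynomial ℂ) : Prop := p = 0 ∨ ∀ z, p.eval z = 0 → z.im = 0

/-- `|f (x + iy)|` is a nondecreasing function of `|y|`, for every real `x`. -/
def VertMono (f : ℂ → ℂ) : Prop :=
  ∀ z w : ℂ, z.re = w.re → |z.im| ≤ |w.im| → ‖f z‖ ≤ ‖f w‖

lemma norm_sub_le_of_abs_im_le {z w r : ℂ} (hr : r.im = 0) (h : z.re = w.re)
    (h' : |z.im| ≤ |w.im|) : ‖z - r‖ ≤ ‖w - r‖ := by
  rw [Complex.norm_def, Complex.norm_def]
  apply Real.sqrt_le_sqrt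
  simp only [Complex.normSq_apply, Complex.sub_re, Complex.sub_im, hr, h]
  have := sq_le_sq' (by linarith [abs_nonneg w.im, neg_abs_le z.im, abs_nonneg z.im]) h'
  rw [sq_abs, sq_abs] at this
  nlinarith

lemma norm_sub_lt_of_abs_im_lt {z w r : ℂ} (hr : r.im = 0) (h : z.re = w.re)
    (h' : |z.im| < |w.im|) : ‖z - r‖ < ‖w - r‖ := by
  rw [Complex.norm_def, Complex.norm_def]
  apply Real.sqrt_lt_sqrt (Complex.normSq_nonneg _)
  simp only [Complex.normSq_apply, Complex.sub_re, Complex.sub_im, hr, h]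
  have := sq_lt_sq' (by linarith [abs_nonneg w.im, neg_abs_le z.im, abs_nonneg z.im]) h'
  rw [sq_abs, sq_abs] at this
  nlinarith

lemma RealRooted.vertMono {p : Polynomial ℂ} (hp : RealRooted p) :
    VertMono fun z => p.eval z := by
  rcases hp with rfl | hp
  · intro z w _ _; simp
  rcases eq_or_ne p 0 with rfl | hp0
  · intro z w _ _; simp
  intro z w hre him
  have key : ∀ s : Multiset ℂ, (∀ r ∈ s, r.im = 0) →
      ‖(s.map fun r => z - r).prod‖ ≤ ‖(s.map fun r => w - r).prod‖ := by
    intro s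
    induction s using Multiset.induction with
    | empty => simp
    | cons a s ih =>
      intro hs
      rw [Multiset.map_cons, Multiset.prod_cons, Multiset.map_cons, Multiset.prod_cons, norm_mul,
        norm_mul]
      exact mul_le_mul (norm_sub_le_of_abs_im_le (hs a (Multiset.mem_cons_self a s)) hre him)
        (ih fun r hr => hs r (Multiset.mem_cons_of_mem hr)) (norm_nonneg _) (norm_nonneg _)
  have hev : ∀ z, p.eval z = p.leadingCoeff * (p.roots.map fun r => z - r).prod := by
    intro z
    exact (IsAlgClosed.splits p).eval_eq_prod_roots z
  simp only [hev, norm_mul]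
  gcongr
  exact key _ fun r hr => hp r ((Polynomial.mem_roots hp0).1 hr)

/-- Gauss-Lucas: the zeros of `p'` lie in the convex hull of those of `p`. -/
lemma RealRooted.derivative {p : Polynomial ℂ} (hp : RealRooted p) :
    RealRooted (Polynomial.derivative p) := by
  rcases hp with rfl | hp
  · left; simp
  by_cases hd : 0 < p.degree
  · right
    intro z hz
    have h0 : Polynomial.derivative p ≠ 0 := by
      intro h
      have := Polynomial.derivative_eq_zero.1 h
      have h2 := Polynomial.natDegree_pos_iff_degree_pos.2 hd
      omega
    have hz' : z ∈ (Polynomial.derivative p).rootSet ℂ := by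
      rw [Polynomial.mem_rootSet]; exact ⟨h0, by simpa using hz⟩
    have := Polynomial.rootSet_derivative_subset_convexHull_rootSet hd hz'
    have hconv : Convex ℝ {z : ℂ | z.im = 0} := by
      intro a ha b hb s t _ _ _
      simp only [mem_ofPred_eq] at *
      simp [ha, hb]
    refine convexHull_min ?_ hconv this
    intro w hw
    rw [Polynomial.mem_rootSet] at hw
    exact hp w (by simpa using hw.2)
  · left
    have : p.natDegree = 0 := by
      by_contra h
      exact hd (Polynomial.natDegree_pos_iff_degree_pos.1 (Nat.pos_of_ne_zero h))
    rw [Polynomial.eq_C_of_natDegree_eq_zero this, Polynomial.derivative_C]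

/-- De Bruijn's averaging operator `f ↦ (f(· + ia) + f(· - ia)) / 2`. On cosine transforms it
multiplies the density by `cosh (a u)`. -/
def imagAverage (a : ℝ) (f : ℂ → ℂ) (z : ℂ) : ℂ :=
  (f (z + a * Complex.I) + f (z - a * Complex.I)) / 2

/-- Averaging preserves real-rootedness: at a zero `z` of the average, `p` has equal modulus at
`z ± i a`, whereas the modulus is strictly larger at the point further from the real axis when `z` is
not real. -/
lemma RealRooted.imagAverage {p : Polynomial ℂ} (hp : RealRooted p) {a : ℝ} (ha : 0 < a) :
    ∃ q : Polynomial ℂ, RealRooted q ∧ (fun z => q.eval z) = imagAverage a fun z => p.eval z := by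
  refine ⟨Polynomial.C (1 / 2) * (p.comp (Polynomial.X + Polynomial.C (a * Complex.I))
    + p.comp (Polynomial.X - Polynomial.C (a * Complex.I))), ?_, ?_⟩
  swap
  · funext z; simp [DBN.imagAverage]; ring
  have hM := hp.vertMono
  rcases hp with rfl | hp
  · left; simp
  rcases eq_or_ne p 0 with rfl | hp0
  · left; simp
  right
  intro z hz
  by_contra him
  simp only [Polynomial.eval_mul, Polynomial.eval_C, Polynomial.eval_add, Polynomial.eval_comp,
    Polynomial.eval_X, Polynomial.eval_sub, mul_eq_zero] at hz
  have hz : p.eval (z + a * Complex.I) = -p.eval (z - a * Complex.I) := by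
    rcases hz with h | h
    · norm_num at h
    · exact eq_neg_of_add_eq_zero_left h
  have hnorm : ‖p.eval (z + a * Complex.I)‖ = ‖p.eval (z - a * Complex.I)‖ := by
    rw [hz, norm_neg]
  have hstrict : ∀ v w : ℂ, v.re = w.re → |v.im| < |w.im| →
      ‖p.eval v‖ = ‖p.eval w‖ → p.eval v = -p.eval w → False := by
    intro v w hre hvw heq hneg
    have hw0 : p.eval w ≠ 0 := by
      intro h
      have := hp w h
      rw [this, abs_zero] at hvw
      exact absurd hvw (not_lt.2 (abs_nonneg _))
    by_cases hd : 0 < p.degree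
    · obtain ⟨r, hr⟩ := IsAlgClosed.exists_root p hd.ne'
      obtain ⟨q, rfl⟩ := Polynomial.dvd_iff_isRoot.2 hr
      have hq : RealRooted q := Or.inr fun z hz => hp z (by simp [hz])
      have hrim : r.im = 0 := hp r hr
      simp only [Polynomial.eval_mul, Polynomial.eval_sub, Polynomial.eval_X, Polynomial.eval_C,
        norm_mul] at heq hw0
      have h1 := norm_sub_lt_of_abs_im_lt hrim hre hvw
      have h2 := hq.vertMono v w hre hvw.le
      have h3 : 0 < ‖q.eval w‖ := norm_pos_iff.2 fun h => hw0 (by simp [h])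
      have : ‖v - r‖ * ‖q.eval v‖ < ‖w - r‖ * ‖q.eval w‖ :=
        lt_of_le_of_lt (mul_le_mul_of_nonneg_left h2 (norm_nonneg _))
          (mul_lt_mul_of_pos_right h1 h3)
      exact this.ne heq
    · have : p.natDegree = 0 := by
        by_contra h
        exact hd (Polynomial.natDegree_pos_iff_degree_pos.1 (Nat.pos_of_ne_zero h))
      rw [Polynomial.eq_C_of_natDegree_eq_zero this] at hneg hw0
      simp only [Polynomial.eval_C] at hneg hw0
      exact hw0 (self_eq_neg.1 hneg)
  rcases lt_or_gt_of_ne him with h | h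
  · refine hstrict (z + a * Complex.I) (z - a * Complex.I) (by simp) ?_ hnorm hz
    simp only [Complex.add_im, Complex.mul_im, Complex.ofReal_re, Complex.I_im, mul_one,
      Complex.ofReal_im, Complex.I_re, mul_zero, add_zero, Complex.sub_im]
    rw [abs_of_neg (by linarith : z.im - a < 0), abs_lt]
    constructor <;> linarith
  · refine hstrict (z - a * Complex.I) (z + a * Complex.I) (by simp) ?_ hnorm.symm
      (by rw [hz, neg_neg])
    simp only [Complex.add_im, Complex.mul_im, Complex.ofReal_re, Complex.I_im, mul_one,
      Complex.ofReal_im, Complex.I_re, mul_zero, add_zero, Complex.sub_im]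
    rw [abs_of_pos (by linarith : 0 < z.im + a), abs_lt]
    constructor <;> linarith

lemma VertMono.of_tendsto {F : ℕ → ℂ → ℂ} {f : ℂ → ℂ} (hF : ∀ n, VertMono (F n))
    (h : ∀ z, Tendsto (fun n => F n z) atTop (𝓝 (f z))) : VertMono f := fun z w hre him =>
  le_of_tendsto_of_tendsto' (h z).norm (h w).norm fun n => hF n z w hre him

lemma RealRooted.iterate_imagAverage {p : Polynomial ℂ} (hp : RealRooted p) {a : ℝ} (ha : 0 < a)
    (N : ℕ) : ∃ q : Polynomial ℂ, RealRooted q ∧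
      (fun z => q.eval z) = (DBN.imagAverage a)^[N] fun z => p.eval z := by
  induction N with
  | zero => exact ⟨p, hp, rfl⟩
  | succ N ih =>
    obtain ⟨q, hq, he⟩ := ih
    obtain ⟨q', hq', he'⟩ := hq.imagAverage ha
    exact ⟨q', hq', by rw [Function.iterate_succ_apply', he', he]⟩

lemma tendsto_iterate_imagAverage {F : ℕ → ℂ → ℂ} {f : ℂ → ℂ}
    (h : ∀ z, Tendsto (fun n => F n z) atTop (𝓝 (f z))) (a : ℝ) (N : ℕ) (z : ℂ) :
    Tendsto (fun n => (imagAverage a)^[N] (F n) z) atTop (𝓝 ((imagAverage a)^[N] f z)) := by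
  induction N generalizing z with
  | zero => exact h z
  | succ N ih =>
    simp only [Function.iterate_succ_apply']
    exact ((ih _).add (ih _)).div_const 2

lemma integrable_cosh_pow_mul (a : ℝ) (N k : ℕ) (p : ℂ × ℂ) :
    IntegrableOn (fun u => (cosh (a * u) ^ N : ℂ) * heatIntegrand k p u) (Ioi 0) := by
  obtain ⟨C, -, hC⟩ := exists_Phi_le
  refine Integrable.mono' ((integrableOn_majorant k (N * (a ^ 2 / 2) + p.1.re)
    |p.2.im|).const_mul C) ?_ ?_
  · have := continuous_heatIntegrand k p
    exact Continuous.aestronglyMeasurable (by fun_prop)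
  refine (ae_restrict_iff' measurableSet_Ioi).2 (Eventually.of_forall fun u (hu : 0 < u) => ?_)
  have h1 := norm_heatIntegrand_le hC k p hu le_rfl le_rfl
  have h2 : ‖(cosh (a * u) ^ N : ℂ)‖ ≤ exp (N * (a ^ 2 / 2) * u ^ 2) := by
    rw [norm_pow, Complex.norm_real,
      Real.norm_of_nonneg (Real.cosh_pos _).le]
    calc cosh (a * u) ^ N ≤ exp ((a * u) ^ 2 / 2) ^ N := by
          gcongr
          exact Real.cosh_le_exp_half_sq _
      _ = _ := by rw [← Real.exp_nat_mul]; congr 1; ring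
  rw [norm_mul]
  calc _ ≤ exp (N * (a ^ 2 / 2) * u ^ 2) *
        (C * (u ^ k * exp (p.1.re * u ^ 2 + |p.2.im| * u - u ^ 4))) := by gcongr
    _ = C * (u ^ k * (exp (N * (a ^ 2 / 2) * u ^ 2) *
        exp (p.1.re * u ^ 2 + |p.2.im| * u - u ^ 4))) := by ring
    _ = _ := by rw [← Real.exp_add]; ring_nf

lemma iterate_imagAverage_heatInt (k : ℕ) (t : ℂ) (a : ℝ) (N : ℕ) (z : ℂ) :
    (imagAverage a)^[N] (heatInt k t) z
      = ∫ u in Ioi (0 : ℝ), (cosh (a * u) ^ N : ℂ) * heatIntegrand k (t, z) u := by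
  induction N generalizing z with
  | zero => simp [heatInt]
  | succ N ih =>
    rw [Function.iterate_succ_apply', imagAverage, ih, ih,
      ← integral_add (integrable_cosh_pow_mul ..) (integrable_cosh_pow_mul ..), ← integral_div]
    refine integral_congr_ae (Eventually.of_forall fun u => ?_)
    have hc : Complex.cos ((z + a * Complex.I) * u + k * (π / 2))
        + Complex.cos ((z - a * Complex.I) * u + k * (π / 2))
        = 2 * (Complex.cos (z * u + k * (π / 2)) * Complex.cosh (a * u)) := by
      rw [show (z + a * Complex.I) * u + k * (π / 2) = (z * u + k * (π / 2)) + (a * u) * Complex.I by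
        ring, show (z - a * Complex.I) * u + k * (π / 2)
          = (z * u + k * (π / 2)) - (a * u) * Complex.I by ring, Complex.cos_add, Complex.cos_sub,
        Complex.cos_mul_I]
      ring
    simp only [heatIntegrand]
    rw [pow_succ _ N, Complex.ofReal_cosh, Complex.ofReal_mul]
    generalize Complex.exp (t * (u : ℂ) ^ 2) = E
    linear_combination ((Complex.cosh (a * u) ^ N) * (E * Phi u * u ^ k) / 2) * hc

lemma one_add_sq_div_two_le_cosh (x : ℝ) : 1 + x ^ 2 / 2 ≤ cosh x := by
  have h1 : cosh x = cosh (x / 2) ^ 2 + sinh (x / 2) ^ 2 := by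
    rw [← Real.cosh_two_mul]; congr 1; ring
  have h2 : (x / 2) ^ 2 ≤ sinh (x / 2) ^ 2 := by
    rcases le_total 0 (x / 2) with h | h
    · have := Real.self_le_sinh_iff.2 h
      gcongr
    · have := Real.sinh_le_self_iff.2 h
      nlinarith
  have h3 := Real.cosh_sq (x / 2)
  nlinarith

/-- The powers are dominated by their limit, uniformly in `N`. -/
lemma cosh_pow_le {c : ℝ} (hc : 0 ≤ c) (u : ℝ) (N : ℕ) :
    cosh (√(2 * c / N) * u) ^ N ≤ exp (c * u ^ 2) := by
  rcases Nat.eq_zero_or_pos N with rfl | hN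
  · simp; positivity
  have hs : (√(2 * c / N) * u) ^ 2 = 2 * c / N * u ^ 2 := by
    rw [mul_pow, Real.sq_sqrt (by positivity)]
  calc cosh (√(2 * c / N) * u) ^ N ≤ exp ((√(2 * c / N) * u) ^ 2 / 2) ^ N := by
        gcongr
        exact Real.cosh_le_exp_half_sq _
    _ = exp (c * u ^ 2) := by
        rw [hs, ← Real.exp_nat_mul]; congr 1; field_simp

lemma tendsto_cosh_pow {c : ℝ} (hc : 0 ≤ c) (u : ℝ) :
    Tendsto (fun N : ℕ => cosh (√(2 * c / N) * u) ^ N) atTop (𝓝 (exp (c * u ^ 2))) := by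
  have h := Real.tendsto_one_add_div_pow_exp (c * u ^ 2)
  refine tendsto_of_tendsto_of_tendsto_of_le_of_le h tendsto_const_nhds (fun N => ?_) (fun N => ?_)
  · rcases Nat.eq_zero_or_pos N with rfl | hN
    · simp
    have hs : (√(2 * c / N) * u) ^ 2 = 2 * c / N * u ^ 2 := by
      rw [mul_pow, Real.sq_sqrt (by positivity)]
    have h1 := one_add_sq_div_two_le_cosh (√(2 * c / N) * u)
    show (1 + c * u ^ 2 / N) ^ N ≤ _
    gcongr
    refine le_trans (le_of_eq ?_) h1
    rw [hs]; ring
  · exact cosh_pow_le hc u N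

/-- Iterated imaginary averages realise the heat flow in the direction of increasing time, since
`cosh (√(2c/N) u) ^ N → exp (c u²)`. -/
lemma tendsto_iterate_imagAverage_heatInt (k : ℕ) (t : ℝ) {c : ℝ} (hc : 0 ≤ c) (z : ℂ) :
    Tendsto (fun N : ℕ => (imagAverage (√(2 * c / N)))^[N] (heatInt k t) z) atTop
      (𝓝 (heatInt k (t + c : ℝ) z)) := by
  obtain ⟨C, -, hC⟩ := exists_Phi_le
  simp only [iterate_imagAverage_heatInt]
  refine tendsto_integral_of_dominated_convergence
    (fun u => C * (u ^ k * exp ((c + t) * u ^ 2 + |z.im| * u - u ^ 4)))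
    (fun N => (integrable_cosh_pow_mul _ N k _).aestronglyMeasurable)
    ((integrableOn_majorant k (c + t) |z.im|).const_mul C) (fun N => ?_) ?_
  · refine (ae_restrict_iff' measurableSet_Ioi).2 (Eventually.of_forall fun u (hu : 0 < u) => ?_)
    have h1 := norm_heatIntegrand_le hC k ((t : ℂ), z) hu le_rfl le_rfl
    rw [norm_mul, norm_pow, Complex.norm_real,
      Real.norm_of_nonneg (Real.cosh_pos _).le]
    calc _ ≤ exp (c * u ^ 2) * (C * (u ^ k * exp (t * u ^ 2 + |z.im| * u - u ^ 4))) := by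
          gcongr
          · exact cosh_pow_le hc u N
          · simpa using h1
      _ = C * (u ^ k * (exp (c * u ^ 2) * exp (t * u ^ 2 + |z.im| * u - u ^ 4))) := by ring
      _ = _ := by rw [← Real.exp_add]; ring_nf
  · refine Eventually.of_forall fun u => ?_
    have h1 := (Complex.continuous_ofReal.tendsto _).comp (tendsto_cosh_pow hc u)
    have h2 := h1.mul_const (heatIntegrand k ((t : ℂ), z) u)
    have h3 : heatIntegrand k (((t + c : ℝ) : ℂ), z) u
        = ((exp (c * u ^ 2) : ℝ) : ℂ) * heatIntegrand k ((t : ℂ), z) u := by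
      simp only [heatIntegrand]
      push_cast
      rw [add_mul, Complex.exp_add]; ring
    rw [h3]
    refine h2.congr fun N => ?_
    simp

/-! ### Even entire functions of order less than two with real zeros -/

/-- Even entire functions of order at most `3/2`, not vanishing at the origin and with only real
zeros. -/
structure RealZeroEven (f : ℂ → ℂ) : Prop where
  diff : Differentiable ℂ f
  even : ∀ z, f (-z) = f z
  zero_ne : f 0 ≠ 0
  real : ∀ z, f z = 0 → z.im = 0
  growth : ∃ C : ℝ, 0 < C ∧ ∀ R : ℝ, 1 ≤ R → ∀ z : ℂ, ‖z‖ ≤ R ^ 2 → ‖f z‖ ≤ C * exp (R ^ 3)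

/-- The even polynomial `∏_{ρ ∈ s} (1 - z² / ρ²)`. -/
def zeroProd (s : Multiset ℝ) (z : ℂ) : ℂ := (s.map fun ρ : ℝ => 1 - z ^ 2 / (ρ : ℂ) ^ 2).prod

/-- `f = ∏_{ρ ∈ s} (1 - z² / ρ²) · g` with `g` even and entire, and all `ρ` in `(0, R]`. -/
structure EvenFactor (f : ℂ → ℂ) (R : ℝ) (s : Multiset ℝ) (g : ℂ → ℂ) : Prop where
  diff : Differentiable ℂ g
  even : ∀ z, g (-z) = g z
  mem : ∀ ρ ∈ s, 0 < ρ ∧ ρ ≤ R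
  eq : ∀ z, f z = zeroProd s z * g z

lemma zeroProd_zero_right (s : Multiset ℝ) : zeroProd s 0 = 1 := by
  induction s using Multiset.induction with
  | empty => simp [zeroProd]
  | cons a s ih => simp [zeroProd]

lemma zeroProd_cons (a : ℝ) (s : Multiset ℝ) (z : ℂ) :
    zeroProd (a ::ₘ s) z = (1 - z ^ 2 / (a : ℂ) ^ 2) * zeroProd s z := by
  simp [zeroProd]

lemma EvenFactor.map_zero {f g : ℂ → ℂ} {R : ℝ} {s : Multiset ℝ} (h : EvenFactor f R s g) :
    g 0 = f 0 := by
  rw [h.eq, zeroProd_zero_right, one_mul]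

/-- On the circle of radius `3 R`, each factor `1 - z² / ρ²` with `ρ ≤ R` has modulus at least
`3² - 1`. -/
lemma pow_card_le_norm_zeroProd {R : ℝ} {s : Multiset ℝ}
    (hs : ∀ ρ ∈ s, 0 < ρ ∧ ρ ≤ R) {z : ℂ} (hz : ‖z‖ = 3 * R) : 8 ^ s.card ≤ ‖zeroProd s z‖ := by
  induction s using Multiset.induction with
  | empty => simp [zeroProd]
  | cons a s ih =>
    rw [zeroProd_cons, norm_mul, Multiset.card_cons, pow_succ']
    obtain ⟨h1, h2⟩ := hs a (Multiset.mem_cons_self a s)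
    refine mul_le_mul ?_ (ih fun ρ hρ => hs ρ (Multiset.mem_cons_of_mem hρ)) (by positivity)
      (norm_nonneg _)
    have h3 := norm_sub_norm_le (z ^ 2 / (a : ℂ) ^ 2) 1
    rw [norm_div, norm_pow, norm_pow, Complex.norm_real, Real.norm_of_nonneg h1.le, norm_one, hz,
      norm_sub_rev] at h3
    refine le_trans ?_ h3
    rw [le_sub_iff_add_le, le_div_iff₀ (by positivity)]
    nlinarith

/-- Jensen-type inequality, from the maximum principle on the disc of radius `3 R`. -/
lemma EvenFactor.norm_le {f g : ℂ → ℂ} {R M : ℝ} {s : Multiset ℝ} (hR : 0 < R)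
    (h : EvenFactor f R s g) (hM : ∀ z : ℂ, ‖z‖ = 3 * R → ‖f z‖ ≤ M) {z : ℂ}
    (hz : ‖z‖ ≤ 3 * R) : ‖g z‖ ≤ M / 8 ^ s.card := by
  have h3R : (3 * R) ≠ 0 := by positivity
  refine Complex.norm_le_of_forall_mem_frontier_norm_le (U := Metric.ball 0 (3 * R))
    Metric.isBounded_ball h.diff.diffContOnCl (fun w hw => ?_) ?_
  · rw [frontier_ball _ h3R, mem_sphere_zero_iff_norm] at hw
    rw [le_div_iff₀ (by positivity), mul_comm]
    calc 8 ^ s.card * ‖g w‖ ≤ ‖zeroProd s w‖ * ‖g w‖ := by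
          gcongr; exact pow_card_le_norm_zeroProd h.mem hw
      _ = ‖f w‖ := by rw [h.eq, norm_mul]
      _ ≤ M := hM w hw
  · rw [closure_ball _ h3R]; simpa using hz

/-- One pair of zeros `±ρ` can be split off. -/
lemma EvenFactor.exists_cons {f g : ℂ → ℂ} {R : ℝ} {s : Multiset ℝ} (hf : RealZeroEven f)
    (h : EvenFactor f R s g) {z : ℂ} (hz : ‖z‖ ≤ R) (hg : g z = 0) :
    ∃ ρ g', EvenFactor f R (ρ ::ₘ s) g' := by
  have hfz : f z = 0 := by rw [h.eq, hg, mul_zero]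
  have him := hf.real z hfz
  have hzre : z = (z.re : ℂ) := Complex.ext (by simp) (by simp [him])
  have hne : z.re ≠ 0 := by
    intro h0
    rw [h0, Complex.ofReal_zero] at hzre
    rw [hzre] at hfz
    exact hf.zero_ne hfz
  have hzero : g (|z.re| : ℝ) = 0 := by
    rcases abs_choice z.re with h1 | h1 <;> rw [h1]
    · rw [← hzre]; exact hg
    · rw [Complex.ofReal_neg, h.even, ← hzre]; exact hg
  set ρ := |z.re| with hρ
  have hρ0 : 0 < ρ := abs_pos.2 hne
  have hρR : ρ ≤ R := (Complex.abs_re_le_norm z).trans hz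
  have hρc : (ρ : ℂ) ≠ 0 := by exact_mod_cast hρ0.ne'
  have hdiff : ∀ (G : ℂ → ℂ) (c : ℂ), Differentiable ℂ G → Differentiable ℂ (dslope G c) :=
    fun G c hG => differentiableOn_univ.1
      ((Complex.differentiableOn_dslope univ_mem).2 hG.differentiableOn)
  set h1 := dslope g ρ
  have e1 : ∀ w, g w = (w - ρ) * h1 w := by
    intro w
    have := sub_smul_dslope g (ρ : ℂ) w
    rw [hzero, sub_zero, smul_eq_mul] at this
    exact this.symm
  have hzero' : h1 (-ρ) = 0 := by
    have := e1 (-ρ)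
    rw [h.even, hzero] at this
    rcases mul_eq_zero.1 this.symm with h2 | h2
    · exfalso; apply hρc; linear_combination (-1 / 2) * h2
    · exact h2
  set h2 := dslope h1 (-ρ)
  have e2 : ∀ w, h1 w = (w + ρ) * h2 w := by
    intro w
    have := sub_smul_dslope h1 (-ρ : ℂ) w
    rw [hzero', sub_zero, smul_eq_mul, sub_neg_eq_add] at this
    exact this.symm
  have hd : Differentiable ℂ h2 := hdiff _ _ (hdiff _ _ h.diff)
  have e3 : ∀ w, g w = (1 - w ^ 2 / (ρ : ℂ) ^ 2) * (-ρ ^ 2 * h2 w) := by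
    intro w
    rw [e1, e2]; field_simp; ring
  refine ⟨ρ, fun w => -ρ ^ 2 * h2 w, hd.const_mul _, ?_, ?_, ?_⟩
  · have hc1 : Continuous fun w => -(ρ : ℂ) ^ 2 * h2 (-w) :=
      continuous_const.mul (hd.continuous.comp continuous_neg)
    have hc2 : Continuous fun w => -(ρ : ℂ) ^ 2 * h2 w := continuous_const.mul hd.continuous
    have hdense : Dense ({(ρ : ℂ), -(ρ : ℂ)}ᶜ : Set ℂ) :=
      (Set.toFinite _).countable.dense_compl ℝ
    have := Continuous.ext_on hdense hc1 hc2 (fun w hw => ?_)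
    · exact fun w => congrFun this w
    · have h5 := h.even w
      rw [e3, e3 w, neg_sq] at h5
      refine mul_left_cancel₀ ?_ h5
      intro h6
      have h7 : w ^ 2 = (ρ : ℂ) ^ 2 := by
        field_simp at h6
        linear_combination -h6
      rcases sq_eq_sq_iff_eq_or_eq_neg.1 h7 with h8 | h8 <;> simp [h8] at hw
  · intro x hx
    rcases Multiset.mem_cons.1 hx with rfl | hx
    · exact ⟨hρ0, hρR⟩
    · exact h.mem x hx
  · intro w
    rw [h.eq, zeroProd_cons, e3 w]; ring

lemma RealZeroEven.exists_bound {f : ℂ → ℂ} (hf : RealZeroEven f) (R : ℝ) :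
    ∃ M, 0 < M ∧ ∀ z : ℂ, ‖z‖ ≤ R → ‖f z‖ ≤ M := by
  obtain ⟨M, hM⟩ := (isCompact_closedBall (0 : ℂ) R).exists_bound_of_continuousOn
    hf.diff.continuous.continuousOn
  exact ⟨max M 1, by positivity, fun z hz => (hM z (by simpa using hz)).trans (le_max_left _ _)⟩

/-- All zeros in a disc can be split off. The process stops since `8 ^ n ≤ M / |f 0|` when `n`
pairs have been split off, `M` being the maximum of `|f|` on the disc of radius `3 R`. -/
lemma RealZeroEven.exists_evenFactor {f : ℂ → ℂ} (hf : RealZeroEven f) {R : ℝ} (hR : 0 < R) :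
    ∃ s g, EvenFactor f R s g ∧ ∀ z : ℂ, ‖z‖ ≤ R → g z ≠ 0 := by
  by_contra! hcon
  have hall : ∀ n : ℕ, ∃ s g, EvenFactor f R s g ∧ s.card = n := by
    intro n
    induction n with
    | zero => exact ⟨0, f, ⟨hf.diff, hf.even, by simp, by simp [zeroProd]⟩, rfl⟩
    | succ n ih =>
      obtain ⟨s, g, hs, hn⟩ := ih
      obtain ⟨z, hz, hgz⟩ := hcon s g hs
      obtain ⟨ρ, g', hg'⟩ := hs.exists_cons hf hz hgz
      exact ⟨_, g', hg', by simp [hn]⟩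
  obtain ⟨M, hM0, hM⟩ := hf.exists_bound (3 * R)
  have hf0 : 0 < ‖f 0‖ := norm_pos_iff.2 hf.zero_ne
  obtain ⟨n, hn⟩ := pow_unbounded_of_one_lt (M / ‖f 0‖) (by norm_num : (1 : ℝ) < 8)
  obtain ⟨s, g, hs, rfl⟩ := hall n
  have := hs.norm_le hR (fun z hz => hM z hz.le) (z := 0) (by simp; positivity)
  rw [hs.map_zero, le_div_iff₀ (by positivity)] at this
  rw [div_lt_iff₀ hf0] at hn
  linarith

/-- An even function without zeros in a disc of radius `R` is nearly constant close to the centre,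
if it is not too large: Borel–Carathéodory for its logarithm, which vanishes to second order. -/
lemma norm_logDeriv_le_of_even {g : ℂ → ℂ} {R M : ℝ} (hR : 0 < R) (hg : Differentiable ℂ g)
    (heven : ∀ z, g (-z) = g z) (hne : ∀ z : ℂ, ‖z‖ ≤ R → g z ≠ 0)
    (hM : ∀ z : ℂ, ‖z‖ ≤ R → ‖g z‖ ≤ M) :
    ∃ h : ℂ → ℂ, ∀ z : ℂ, ‖z‖ ≤ R / 8 → g z = g 0 * Complex.exp (h z) ∧
      ‖h z‖ ≤ 64 * (log (M / ‖g 0‖) + 1) / R ^ 2 * ‖z‖ * ‖z‖ ∧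
      ‖logDeriv g z‖ ≤ 64 * (log (M / ‖g 0‖) + 1) / R ^ 2 * ‖z‖ := by
  set A := log (M / ‖g 0‖) + 1 with hA
  have hg0 : 0 < ‖g 0‖ := norm_pos_iff.2 (hne 0 (by simpa using hR.le))
  have hM0 : ‖g 0‖ ≤ M := hM 0 (by simpa using hR.le)
  have hA0 : 0 < A := by
    have : 0 ≤ log (M / ‖g 0‖) := Real.log_nonneg (by rwa [le_div_iff₀ hg0, one_mul])
    linarith
  have hdg : Differentiable ℂ (deriv g) := hg.deriv
  have hq : DifferentiableOn ℂ (logDeriv g) (Metric.ball 0 R) := by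
    intro z hz
    exact ((hdg z).div (hg z) (hne z (by simpa using (mem_ball_zero_iff.1 hz).le))).differentiableWithinAt
  obtain ⟨h, h0, hh⟩ := hq.isExactOn_ball.with_val_at 0 0
  have hexp : ∀ z ∈ Metric.ball (0 : ℂ) R, g z = g 0 * Complex.exp (h z) := by
    have hconst : ∀ z ∈ Metric.ball (0 : ℂ) R, g z * Complex.exp (-h z) = g 0 := by
      intro z hz
      have hder : ∀ w ∈ Metric.ball (0 : ℂ) R,
          HasDerivAt (fun w => g w * Complex.exp (-h w)) 0 w := by
        intro w hw
        have := (hg w).hasDerivAt.mul (hh w hw).neg.cexp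
        refine this.congr_deriv ?_
        have hne' := hne w (mem_ball_zero_iff.1 hw).le
        rw [logDeriv_apply]; field_simp; ring
      have := (convex_ball (0 : ℂ) R).is_const_of_fderivWithin_eq_zero (𝕜 := ℂ)
        (f := fun w => g w * Complex.exp (-h w))
        (fun w hw => (hder w hw).differentiableAt.differentiableWithinAt)
        (fun w hw => by
          rw [fderivWithin_of_isOpen Metric.isOpen_ball hw, (hder w hw).hasFDerivAt.fderiv]
          ext; simp) hz (Metric.mem_ball_self hR)
      simpa [h0] using this
    intro z hz
    rw [← hconst z hz, mul_assoc, ← Complex.exp_add]; simp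
  have hre : MapsTo h (Metric.ball 0 R) {z | z.re ≤ A} := by
    intro z hz
    have h1 : ‖g z‖ = ‖g 0‖ * exp (h z).re := by
      rw [hexp z hz, norm_mul, Complex.norm_exp]
    have h2 := hM z (mem_ball_zero_iff.1 hz).le
    rw [h1] at h2
    have h3 : exp (h z).re ≤ M / ‖g 0‖ := by rwa [le_div_iff₀ hg0, mul_comm]
    have := (Real.le_log_iff_exp_le (lt_of_lt_of_le (Real.exp_pos _) h3)).2 h3
    show (h z).re ≤ A
    linarith
  have hhd : DifferentiableOn ℂ h (Metric.ball 0 R) :=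
    fun z hz => (hh z hz).differentiableAt.differentiableWithinAt
  have b0 : ∀ z : ℂ, ‖z‖ ≤ R / 2 → ‖h z‖ ≤ 2 * A := by
    intro z hz
    have := Complex.borelCaratheodory_zero hA0 hhd hre hR
      (mem_ball_zero_iff.2 (by linarith) : z ∈ Metric.ball (0 : ℂ) R) h0
    refine this.trans ?_
    rw [div_le_iff₀ (by linarith)]
    nlinarith
  have b1 : ∀ z : ℂ, ‖z‖ ≤ R / 4 → ‖logDeriv g z‖ ≤ 2 * A / (R / 4) := by
    intro z hz
    have hsub : ∀ w ∈ Metric.closedBall z (R / 4), ‖w‖ ≤ R / 2 := by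
      intro w hw
      have := norm_le_norm_add_norm_sub' w z
      rw [mem_closedBall_iff_norm] at hw
      linarith
    rw [← (hh z (mem_ball_zero_iff.2 (by linarith))).deriv]
    refine Complex.norm_deriv_le_of_forall_mem_sphere_norm_le (by positivity) ?_
      (fun w hw => b0 w (hsub w (Metric.sphere_subset_closedBall hw)))
    refine DifferentiableOn.diffContOnCl (hhd.mono fun w hw => mem_ball_zero_iff.2 ?_)
    rw [closure_ball _ (by positivity)] at hw
    linarith [hsub w hw]
  have b2 : ∀ z : ℂ, ‖z‖ ≤ R / 8 → ‖deriv (logDeriv g) z‖ ≤ 2 * A / (R / 4) / (R / 8) := by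
    intro z hz
    have hsub : ∀ w ∈ Metric.closedBall z (R / 8), ‖w‖ ≤ R / 4 := by
      intro w hw
      have := norm_le_norm_add_norm_sub' w z
      rw [mem_closedBall_iff_norm] at hw
      linarith
    refine Complex.norm_deriv_le_of_forall_mem_sphere_norm_le (by positivity) ?_
      (fun w hw => b1 w (hsub w (Metric.sphere_subset_closedBall hw)))
    refine DifferentiableOn.diffContOnCl (hq.mono fun w hw => mem_ball_zero_iff.2 ?_)
    rw [closure_ball _ (by positivity)] at hw
    linarith [hsub w hw]
  have hcon : 2 * A / (R / 4) / (R / 8) = 64 * A / R ^ 2 := by field_simp; ring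
  rw [hcon] at b2
  have hld0 : logDeriv g 0 = 0 := by
    have h1 : HasDerivAt (fun z => g (-z)) (deriv g (-0) * (-1)) 0 :=
      (hg (-0)).hasDerivAt.comp 0 (hasDerivAt_neg (0 : ℂ))
    rw [funext heven] at h1
    have := h1.unique (hg 0).hasDerivAt
    rw [neg_zero] at this
    have : deriv g 0 = 0 := by linear_combination (-1 / 2) * this
    rw [logDeriv_apply, this, zero_div]
  have c1 : ∀ z : ℂ, ‖z‖ ≤ R / 8 → ‖logDeriv g z‖ ≤ 64 * A / R ^ 2 * ‖z‖ := by
    intro z hz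
    have := (convex_closedBall (0 : ℂ) (R / 8)).norm_image_sub_le_of_norm_deriv_le
      (f := logDeriv g) (C := 64 * A / R ^ 2) (x := 0) (y := z)
      (fun w hw => hq.differentiableAt (Metric.isOpen_ball.mem_nhds (mem_ball_zero_iff.2 (by
        rw [mem_closedBall_zero_iff] at hw; linarith))))
      (fun w hw => b2 w (mem_closedBall_zero_iff.1 hw)) (by simp; positivity)
      (mem_closedBall_zero_iff.2 hz)
    simpa [hld0] using this
  refine ⟨h, fun z hz => ⟨hexp z (mem_ball_zero_iff.2 (by linarith)), ?_, c1 z hz⟩⟩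
  have := (convex_closedBall (0 : ℂ) ‖z‖).norm_image_sub_le_of_norm_deriv_le
      (f := h) (C := 64 * A / R ^ 2 * ‖z‖) (x := 0) (y := z)
      (fun w hw => (hh w (mem_ball_zero_iff.2 (by
        rw [mem_closedBall_zero_iff] at hw; linarith))).differentiableAt)
      (fun w hw => by
        rw [mem_closedBall_zero_iff] at hw
        rw [(hh w (mem_ball_zero_iff.2 (by linarith))).deriv]
        refine (c1 w (hw.trans hz)).trans ?_
        gcongr) (by simp)
      (mem_closedBall_zero_iff.2 le_rfl)
  simpa [h0] using this

/-- The genus-zero part of Hadamard's theorem in quantitative form: the cofactor tends to the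
constant `f 0`. -/
lemma RealZeroEven.exists_cofactor_near {f : ℂ → ℂ} (hf : RealZeroEven f) {r ε : ℝ}
    (hε : 0 < ε) : ∃ R₀ : ℝ, 0 < R₀ ∧ ∀ R, R₀ ≤ R → ∀ s g, EvenFactor f R s g →
      (∀ z : ℂ, ‖z‖ ≤ R → g z ≠ 0) → ∀ z : ℂ, ‖z‖ ≤ r → ‖g z - f 0‖ ≤ ε ∧ ‖logDeriv g z‖ ≤ ε := by
  obtain ⟨C, hC0, hC⟩ := hf.growth
  have hf0 : 0 < ‖f 0‖ := norm_pos_iff.2 hf.zero_ne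
  set B : ℝ := |log (C / ‖f 0‖)| + 1 with hB
  have hB0 : 0 < B := by positivity
  have hlim : Tendsto (fun x : ℝ => 576 * (x ^ 3 + B) / x ^ 4 * (|r| + 1) * (|r| + 1))
      atTop (𝓝 0) := by
    have h1 : Tendsto (fun x : ℝ => x⁻¹ + B * (x ^ 4)⁻¹) atTop (𝓝 (0 + B * 0)) :=
      tendsto_inv_atTop_zero.add
        ((tendsto_inv_atTop_zero.comp (tendsto_pow_atTop (by norm_num))).const_mul B)
    have h2 := ((h1.const_mul 576).mul_const (|r| + 1)).mul_const (|r| + 1)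
    simp only [mul_zero, add_zero, zero_mul] at h2
    refine h2.congr' ?_
    filter_upwards [eventually_gt_atTop 0] with x hx
    field_simp
  set δ : ℝ := min (min ε (ε / (2 * ‖f 0‖))) 1 with hδ
  have hδ0 : 0 < δ := by positivity
  obtain ⟨x₀, hx₀⟩ := ((hlim.eventually (gt_mem_nhds hδ0)).and
    (eventually_ge_atTop (1 : ℝ))).exists_forall_of_atTop
  set x₁ : ℝ := max x₀ (max 1 (24 * (|r| + 1))) with hx₁
  refine ⟨x₁ ^ 2 / 3, by positivity, fun R hR s g hfac hne z hz => ?_⟩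
  set x : ℝ := √(3 * R) with hx
  have hx1 : x₁ ≤ x := Real.le_sqrt_of_sq_le (by linarith)
  have hxx : x ^ 2 = 3 * R := Real.sq_sqrt (by nlinarith [sq_nonneg x₁])
  have hx1' : 1 ≤ x := ((le_max_left _ _).trans (le_max_right _ _)).trans hx1
  have hxr : 24 * (|r| + 1) ≤ x := ((le_max_right _ _).trans (le_max_right _ _)).trans hx1
  have hRpos : 0 < R := by nlinarith
  have hzr : ‖z‖ ≤ |r| + 1 := hz.trans ((le_abs_self r).trans (by linarith))
  have hz8 : ‖z‖ ≤ R / 8 := by nlinarith [abs_nonneg r]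
  have hgM : ∀ w : ℂ, ‖w‖ ≤ R → ‖g w‖ ≤ C * exp (x ^ 3) := by
    intro w hw
    refine (hfac.norm_le hRpos (M := C * exp (x ^ 3)) (fun v hv => hC x hx1' v (by rw [hv, hxx]))
      (by linarith : ‖w‖ ≤ 3 * R)).trans ?_
    exact div_le_self (by positivity) (one_le_pow₀ (by norm_num))
  obtain ⟨h, hh⟩ := norm_logDeriv_le_of_even hRpos hfac.diff hfac.even hne hgM
  obtain ⟨e1, e2, e3⟩ := hh z hz8
  rw [hfac.map_zero] at e1 e2 e3
  have hlog : log (C * exp (x ^ 3) / ‖f 0‖) + 1 ≤ x ^ 3 + B := by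
    rw [mul_div_right_comm, Real.log_mul (by positivity) (Real.exp_pos _).ne', Real.log_exp]
    have := le_abs_self (log (C / ‖f 0‖))
    linarith
  have hcoef : 64 * (log (C * exp (x ^ 3) / ‖f 0‖) + 1) / R ^ 2 ≤ 576 * (x ^ 3 + B) / x ^ 4 := by
    have : x ^ 4 = 9 * R ^ 2 := by
      calc x ^ 4 = (x ^ 2) ^ 2 := by ring
        _ = _ := by rw [hxx]; ring
    rw [this, div_le_div_iff₀ (by positivity) (by positivity)]
    nlinarith [sq_nonneg R]
  have hpos : 0 ≤ 576 * (x ^ 3 + B) / x ^ 4 := by positivity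
  have hsmall := (hx₀ x ((le_max_left _ _).trans hx1)).1
  have hhz : ‖h z‖ ≤ δ := by
    refine e2.trans (le_trans ?_ hsmall.le)
    gcongr
  have hlz : ‖logDeriv g z‖ ≤ δ := by
    refine e3.trans (le_trans ?_ hsmall.le)
    calc _ ≤ 576 * (x ^ 3 + B) / x ^ 4 * (|r| + 1) := by gcongr
      _ ≤ 576 * (x ^ 3 + B) / x ^ 4 * (|r| + 1) * (|r| + 1) :=
        le_mul_of_one_le_right (by positivity) (by linarith [abs_nonneg r])
  have hδ1 : δ ≤ 1 := min_le_right _ _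
  have hδε : δ ≤ ε := (min_le_left _ _).trans (min_le_left _ _)
  have hδε' : δ ≤ ε / (2 * ‖f 0‖) := (min_le_left _ _).trans (min_le_right _ _)
  refine ⟨?_, hlz.trans hδε⟩
  have h5 : g z - f 0 = f 0 * (Complex.exp (h z) - 1) := by rw [e1]; ring
  have h6 := Complex.norm_exp_sub_one_le (hhz.trans hδ1)
  rw [h5, norm_mul]
  calc ‖f 0‖ * ‖Complex.exp (h z) - 1‖ ≤ ‖f 0‖ * (2 * (ε / (2 * ‖f 0‖))) := by
        gcongr; linarith
    _ = ε := by field_simp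

/-- A function of the class is a locally uniform limit of real-rooted polynomials. -/
lemma RealZeroEven.exists_tendsto_polynomial {f : ℂ → ℂ} (hf : RealZeroEven f) :
    ∃ p : ℕ → Polynomial ℂ, (∀ n, RealRooted (p n)) ∧
      TendstoLocallyUniformlyOn (fun n z => (p n).eval z) f atTop univ := by
  have hex : ∀ n : ℕ, ∃ s g, EvenFactor f ((n : ℝ) + 1) s g ∧
      ∀ z : ℂ, ‖z‖ ≤ (n : ℝ) + 1 → g z ≠ 0 := fun n => hf.exists_evenFactor (by positivity)
  choose s g hfac hne using hex
  let P : Multiset ℝ → Polynomial ℂ := fun s =>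
    (s.map fun ρ : ℝ => 1 - Polynomial.C ((ρ : ℂ) ^ 2)⁻¹ * Polynomial.X ^ 2).prod
  have hPe : ∀ s z, (P s).eval z = zeroProd s z := by
    intro s z
    simp only [P, zeroProd]
    rw [Polynomial.eval_multiset_prod, Multiset.map_map]
    congr 1
    refine Multiset.map_congr rfl fun ρ _ => ?_
    simp [div_eq_inv_mul]
  refine ⟨fun n => Polynomial.C (f 0) * P (s n), fun n => Or.inr fun z hz => ?_, ?_⟩
  · rw [Polynomial.eval_mul, Polynomial.eval_C, hPe] at hz
    have h1 := (mul_eq_zero.1 hz).resolve_left hf.zero_ne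
    refine hf.real z ?_
    rw [(hfac n).eq, h1, zero_mul]
  · rw [tendstoLocallyUniformlyOn_iff_forall_isCompact isOpen_univ]
    intro K _ hK
    obtain ⟨r, hr⟩ := hK.isBounded.exists_norm_le
    rw [Metric.tendstoUniformlyOn_iff]
    intro ε hε
    obtain ⟨M, hM0, hM⟩ := hf.exists_bound r
    have hf0 : 0 < ‖f 0‖ := norm_pos_iff.2 hf.zero_ne
    obtain ⟨R₀, -, hR⟩ := hf.exists_cofactor_near (r := r)
      (ε := min (‖f 0‖ / 2) (ε * ‖f 0‖ / (4 * M))) (by positivity)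
    obtain ⟨N, hN⟩ := exists_nat_ge R₀
    filter_upwards [eventually_ge_atTop N] with n hn z hz
    have hnR : R₀ ≤ (n : ℝ) + 1 := by
      have : (N : ℝ) ≤ n := by exact_mod_cast hn
      linarith
    have h1 := (hR _ hnR _ _ (hfac n) (hne n) z (hr z hz)).1
    have h2 : ‖f 0‖ / 2 ≤ ‖g n z‖ := by
      have := norm_sub_norm_le (f 0) (g n z)
      rw [norm_sub_rev] at this
      have := h1.trans (min_le_left _ _)
      linarith
    have h3 : ‖zeroProd (s n) z‖ * (‖f 0‖ / 2) ≤ M := by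
      calc _ ≤ ‖zeroProd (s n) z‖ * ‖g n z‖ := by gcongr
        _ = ‖f z‖ := by rw [(hfac n).eq, norm_mul]
        _ ≤ M := hM z (hr z hz)
    rw [dist_eq_norm, Polynomial.eval_mul, Polynomial.eval_C, hPe, (hfac n).eq z]
    have h4 : zeroProd (s n) z * g n z - f 0 * zeroProd (s n) z
        = zeroProd (s n) z * (g n z - f 0) := by ring
    rw [h4, norm_mul]
    have h5 : ‖zeroProd (s n) z‖ ≤ 2 * M / ‖f 0‖ := by
      rw [le_div_iff₀ hf0]; linarith
    calc ‖zeroProd (s n) z‖ * ‖g n z - f 0‖ ≤ 2 * M / ‖f 0‖ * (ε * ‖f 0‖ / (4 * M)) := by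
          gcongr
          exact h1.trans (min_le_right _ _)
      _ = ε / 2 := by field_simp; norm_num
      _ < ε := by linarith

/-! ### Reality and simplicity of the zeros along the flow -/

lemma heatInt_zero_ne (t : ℝ) : heatInt 0 t 0 ≠ 0 := fun h => by
  have := heatInt_zero_pos t
  rw [h] at this
  simp at this

lemma realZeroEven_heatInt {t : ℝ} (ht : t ≤ 0) (hreal : ∀ z, heatInt 0 t z = 0 → z.im = 0) :
    RealZeroEven (heatInt 0 t) where
  diff := differentiable_heatInt 0 t
  even := heatInt_zero_neg t
  zero_ne := heatInt_zero_ne t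
  real := hreal
  growth := by
    obtain ⟨C, hC0, hC⟩ := exists_norm_heatInt_le
    exact ⟨C, hC0, fun R hR z hz => hC t ht z R hR hz⟩

/-- De Bruijn: if `H_{t'}` has only real zeros then, for `s ≥ t'`, all the derivatives of `H_s` are
pointwise limits of real-rooted polynomials, obtained by iterated imaginary averaging. -/
lemma vertMono_heatInt {t' : ℝ} (ht' : t' ≤ 0) (hreal : ∀ z, heatInt 0 t' z = 0 → z.im = 0)
    (k : ℕ) {s : ℝ} (hs : t' ≤ s) : VertMono (heatInt k s) := by
  obtain ⟨p, hp, hlim⟩ := (realZeroEven_heatInt ht' hreal).exists_tendsto_polynomial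
  have hk : ∀ k : ℕ, ∃ q : ℕ → Polynomial ℂ, (∀ n, RealRooted (q n)) ∧
      TendstoLocallyUniformlyOn (fun n z => (q n).eval z) (heatInt k t') atTop univ := by
    intro k
    induction k with
    | zero => exact ⟨p, hp, hlim⟩
    | succ k ih =>
      obtain ⟨q, hq, hql⟩ := ih
      refine ⟨fun n => Polynomial.derivative (q n), fun n => (hq n).derivative, ?_⟩
      have := hql.deriv (Eventually.of_forall fun n => (q n).differentiable.differentiableOn)
        isOpen_univ
      rw [deriv_heatInt] at this
      convert this using 3 with n
      simp
  obtain ⟨q, hq, hql⟩ := hk k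
  have hpt : ∀ z, Tendsto (fun n => (q n).eval z) atTop (𝓝 (heatInt k t' z)) := fun z =>
    hql.tendsto_at (mem_univ z)
  rcases hs.eq_or_lt with rfl | hlt
  · exact VertMono.of_tendsto (fun n => (hq n).vertMono) hpt
  have hc : 0 < s - t' := by linarith
  have hN : ∀ N : ℕ, VertMono ((imagAverage (√(2 * (s - t') / ((N + 1 : ℕ) : ℝ))))^[N + 1]
      (heatInt k t')) := by
    intro N
    refine VertMono.of_tendsto (fun n => ?_) (tendsto_iterate_imagAverage hpt _ _)
    obtain ⟨q', hq', he⟩ := (hq n).iterate_imagAverage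
      (a := √(2 * (s - t') / ((N + 1 : ℕ) : ℝ))) (Real.sqrt_pos.2 (by positivity)) (N + 1)
    rw [← he]
    exact hq'.vertMono
  refine VertMono.of_tendsto hN fun z => ?_
  have := (tendsto_iterate_imagAverage_heatInt k t' hc.le z).comp (tendsto_add_atTop_nat 1)
  rw [add_sub_cancel] at this
  exact this

/-- A nonreal zero would force `f` to vanish on a vertical segment, hence identically. -/
lemma VertMono.real_zeros {f : ℂ → ℂ} (hf : VertMono f) (hd : Differentiable ℂ f)
    (h0 : f 0 ≠ 0) {z : ℂ} (hz : f z = 0) : z.im = 0 := by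
  by_contra him
  have hseg : ∀ n : ℕ, f (z.re + (z.im / (n + 1) : ℝ) * Complex.I) = 0 := by
    intro n
    have := hf (z.re + (z.im / (n + 1) : ℝ) * Complex.I) z (by simp [-Complex.ofReal_div]) (by
      simp only [Complex.add_im, Complex.ofReal_im, Complex.mul_im, Complex.ofReal_re,
        Complex.I_im, mul_one, Complex.I_re, mul_zero, add_zero, zero_add]
      rw [abs_div, abs_of_pos (by positivity : (0 : ℝ) < (n : ℝ) + 1)]
      exact div_le_self (abs_nonneg _) (by linarith [(Nat.cast_nonneg n : (0 : ℝ) ≤ n)]))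
    rw [hz, norm_zero] at this
    exact norm_le_zero_iff.1 this
  have htend : Tendsto (fun n : ℕ => (z.re : ℂ) + (z.im / (n + 1) : ℝ) * Complex.I) atTop
      (𝓝[≠] (z.re : ℂ)) := by
    refine tendsto_nhdsWithin_iff.2 ⟨?_, Eventually.of_forall fun n => ?_⟩
    · have h1 : Tendsto (fun n : ℕ => z.im / ((n : ℝ) + 1)) atTop (𝓝 0) := by
        have := (tendsto_one_div_add_atTop_nhds_zero_nat (𝕜 := ℝ)).const_mul z.im
        simpa [div_eq_mul_inv] using this
      have h2 := ((Complex.continuous_ofReal.tendsto 0).comp h1).mul_const Complex.I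
      simpa using h2.const_add (z.re : ℂ)
    · simp only [mem_compl_iff, mem_singleton_iff, add_eq_left, mul_eq_zero, Complex.ofReal_eq_zero,
        Complex.I_ne_zero, or_false]
      exact div_ne_zero him (by positivity)
  have hfreq : ∃ᶠ w in 𝓝[≠] (z.re : ℂ), f w = 0 :=
    htend.frequently (Frequently.of_forall hseg)
  have han : AnalyticOnNhd ℂ f univ := fun w _ => hd.analyticAt w
  have := han.eqOn_zero_of_preconnected_of_frequently_eq_zero isPreconnected_univ
    (mem_univ (z.re : ℂ)) hfreq (mem_univ 0)
  exact h0 this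

lemma iteratedDeriv_heatInt (k : ℕ) (t : ℂ) : iteratedDeriv k (heatInt 0 t) = heatInt k t := by
  induction k with
  | zero => simp
  | succ k ih => rw [iteratedDeriv_succ, ih, deriv_heatInt]

lemma exists_heatInt_ne_zero (t : ℝ) (x : ℂ) : ∃ k, heatInt k t x ≠ 0 := by
  by_contra! h
  have := Complex.taylorSeries_eq_of_entire (differentiable_heatInt 0 t) x 0
  simp only [iteratedDeriv_heatInt, h] at this
  exact heatInt_zero_ne t (by simpa using this.symm)

/-- Zeros become simple immediately after a time at which all zeros are real. Near a multiple zero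
`x₀` of `H_t`, the function `|V_s(x₀ + i y)|` with `V` a suitable derivative of `H` is not monotone
in `y` when `s = t - y² / 2`, by the heat equation. -/
lemma heatInt_one_ne_zero {t' : ℝ} (ht' : t' ≤ 0) (hreal : ∀ z, heatInt 0 t' z = 0 → z.im = 0)
    {t : ℝ} (ht : t' < t) {x : ℂ} (hx : heatInt 0 t x = 0) : heatInt 1 t x ≠ 0 := by
  classical
  intro h1
  have hex := exists_heatInt_ne_zero t x
  obtain ⟨k, hk⟩ : ∃ k, Nat.find hex = k + 2 := by
    have h0 : Nat.find hex ≠ 0 := fun h => Nat.find_spec hex (by rw [h]; exact hx)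
    have h1' : Nat.find hex ≠ 1 := fun h => Nat.find_spec hex (by rw [h]; exact h1)
    exact ⟨Nat.find hex - 2, by omega⟩
  have hV : heatInt (k + 2) t x ≠ 0 := hk ▸ Nat.find_spec hex
  have hV0 : heatInt k t x = 0 := not_not.1 (Nat.find_min hex (m := k) (by omega))
  have hV1 : heatInt (k + 1) t x = 0 := not_not.1 (Nat.find_min hex (m := k + 1) (by omega))
  set v : ℝ := ‖heatInt (k + 2) t x‖ with hv
  have hv0 : 0 < v := norm_pos_iff.2 hV
  -- the parabola `s = t - y² / 2`, `z = x + i y`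
  have hα : ∀ y : ℝ, HasDerivAt (fun y : ℝ => ((t - y ^ 2 / 2 : ℝ) : ℂ)) ((-y : ℝ) : ℂ) y := by
    intro y
    have : HasDerivAt (fun y : ℝ => t - y ^ 2 / 2) (-y) y := by
      have := ((hasDerivAt_pow 2 y).div_const 2).const_sub t
      exact this.congr_deriv (by simp)
    exact this.ofReal_comp
  have hβ : ∀ y : ℝ, HasDerivAt (fun y : ℝ => x + (y : ℂ) * Complex.I) Complex.I y := by
    intro y
    have := ((hasDerivAt_id y).ofReal_comp.mul_const Complex.I).const_add x
    simpa using this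
  set h : ℝ → ℂ := fun y => heatInt k ((t - y ^ 2 / 2 : ℝ) : ℂ) (x + (y : ℂ) * Complex.I)
  set h' : ℝ → ℂ := fun y =>
    -heatInt (k + 2) ((t - y ^ 2 / 2 : ℝ) : ℂ) (x + (y : ℂ) * Complex.I) * ((-y : ℝ) : ℂ)
      + heatInt (k + 1) ((t - y ^ 2 / 2 : ℝ) : ℂ) (x + (y : ℂ) * Complex.I) * Complex.I
  have hh : ∀ y, HasDerivAt h (h' y) y := fun y => hasDerivAt_heatInt_curve k (hα y) (hβ y)
  have hh'0 : h' 0 = 0 := by simp [h', hV1]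
  have hh' : HasDerivAt h' 0 0 := by
    have e1 := (hasDerivAt_heatInt_curve (k + 2) (hα 0) (hβ 0)).neg.mul
      ((hasDerivAt_neg (0 : ℝ)).ofReal_comp)
    have e2 := (hasDerivAt_heatInt_curve (k + 1) (hα 0) (hβ 0)).mul_const Complex.I
    refine (e1.add e2).congr_deriv ?_
    simp
    rw [mul_assoc, Complex.I_mul_I]; ring
  have hsmall : ∀ᶠ y : ℝ in 𝓝 0, ‖h' y‖ ≤ v / 8 * |y| := by
    have := (hasDerivAt_iff_isLittleO.1 hh').def (c := v / 8) (by positivity)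
    simpa [hh'0] using this
  -- on the vertical line through `x` the value at `x` itself decreases linearly in time
  have hκ : HasDerivAt (fun e : ℝ => heatInt k ((t - e : ℝ) : ℂ) x) (heatInt (k + 2) t x) 0 := by
    have e0 : HasDerivAt (fun e : ℝ => ((t - e : ℝ) : ℂ)) ((-1 : ℝ) : ℂ) 0 :=
      ((hasDerivAt_id (0 : ℝ)).const_sub t).ofReal_comp
    have := hasDerivAt_heatInt_curve k e0 (hasDerivAt_const (0 : ℝ) x)
    exact this.congr_deriv (by simp)
  have hlarge : ∀ᶠ e : ℝ in 𝓝 0, v / 2 * |e| ≤ ‖heatInt k ((t - e : ℝ) : ℂ) x‖ := by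
    have := (hasDerivAt_iff_isLittleO.1 hκ).def (c := v / 2) (by positivity)
    filter_upwards [this] with e he
    simp only [sub_zero, hV0, Real.norm_eq_abs] at he
    have h2 := norm_sub_norm_le (e • heatInt (k + 2) t x) (heatInt k ((t - e : ℝ) : ℂ) x)
    rw [norm_sub_rev, norm_smul, Real.norm_eq_abs, ← hv] at h2
    linarith
  obtain ⟨δ₁, hδ₁, H1⟩ := Metric.eventually_nhds_iff.1 hsmall
  obtain ⟨δ₂, hδ₂, H2⟩ := Metric.eventually_nhds_iff.1 hlarge
  obtain ⟨y, hy0, hy1, hy2, hy3⟩ : ∃ y : ℝ, 0 < y ∧ y < δ₁ ∧ y ^ 2 / 2 < δ₂ ∧ y ^ 2 / 2 ≤ t - t' := by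
    refine ⟨min (min (δ₁ / 2) 1) (min (δ₂) (t - t')), ?_, ?_, ?_, ?_⟩
    · have : 0 < t - t' := by linarith
      positivity
    · exact lt_of_le_of_lt ((min_le_left _ _).trans (min_le_left _ _)) (by linarith)
    all_goals
      set m := min (min (δ₁ / 2) 1) (min (δ₂) (t - t')) with hm
      have m0 : 0 < m := by
        have : 0 < t - t' := by linarith
        positivity
      have m1 : m ≤ 1 := (min_le_left _ _).trans (min_le_right _ _)
      have m2 : m ≤ δ₂ := (min_le_right _ _).trans (min_le_left _ _)
      have m3 : m ≤ t - t' := (min_le_right _ _).trans (min_le_right _ _)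
      nlinarith
  have hM := vertMono_heatInt ht' hreal k (s := t - y ^ 2 / 2) (by linarith) x
    (x + (y : ℂ) * Complex.I)
  have hb : ‖h y‖ ≤ v / 8 * y * y := by
    have := (convex_Icc (0 : ℝ) y).norm_image_sub_le_of_norm_hasDerivWithin_le (f := h) (f' := h')
      (C := v / 8 * y) (x := 0) (y := y) (fun w _ => (hh w).hasDerivWithinAt) (fun w hw => by
        refine (H1 (by rw [dist_zero_right, Real.norm_eq_abs, abs_of_nonneg hw.1]
                       exact lt_of_le_of_lt hw.2 hy1)).trans ?_
        rw [abs_of_nonneg hw.1]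
        have := hw.2
        gcongr) (left_mem_Icc.2 hy0.le) (right_mem_Icc.2 hy0.le)
    have h00 : h 0 = 0 := by simp [h, hV0]
    rw [h00, sub_zero, sub_zero, Real.norm_eq_abs, abs_of_pos hy0] at this
    exact this
  have hl := H2 (y := y ^ 2 / 2) (by
    rw [dist_zero_right, Real.norm_eq_abs, abs_of_nonneg (by positivity)]; exact hy2)
  rw [abs_of_nonneg (by positivity)] at hl
  have hxim : x.im = 0 := (vertMono_heatInt ht' hreal 0 ht.le).real_zeros
    (differentiable_heatInt 0 t) (heatInt_zero_ne t) hx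
  have hM' := hM (by simp) (by simp [hxim])
  have : v / 2 * (y ^ 2 / 2) ≤ v / 8 * y * y := hl.trans (hM'.trans hb)
  nlinarith [mul_pos hv0 (pow_pos hy0 2)]

/-- At every time in `(Λ, ∞)` the zeros of `H_t` are real and simple. -/
theorem zeros_real_simple (hneg : deBruijnNewman < 0) {t : ℝ} (ht : deBruijnNewman < t) :
    (∀ z, heatInt 0 t z = 0 → z.im = 0) ∧ ∀ z, heatInt 0 t z = 0 → heatInt 1 t z ≠ 0 := by
  have hne : {t : ℝ | ∀ z : ℂ, H t z = 0 → z.im = 0}.Nonempty := by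
    by_contra h
    rw [not_nonempty_iff_eq_empty] at h
    rw [deBruijnNewman, h, Real.sInf_empty] at hneg
    exact lt_irrefl _ hneg
  obtain ⟨t', ht'mem, ht'⟩ := exists_lt_of_csInf_lt hne (lt_min ht hneg)
  have h1 : t' ≤ 0 := (ht'.trans_le (min_le_right _ _)).le
  have h2 : t' < t := ht'.trans_le (min_le_left _ _)
  have hreal : ∀ z, heatInt 0 t' z = 0 → z.im = 0 := fun z hz =>
    ht'mem z (by rw [H_eq_heatInt]; exact hz)
  exact ⟨fun z hz => (vertMono_heatInt h1 hreal 0 h2.le).real_zeros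
    (differentiable_heatInt 0 t) (heatInt_zero_ne t) hz,
    fun z hz => heatInt_one_ne_zero h1 hreal h2 hz⟩

/-! ### Partial fractions of the logarithmic derivative -/

/-- The positive real zeros of `f`. -/
def posZeros (f : ℂ → ℂ) : Set ℝ := {x | 0 < x ∧ f x = 0}

/-- The logarithmic derivative of `1 - z² / ρ²`. -/
def pairKernel (z : ℂ) (ρ : ℝ) : ℂ := 1 / (z - ρ) + 1 / (z + ρ)

/-- The Poisson kernel of the upper half-plane at `x + iy`, summed over the points `± ρ`
(without the factor `1/π`). -/
def poissonPair (x y ρ : ℝ) : ℝ := y / ((x - ρ) ^ 2 + y ^ 2) + y / ((x + ρ) ^ 2 + y ^ 2)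

lemma sub_ofReal_ne_zero {z : ℂ} (hz : z.im ≠ 0) (ρ : ℝ) : z - ρ ≠ 0 := fun h => hz (by
  have := congrArg Complex.im h
  simpa using this)

lemma add_ofReal_ne_zero {z : ℂ} (hz : z.im ≠ 0) (ρ : ℝ) : z + ρ ≠ 0 := fun h => hz (by
  have := congrArg Complex.im h
  simpa using this)

lemma im_pairKernel (x y ρ : ℝ) : (pairKernel (x + y * Complex.I) ρ).im = -poissonPair x y ρ := by
  simp only [pairKernel, poissonPair, one_div, Complex.add_im, Complex.inv_im, Complex.normSq_apply]
  simp
  ring_nf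

lemma re_pairKernel (x y ρ : ℝ) : (pairKernel (x + y * Complex.I) ρ).re
    = (x - ρ) / ((x - ρ) ^ 2 + y ^ 2) + (x + ρ) / ((x + ρ) ^ 2 + y ^ 2) := by
  simp only [pairKernel, one_div, Complex.add_re, Complex.inv_re, Complex.normSq_apply]
  simp [sq]

lemma logDeriv_factor {z : ℂ} (hz : z.im ≠ 0) {ρ : ℝ} (hρ : ρ ≠ 0) :
    (1 - z ^ 2 / (ρ : ℂ) ^ 2 ≠ 0) ∧
      logDeriv (fun z : ℂ => 1 - z ^ 2 / (ρ : ℂ) ^ 2) z = pairKernel z ρ := by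
  have h1 := sub_ofReal_ne_zero hz ρ
  have h2 := add_ofReal_ne_zero hz ρ
  have hρ' : (ρ : ℂ) ≠ 0 := by exact_mod_cast hρ
  have h3 : 1 - z ^ 2 / (ρ : ℂ) ^ 2 = -((z - ρ) * (z + ρ)) / (ρ : ℂ) ^ 2 := by
    field_simp; ring
  have h4 : 1 - z ^ 2 / (ρ : ℂ) ^ 2 ≠ 0 := by
    rw [h3]
    exact div_ne_zero (neg_ne_zero.2 (mul_ne_zero h1 h2)) (pow_ne_zero 2 hρ')
  refine ⟨h4, ?_⟩
  have hd : HasDerivAt (fun z : ℂ => 1 - z ^ 2 / (ρ : ℂ) ^ 2) (-(2 * z / (ρ : ℂ) ^ 2)) z := by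
    have := ((hasDerivAt_pow 2 z).div_const ((ρ : ℂ) ^ 2)).const_sub 1
    simpa using this
  rw [logDeriv_apply, hd.deriv, h3, pairKernel]
  field_simp
  ring

lemma differentiable_zeroProd (s : Multiset ℝ) : Differentiable ℂ (zeroProd s) := by
  induction s using Multiset.induction with
  | empty =>
    have : zeroProd 0 = fun _ => 1 := by funext; simp [zeroProd]
    rw [this]; fun_prop
  | cons a s ih =>
    have : zeroProd (a ::ₘ s) = fun z => (1 - z ^ 2 / (a : ℂ) ^ 2) * zeroProd s z :=
      funext (zeroProd_cons a s)
    rw [this]; fun_prop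

lemma logDeriv_zeroProd {z : ℂ} (hz : z.im ≠ 0) {s : Multiset ℝ} (hs : ∀ ρ ∈ s, 0 < ρ) :
    zeroProd s z ≠ 0 ∧ logDeriv (zeroProd s) z = (s.map (pairKernel z)).sum := by
  induction s using Multiset.induction with
  | empty =>
    refine ⟨by simp [zeroProd], ?_⟩
    have : zeroProd 0 = fun _ => 1 := by funext; simp [zeroProd]
    rw [this]; simp
  | cons a s ih =>
    obtain ⟨h1, h2⟩ := ih fun ρ hρ => hs ρ (Multiset.mem_cons_of_mem hρ)
    obtain ⟨h3, h4⟩ := logDeriv_factor hz (hs a (Multiset.mem_cons_self a s)).ne'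
    have : zeroProd (a ::ₘ s) = fun z => (1 - z ^ 2 / (a : ℂ) ^ 2) * zeroProd s z :=
      funext (zeroProd_cons a s)
    refine ⟨by rw [zeroProd_cons]; exact mul_ne_zero h3 h1, ?_⟩
    rw [this, logDeriv_mul z h3 h1 (by fun_prop) (differentiable_zeroProd s z), h4, h2,
      Multiset.map_cons, Multiset.sum_cons]

variable {f : ℂ → ℂ}

lemma EvenFactor.logDeriv_eq {R : ℝ} {s : Multiset ℝ} {g : ℂ → ℂ} (h : EvenFactor f R s g)
    {z : ℂ} (hz : z.im ≠ 0) (hg : g z ≠ 0) :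
    logDeriv f z = (s.map (pairKernel z)).sum + logDeriv g z := by
  obtain ⟨h1, h2⟩ := logDeriv_zeroProd hz fun ρ hρ => (h.mem ρ hρ).1
  rw [funext h.eq, logDeriv_mul z h1 hg (differentiable_zeroProd s z) (h.diff z), h2]

lemma EvenFactor.mem_iff {R : ℝ} {s : Multiset ℝ} {g : ℂ → ℂ} (h : EvenFactor f R s g)
    (hg : ∀ z : ℂ, ‖z‖ ≤ R → g z ≠ 0) (x : ℝ) : x ∈ s ↔ x ∈ posZeros f ∧ x ≤ R := by
  constructor
  · intro hx
    obtain ⟨h1, h2⟩ := h.mem x hx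
    refine ⟨⟨h1, ?_⟩, h2⟩
    obtain ⟨s', rfl⟩ := Multiset.exists_cons_of_mem hx
    have : (x : ℂ) ≠ 0 := by exact_mod_cast h1.ne'
    rw [h.eq, zeroProd_cons, div_self (pow_ne_zero 2 this)]; ring
  · rintro ⟨⟨h1, h2⟩, h3⟩
    have hgx := hg x (by rwa [Complex.norm_real, Real.norm_of_nonneg h1.le])
    rw [h.eq] at h2
    have h4 := (mul_eq_zero.1 h2).resolve_right hgx
    rw [zeroProd, Multiset.prod_eq_zero_iff, Multiset.mem_map] at h4
    obtain ⟨ρ, hρ, h5⟩ := h4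
    have hρ0 := (h.mem ρ hρ).1
    have : (ρ : ℂ) ≠ 0 := by exact_mod_cast hρ0.ne'
    field_simp at h5
    have h6 : ρ ^ 2 = x ^ 2 := by
      have : (ρ : ℂ) ^ 2 = (x : ℂ) ^ 2 := by linear_combination h5
      exact_mod_cast this
    have : ρ = x := by nlinarith
    rwa [← this]

lemma EvenFactor.nodup {R : ℝ} {s : Multiset ℝ} {g : ℂ → ℂ} (h : EvenFactor f R s g)
    (hsimple : ∀ x : ℝ, f x = 0 → deriv f x ≠ 0) : s.Nodup := by
  rw [Multiset.nodup_iff_ne_cons_cons]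
  rintro a t rfl
  have ha := (h.mem a (Multiset.mem_cons_self a _)).1
  have hac : (a : ℂ) ≠ 0 := by exact_mod_cast ha.ne'
  have he : f = fun z => (1 - z ^ 2 / (a : ℂ) ^ 2) ^ 2 * (zeroProd t z * g z) := by
    funext z; rw [h.eq, zeroProd_cons, zeroProd_cons]; ring
  have h0 : (1 - (a : ℂ) ^ 2 / (a : ℂ) ^ 2) = 0 := by rw [div_self (pow_ne_zero 2 hac)]; ring
  have hd : HasDerivAt f 0 a := by
    have h1 : HasDerivAt (fun z : ℂ => 1 - z ^ 2 / (a : ℂ) ^ 2) (-(2 * a / (a : ℂ) ^ 2)) a := by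
      have := ((hasDerivAt_pow 2 (a : ℂ)).div_const ((a : ℂ) ^ 2)).const_sub 1
      simpa using this
    have h2 := (h1.pow 2).mul ((differentiable_zeroProd t a).mul (h.diff a)).hasDerivAt
    rw [he]
    refine h2.congr_deriv ?_
    simp [h0]
  refine hsimple a ?_ hd.deriv
  rw [he]; simp [h0]

/-- The class of functions to which the explicit formulas below apply. -/
structure SimpleRealZeroEven (f : ℂ → ℂ) : Prop extends RealZeroEven f where
  simple : ∀ x : ℝ, f x = 0 → deriv f x ≠ 0

lemma SimpleRealZeroEven.finite_zeros (hf : SimpleRealZeroEven f) (R : ℝ) :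
    (posZeros f ∩ Iic R).Finite := by
  obtain ⟨s, g, hs, hg⟩ := hf.exists_evenFactor (R := max R 1) (by positivity)
  refine (s.toFinset.finite_toSet).subset fun x hx => ?_
  rw [Finset.mem_coe, Multiset.mem_toFinset, hs.mem_iff hg]
  exact ⟨hx.1, hx.2.trans (le_max_left _ _)⟩

lemma SimpleRealZeroEven.countable_zeros (hf : SimpleRealZeroEven f) : (posZeros f).Countable := by
  have : posZeros f = ⋃ n : ℕ, posZeros f ∩ Iic (n : ℝ) := by
    ext x
    simp only [mem_iUnion, mem_inter_iff, mem_Iic]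
    exact ⟨fun h => (exists_nat_ge x).imp fun n hn => ⟨h, hn⟩, fun ⟨_, h, _⟩ => h⟩
  rw [this]
  exact countable_iUnion fun n => (hf.finite_zeros n).countable

lemma one_add_sq_le {x y ρ : ℝ} (hy : y ≠ 0) :
    1 + ρ ^ 2 ≤ ((1 + 2 * x ^ 2) / y ^ 2 + 2) * ((x - ρ) ^ 2 + y ^ 2) := by
  have hy2 : 0 < y ^ 2 := by positivity
  have h1 : ((1 + 2 * x ^ 2) / y ^ 2 + 2) * ((x - ρ) ^ 2 + y ^ 2)
      = (1 + 2 * x ^ 2) / y ^ 2 * (x - ρ) ^ 2 + (1 + 2 * x ^ 2) + 2 * (x - ρ) ^ 2 + 2 * y ^ 2 := by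
    field_simp; ring
  rw [h1]
  have : 0 ≤ (1 + 2 * x ^ 2) / y ^ 2 * (x - ρ) ^ 2 := by positivity
  nlinarith [sq_nonneg (2 * x - ρ)]

/-- The partial fraction expansion of the logarithmic derivative, with paired zeros. -/
lemma SimpleRealZeroEven.hasSum_logDeriv (hf : SimpleRealZeroEven f) {z : ℂ} (hz : z.im ≠ 0) :
    HasSum (fun ρ : posZeros f => pairKernel z ρ) (logDeriv f z) := by
  classical
  have hex : ∀ n : ℕ, ∃ s g, EvenFactor f ((n : ℝ) + 1) s g ∧
      ∀ z : ℂ, ‖z‖ ≤ (n : ℝ) + 1 → g z ≠ 0 := fun n => hf.exists_evenFactor (by positivity)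
  choose s g hfac hne using hex
  have hmem := fun n => (hfac n).mem_iff (hne n)
  let F : ℕ → Finset (posZeros f) := fun n => (s n).toFinset.subtype (· ∈ posZeros f)
  have hF : Tendsto F atTop atTop := by
    refine tendsto_atTop_finset_of_monotone (fun m n hmn x hx => ?_) fun x => ?_
    · simp only [F, Finset.mem_subtype, Multiset.mem_toFinset, hmem] at hx ⊢
      have : (m : ℝ) ≤ n := by exact_mod_cast hmn
      exact ⟨hx.1, by linarith [hx.2]⟩
    · obtain ⟨n, hn⟩ := exists_nat_ge (x : ℝ)
      refine ⟨n, ?_⟩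
      simp only [F, Finset.mem_subtype, Multiset.mem_toFinset, hmem]
      exact ⟨x.2, by linarith⟩
  have hsum : ∀ n (w : ℂ), ∑ ρ ∈ F n, pairKernel w ρ = ((s n).map (pairKernel w)).sum := by
    intro n w
    rw [Finset.sum_subtype_of_mem (fun ρ => pairKernel w ρ)]
    · have : (s n).toFinset.val = s n :=
        Multiset.dedup_eq_self.2 ((hfac n).nodup hf.simple)
      rw [Finset.sum_eq_multiset_sum, this]
    · intro x hx
      exact ((hmem n x).1 (Multiset.mem_toFinset.1 hx)).1
  have hlim : ∀ w : ℂ, w.im ≠ 0 →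
      Tendsto (fun n => ∑ ρ ∈ F n, pairKernel w ρ) atTop (𝓝 (logDeriv f w)) := by
    intro w hw
    rw [Metric.tendsto_atTop]
    intro ε hε
    obtain ⟨R₀, -, hR₀⟩ := hf.exists_cofactor_near (r := ‖w‖) (half_pos hε)
    obtain ⟨N, hN⟩ := exists_nat_ge (max R₀ ‖w‖)
    refine ⟨N, fun n hn => ?_⟩
    have hn' : max R₀ ‖w‖ ≤ (n : ℝ) + 1 := by
      have : (N : ℝ) ≤ n := by exact_mod_cast hn
      linarith
    have h1 := (hR₀ _ ((le_max_left _ _).trans hn') _ _ (hfac n) (hne n) w le_rfl).2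
    rw [dist_eq_norm, hsum, (hfac n).logDeriv_eq hw (hne n w ((le_max_right _ _).trans hn')),
      sub_add_cancel_left, norm_neg]
    linarith
  have hsq : Summable fun ρ : posZeros f => 1 / (1 + (ρ : ℝ) ^ 2) := by
    have h1 := hlim Complex.I (by simp)
    have h2 := (Complex.continuous_im.tendsto _).comp h1
    have him : ∀ ρ : ℝ, (pairKernel Complex.I ρ).im = -(2 * (1 / (1 + ρ ^ 2))) := by
      intro ρ
      have := im_pairKernel 0 1 ρ
      simp only [Complex.ofReal_zero, Complex.ofReal_one, one_mul, zero_add] at this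
      rw [this, poissonPair]
      congr 1
      rw [zero_sub, neg_sq, zero_add, one_pow, add_comm (ρ ^ 2)]; ring
    have h3 : Tendsto (fun n => ∑ ρ ∈ F n, 1 / (1 + (ρ : ℝ) ^ 2)) atTop
        (𝓝 (-(logDeriv f Complex.I).im / 2)) := by
      refine (h2.neg.div_const 2).congr fun n => ?_
      simp only [Function.comp_apply, Complex.im_sum, him, Finset.sum_neg_distrib,
        ← Finset.mul_sum]
      ring
    refine summable_of_sum_le (c := -(logDeriv f Complex.I).im / 2) (fun ρ => by positivity)
      fun t => ?_
    refine ge_of_tendsto h3 ?_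
    filter_upwards [hF.eventually_ge_atTop t] with n hn
    exact Finset.sum_le_sum_of_subset_of_nonneg hn fun ρ _ _ => by positivity
  have hsummable : Summable fun ρ : posZeros f => pairKernel z ρ := by
    set c : ℝ := (1 + 2 * z.re ^ 2) / z.im ^ 2 + 2 with hc
    have hc0 : 0 < c := by positivity
    have hnorm : ∀ ρ : ℝ, 1 + ρ ^ 2 ≤ c * ‖z - ρ‖ ^ 2 := by
      intro ρ
      have := one_add_sq_le (x := z.re) (ρ := ρ) hz
      rw [Complex.sq_norm, Complex.normSq_apply]
      simpa [sq, hc] using this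
    refine Summable.of_norm_bounded (g := fun ρ : posZeros f =>
      2 * ‖z‖ * c * (1 / (1 + (ρ : ℝ) ^ 2))) (hsq.mul_left _) fun ρ => ?_
    have h1 := sub_ofReal_ne_zero hz ρ
    have h2 := add_ofReal_ne_zero hz ρ
    have hk : pairKernel z ρ = 2 * z / ((z - ρ) * (z + ρ)) := by
      rw [pairKernel]; field_simp; ring
    rw [hk, norm_div, norm_mul, norm_mul, Complex.norm_ofNat, mul_assoc (2 * ‖z‖) c,
      div_eq_mul_one_div]
    gcongr
    have h3 := hnorm ρ
    have h4 := hnorm (-ρ)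
    rw [Complex.ofReal_neg, sub_neg_eq_add, neg_sq] at h4
    have hA : 0 < ‖z - ρ‖ := norm_pos_iff.2 h1
    have hB : 0 < ‖z + ρ‖ := norm_pos_iff.2 h2
    rw [mul_one_div, div_le_div_iff₀ (by positivity) (by positivity), one_mul]
    have h5 : (1 + (ρ : ℝ) ^ 2) ^ 2 ≤ (c * (‖z - ρ‖ * ‖z + ρ‖)) ^ 2 := by
      calc (1 + (ρ : ℝ) ^ 2) ^ 2 = (1 + (ρ : ℝ) ^ 2) * (1 + (ρ : ℝ) ^ 2) := sq _
        _ ≤ (c * ‖z - ρ‖ ^ 2) * (c * ‖z + ρ‖ ^ 2) :=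
          mul_le_mul h3 h4 (by positivity) (by positivity)
        _ = _ := by ring
    exact (pow_le_pow_iff_left₀ (by positivity) (by positivity) two_ne_zero).1 h5
  have := tendsto_nhds_unique (hsummable.hasSum.comp hF) (hlim z hz)
  rw [← this]
  exact hsummable.hasSum

/-- `-Im (f'/f)` as a sum of Poisson kernels. -/
lemma SimpleRealZeroEven.hasSum_poisson (hf : SimpleRealZeroEven f) (x : ℝ) {y : ℝ} (hy : 0 < y) :
    HasSum (fun ρ : posZeros f => poissonPair x y ρ)
      (-(logDeriv f (x + y * Complex.I)).im) := by
  have h := (Complex.hasSum_im (hf.hasSum_logDeriv (z := x + y * Complex.I) (by simp [hy.ne']))).neg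
  simpa only [im_pairKernel, neg_neg] using h

lemma SimpleRealZeroEven.hasSum_re (hf : SimpleRealZeroEven f) (x : ℝ) {y : ℝ} (hy : 0 < y) :
    HasSum (fun ρ : posZeros f => (x - ρ) / ((x - ρ) ^ 2 + y ^ 2) + (x + ρ) / ((x + ρ) ^ 2 + y ^ 2))
      (logDeriv f (x + y * Complex.I)).re := by
  have h := Complex.hasSum_re (hf.hasSum_logDeriv (z := x + y * Complex.I) (by simp [hy.ne']))
  simpa only [re_pairKernel] using h

lemma poissonPair_nonneg (x : ℝ) {y : ℝ} (hy : 0 < y) (ρ : ℝ) : 0 ≤ poissonPair x y ρ := by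
  unfold poissonPair; positivity

lemma SimpleRealZeroEven.im_logDeriv_nonpos (hf : SimpleRealZeroEven f) {z : ℂ} (hz : 0 < z.im) :
    (logDeriv f z).im ≤ 0 := by
  have := (hf.hasSum_poisson z.re hz).nonneg fun ρ => poissonPair_nonneg _ hz _
  rw [Complex.re_add_im] at this
  linarith

/-- `y · (-Im (f'/f)(x + iy))` is nondecreasing in `y`. -/
lemma SimpleRealZeroEven.mul_im_logDeriv_mono (hf : SimpleRealZeroEven f) (x : ℝ) {y₁ y₂ : ℝ}
    (h1 : 0 < y₁) (h2 : y₁ ≤ y₂) :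
    y₁ * -(logDeriv f (x + y₁ * Complex.I)).im ≤ y₂ * -(logDeriv f (x + y₂ * Complex.I)).im := by
  refine hasSum_le (fun ρ => ?_) ((hf.hasSum_poisson x h1).mul_left y₁)
    ((hf.hasSum_poisson x (h1.trans_le h2)).mul_left y₂)
  have key : ∀ a : ℝ, y₁ * (y₁ / (a ^ 2 + y₁ ^ 2)) ≤ y₂ * (y₂ / (a ^ 2 + y₂ ^ 2)) := by
    intro a
    have h3 : 0 < y₂ := h1.trans_le h2
    rw [← mul_div_assoc, ← mul_div_assoc, div_le_div_iff₀ (by positivity) (by positivity)]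
    have : y₁ * y₁ ≤ y₂ * y₂ := by nlinarith
    nlinarith [mul_le_mul_of_nonneg_left this (sq_nonneg a)]
  unfold poissonPair
  rw [mul_add, mul_add]
  exact add_le_add (key _) (key _)

/-! ### Zero counting from values of the logarithmic derivative -/

/-- The number of zeros of `f` in `(0, T]`. -/
def zeroCount (f : ℂ → ℂ) (T : ℝ) : ℕ := (posZeros f ∩ Iic T).ncard

/-- The error made when the sign function is replaced by
`(2/π) (arctan s + s / (1 + s²))` is `O(1 / (1 + s²))`. -/
lemma abs_sign_sub_arctan_le {s e : ℝ} (he : (0 < s → e = π / 2) ∧ (s < 0 → e = -(π / 2)) ∧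
    |e| ≤ π / 2) : |e - arctan s - s / (1 + s ^ 2)| ≤ 5 / (1 + s ^ 2) := by
  have key : ∀ s : ℝ, 0 < s → |π / 2 - arctan s - s / (1 + s ^ 2)| ≤ 5 / (1 + s ^ 2) := by
    intro s hs
    have h1 : arctan s⁻¹ = π / 2 - arctan s := Real.arctan_inv_of_pos hs
    rw [← h1]
    have h2 : 0 < arctan s⁻¹ := Real.arctan_pos.2 (inv_pos.2 hs)
    have h3 : arctan s⁻¹ ≤ s⁻¹ := by
      have := Real.le_tan h2.le (Real.arctan_lt_pi_div_two _)
      rwa [Real.tan_arctan] at this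
    have h4 := Real.arctan_lt_pi_div_two s⁻¹
    have h5 := Real.pi_lt_d2
    have h6 : 0 < s / (1 + s ^ 2) := by positivity
    rw [abs_le]
    constructor
    · have : s / (1 + s ^ 2) ≤ arctan s⁻¹ + 5 / (1 + s ^ 2) := by
        rcases le_total s 1 with h | h
        · have : s / (1 + s ^ 2) ≤ 5 / (1 + s ^ 2) := by gcongr; linarith
          linarith
        · have h8 : s⁻¹ / (1 + s⁻¹ ^ 2) ≤ arctan s⁻¹ := by
            set v := s⁻¹
            have hv : 0 < v := inv_pos.2 hs
            have h10 : sin (2 * arctan v) / 2 = v / (1 + v ^ 2) := by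
              rw [Real.sin_two_mul, Real.sin_arctan, Real.cos_arctan]
              have h11 : √(1 + v ^ 2) * √(1 + v ^ 2) = 1 + v ^ 2 :=
                Real.mul_self_sqrt (by positivity)
              field_simp
              rw [sq √(1 + v ^ 2), h11]
            rw [← h10]
            have := Real.sin_le (x := 2 * arctan v) (by linarith)
            linarith
          have h9 : s⁻¹ / (1 + s⁻¹ ^ 2) = s / (1 + s ^ 2) := by field_simp; ring
          have : 0 < 5 / (1 + s ^ 2) := by positivity
          linarith
      linarith
    · have : arctan s⁻¹ ≤ s / (1 + s ^ 2) + 5 / (1 + s ^ 2) := by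
        rcases le_total s 1 with h | h
        · have : 5 / 2 ≤ 5 / (1 + s ^ 2) := by gcongr; nlinarith
          linarith
        · refine h3.trans ?_
          rw [← add_div, inv_eq_one_div, div_le_div_iff₀ hs (by positivity)]
          nlinarith
      linarith
  obtain ⟨hp, hn, hb⟩ := he
  rcases lt_trichotomy s 0 with h | h | h
  · rw [hn h]
    have := key (-s) (by linarith)
    rw [Real.arctan_neg, neg_sq] at this
    rw [← abs_neg]
    convert this using 2
    ring
  · rw [h]
    have := Real.pi_lt_d2
    norm_num
    linarith
  · rw [hp h]; exact key s h

lemma hasDerivAt_arctan_div (a : ℝ) {y : ℝ} (hy : 0 < y) (x : ℝ) :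
    HasDerivAt (fun x => arctan ((x - a) / y)) (y / ((x - a) ^ 2 + y ^ 2)) x := by
  have h := (((hasDerivAt_id x).sub_const a).div_const y).arctan
  refine h.congr_deriv ?_
  simp only [id]
  field_simp
  ring

lemma continuous_poissonPair {y : ℝ} (hy : 0 < y) (ρ : ℝ) : Continuous fun x => poissonPair x y ρ := by
  unfold poissonPair
  have h1 : ∀ x, (x - ρ) ^ 2 + y ^ 2 ≠ 0 := fun x => by positivity
  have h2 : ∀ x, (x + ρ) ^ 2 + y ^ 2 ≠ 0 := fun x => by positivity
  fun_prop (disch := first | exact h1 _ | exact h2 _)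

lemma integral_poissonPair (T : ℝ) {y : ℝ} (hy : 0 < y) (ρ : ℝ) :
    ∫ x in (0 : ℝ)..T, poissonPair x y ρ = arctan ((T - ρ) / y) + arctan ((T + ρ) / y) := by
  have h : ∀ x ∈ uIcc 0 T, HasDerivAt (fun x => arctan ((x - ρ) / y) + arctan ((x - -ρ) / y))
      (poissonPair x y ρ) x := by
    intro x _
    refine ((hasDerivAt_arctan_div ρ hy x).add (hasDerivAt_arctan_div (-ρ) hy x)).congr_deriv ?_
    rw [poissonPair, sub_neg_eq_add]
  rw [intervalIntegral.integral_eq_sub_of_hasDerivAt h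
    ((continuous_poissonPair hy ρ).intervalIntegrable _ _)]
  have : arctan ((0 - ρ) / y) = -arctan ((0 - -ρ) / y) := by
    rw [← Real.arctan_neg]; congr 1; ring
  rw [this, sub_neg_eq_add]; ring

lemma poissonPair_le {x T y : ℝ} (hx : 0 ≤ x) (hxT : x ≤ T) (hy : 0 < y) (ρ : ℝ) :
    poissonPair x y ρ ≤ (3 + 2 * T ^ 2 / y ^ 2) * poissonPair 0 y ρ := by
  have key : ∀ a : ℝ, y / ((x - a) ^ 2 + y ^ 2)
      ≤ (3 + 2 * T ^ 2 / y ^ 2) * (y / ((0 - a) ^ 2 + y ^ 2)) := by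
    intro a
    rw [← mul_div_assoc, div_le_div_iff₀ (by positivity) (by positivity)]
    have h1 : 2 * T ^ 2 / y ^ 2 * y ^ 2 = 2 * T ^ 2 := by field_simp
    have h2 : 0 ≤ 2 * T ^ 2 / y ^ 2 * (x - a) ^ 2 := by positivity
    have h3 : x ^ 2 ≤ T ^ 2 := by gcongr
    have h4 : (0 - a) ^ 2 + y ^ 2 ≤ (3 + 2 * T ^ 2 / y ^ 2) * ((x - a) ^ 2 + y ^ 2) := by
      have e1 : (3 + 2 * T ^ 2 / y ^ 2) * ((x - a) ^ 2 + y ^ 2) = 3 * (x - a) ^ 2 + 3 * y ^ 2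
        + 2 * T ^ 2 / y ^ 2 * (x - a) ^ 2 + 2 * T ^ 2 / y ^ 2 * y ^ 2 := by ring
      rw [e1, h1]
      nlinarith [sq_nonneg (2 * x - a), sq_nonneg (x - a), sq_nonneg y]
    calc y * ((0 - a) ^ 2 + y ^ 2) ≤ y * ((3 + 2 * T ^ 2 / y ^ 2) * ((x - a) ^ 2 + y ^ 2)) := by
          gcongr
      _ = _ := by ring
  have h1 := key ρ
  have h2 := key (-ρ)
  simp only [sub_neg_eq_add] at h2
  unfold poissonPair
  linarith

/-- The partial fraction expansion integrated over a horizontal segment. -/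
lemma SimpleRealZeroEven.hasSum_arctan (hf : SimpleRealZeroEven f) {T y : ℝ} (hT : 0 ≤ T)
    (hy : 0 < y) :
    HasSum (fun ρ : posZeros f => arctan ((T - ρ) / y) + arctan ((T + ρ) / y))
      (∫ x in (0 : ℝ)..T, -(logDeriv f (x + y * Complex.I)).im) := by
  have : Countable (posZeros f) := hf.countable_zeros.to_subtype
  have h := intervalIntegral.hasSum_integral_of_dominated_convergence (μ := volume) (a := 0) (b := T)
    (F := fun (ρ : posZeros f) (x : ℝ) => poissonPair x y ρ)
    (f := fun x => -(logDeriv f (x + y * Complex.I)).im)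
    (fun ρ _ => (3 + 2 * T ^ 2 / y ^ 2) * poissonPair 0 y ρ)
    (fun ρ => (continuous_poissonPair hy ρ).aestronglyMeasurable)
    (fun ρ => Eventually.of_forall fun x hx => ?_)
    (Eventually.of_forall fun x _ => (hf.hasSum_poisson 0 hy).summable.mul_left _)
    (by simp)
    (Eventually.of_forall fun x _ => hf.hasSum_poisson x hy)
  · simpa only [integral_poissonPair T hy] using h
  · rw [uIoc_of_le hT] at hx
    rw [Real.norm_of_nonneg (poissonPair_nonneg x hy ρ)]
    exact poissonPair_le hx.1.le hx.2 hy ρ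

/-- The zero counting function, up to an error controlled by a Poisson integral at the height `y`,
is given by values of the logarithmic derivative at the height `y`. -/
lemma SimpleRealZeroEven.abs_zeroCount_sub_le (hf : SimpleRealZeroEven f) {T y : ℝ} (hT : 0 ≤ T)
    (hy : 0 < y) :
    |π * zeroCount f T - (∫ x in (0 : ℝ)..T, -(logDeriv f (x + y * Complex.I)).im)
      - y * (logDeriv f (T + y * Complex.I)).re| ≤ 5 * y * -(logDeriv f (T + y * Complex.I)).im := by
  classical
  have hcount : HasSum (fun ρ : posZeros f => if (ρ : ℝ) ≤ T then π else 0) (π * zeroCount f T) := by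
    have hfin := hf.finite_zeros T
    have hsub : {ρ : posZeros f | (ρ : ℝ) ≤ T}.Finite := by
      have := hfin.preimage (f := ((↑) : posZeros f → ℝ)) Subtype.val_injective.injOn
      refine this.subset fun ρ hρ => ?_
      exact ⟨ρ.2, hρ⟩
    have hS : HasSum (fun ρ : posZeros f => if (ρ : ℝ) ≤ T then π else 0)
        (∑ ρ ∈ hsub.toFinset, if (ρ : ℝ) ≤ T then π else 0) :=
      hasSum_sum_of_ne_finset_zero (fun ρ hρ => by
        rw [if_neg]; intro h; exact hρ (hsub.mem_toFinset.2 h))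
    have hcard : hsub.toFinset.card = zeroCount f T := by
      rw [zeroCount, ← Set.ncard_eq_toFinset_card _ hsub,
        ← Set.ncard_image_of_injective _ (Subtype.val_injective (p := (· ∈ posZeros f)))]
      congr 1
      ext x
      simp only [mem_image, Subtype.exists, mem_inter_iff, mem_Iic]
      constructor
      · rintro ⟨a, ha, h1, rfl⟩; exact ⟨ha, h1⟩
      · rintro ⟨h1, h2⟩; exact ⟨x, h1, h2, rfl⟩
    have : ∑ ρ ∈ hsub.toFinset, (if (ρ : ℝ) ≤ T then π else 0) = π * zeroCount f T := by
      rw [Finset.sum_congr rfl (g := fun _ => π) (fun ρ hρ => by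
          have h : (ρ : ℝ) ≤ T := hsub.mem_toFinset.1 hρ
          rw [if_pos h]),
        Finset.sum_const, hcard, nsmul_eq_mul, mul_comm]
    rwa [this] at hS
  have hre := (hf.hasSum_re T hy).mul_left y
  have hp := (hf.hasSum_poisson T hy).mul_left (5 * y)
  have hall := (hcount.sub (hf.hasSum_arctan hT hy)).sub hre
  rw [← Real.norm_eq_abs, ← hall.tsum_eq]
  refine tsum_of_norm_bounded hp fun ρ => ?_
  have hρ : 0 < (ρ : ℝ) := ρ.2.1
  have hpi := Real.pi_pos
  have h1 := abs_sign_sub_arctan_le (s := (T - ρ) / y)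
    (e := (if (ρ : ℝ) ≤ T then π else 0) - π / 2) ⟨fun h => by
      have : 0 < T - ρ := by by_contra h'; exact absurd h (not_lt.2 (div_nonpos_of_nonpos_of_nonneg (not_lt.1 h') hy.le))
      rw [if_pos (by linarith)]; ring, fun h => by
      have : T - ρ < 0 := by by_contra h'; exact absurd h (not_lt.2 (div_nonneg (not_lt.1 h') hy.le))
      rw [if_neg (by linarith)]; ring, by
      split_ifs <;> rw [abs_le] <;> constructor <;> linarith⟩
  have h2 := abs_sign_sub_arctan_le (s := (T + ρ) / y) (e := π / 2) ⟨fun _ => rfl, fun h =>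
    absurd h (not_lt.2 (by positivity)), by rw [abs_of_pos (by positivity)]⟩
  have e1 : ∀ a : ℝ, y * (a / (a ^ 2 + y ^ 2)) = (a / y) / (1 + (a / y) ^ 2) := by
    intro a; field_simp; ring
  have e2 : ∀ a : ℝ, 5 * y * (y / (a ^ 2 + y ^ 2)) = 5 / (1 + (a / y) ^ 2) := by
    intro a; field_simp; ring
  rw [Real.norm_eq_abs, poissonPair, mul_add (5 * y), e2, e2, mul_add y, e1, e1]
  refine le_trans (le_of_eq ?_) ((abs_add_le _ _).trans (add_le_add h1 h2))
  congr 1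
  ring

/-! ### The logarithmic derivative along the heat flow -/

/-- `u = H_t' / H_t`. -/
def heatLog (t z : ℂ) : ℂ := heatInt 1 t z / heatInt 0 t z

/-- The `z`-derivative of `heatLog`. -/
def heatLog₁ (t z : ℂ) : ℂ := heatInt 2 t z / heatInt 0 t z - heatLog t z ^ 2

/-- The second `z`-derivative of `heatLog`. -/
def heatLog₂ (t z : ℂ) : ℂ := heatInt 3 t z / heatInt 0 t z
  - heatInt 1 t z * heatInt 2 t z / heatInt 0 t z ^ 2 - 2 * heatLog t z * heatLog₁ t z

lemma logDeriv_heatInt (t : ℂ) : logDeriv (heatInt 0 t) = heatLog t := by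
  funext z
  rw [logDeriv_apply, deriv_heatInt]; rfl

lemma hasDerivAt_heatLog {t z : ℂ} (h : heatInt 0 t z ≠ 0) :
    HasDerivAt (heatLog t) (heatLog₁ t z) z := by
  refine ((hasDerivAt_heatInt 1 t z).div (hasDerivAt_heatInt 0 t z) h).congr_deriv ?_
  simp only [heatLog₁, heatLog]
  field_simp

lemma hasDerivAt_heatLog₁ {t z : ℂ} (h : heatInt 0 t z ≠ 0) :
    HasDerivAt (heatLog₁ t) (heatLog₂ t z) z := by
  refine (((hasDerivAt_heatInt 2 t z).div (hasDerivAt_heatInt 0 t z) h).sub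
    ((hasDerivAt_heatLog h).pow 2)).congr_deriv ?_
  simp only [heatLog₂, heatLog₁, heatLog, Nat.cast_ofNat, Nat.add_one_sub_one, pow_one]
  field_simp

/-- The heat equation for `H` becomes the Burgers-type equation `∂_t u = -(u'' + 2 u u')`. -/
lemma hasDerivAt_heatLog_curve {α β : ℝ → ℂ} {α' β' : ℂ} {s : ℝ} (hα : HasDerivAt α α' s)
    (hβ : HasDerivAt β β' s) (h : heatInt 0 (α s) (β s) ≠ 0) :
    HasDerivAt (fun s => heatLog (α s) (β s))
      (-(heatLog₂ (α s) (β s) + 2 * heatLog (α s) (β s) * heatLog₁ (α s) (β s)) * α'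
        + heatLog₁ (α s) (β s) * β') s := by
  refine ((hasDerivAt_heatInt_curve 1 hα hβ).div (hasDerivAt_heatInt_curve 0 hα hβ) h).congr_deriv ?_
  simp only [heatLog₂, heatLog₁, heatLog]
  field_simp
  ring

lemma SimpleRealZeroEven.ne_zero {f : ℂ → ℂ} (hf : SimpleRealZeroEven f) {z : ℂ}
    (hz : 0 < z.im) : f z ≠ 0 := fun h => hz.ne' (hf.real z h)

/-- Harnack-type estimate: on the upper half-plane `Im u ≤ 0`, so the increments of `u` are
controlled by `-Im u`. -/
lemma SimpleRealZeroEven.norm_logDeriv_sub_le {f : ℂ → ℂ} (hf : SimpleRealZeroEven f) {z w : ℂ}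
    (hz : 0 < z.im) {M : ℝ} (hM : -(logDeriv f z).im < M) (hw : ‖w - z‖ ≤ z.im / 2) :
    ‖logDeriv f w - logDeriv f z‖ ≤ 2 * M := by
  have hM0 : 0 < M := lt_of_le_of_lt (by linarith [hf.im_logDeriv_nonpos hz]) hM
  have him : ∀ v ∈ Metric.ball (0 : ℂ) z.im, 0 < (z + v).im := by
    intro v hv
    have h1 := Complex.abs_im_le_norm v
    have h2 := neg_abs_le v.im
    rw [mem_ball_zero_iff] at hv
    rw [Complex.add_im]; linarith
  have hd : DifferentiableOn ℂ (fun v => -Complex.I * (logDeriv f (z + v) - logDeriv f z))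
      (Metric.ball 0 z.im) := by
    intro v hv
    refine DifferentiableAt.differentiableWithinAt ?_
    have h1 : DifferentiableAt ℂ (logDeriv f) (z + v) :=
      (hf.diff.deriv _).div (hf.diff _) (hf.ne_zero (him v hv))
    have h2 : DifferentiableAt ℂ (fun v => logDeriv f (z + v)) v :=
      h1.comp v ((differentiableAt_id).const_add z)
    exact (h2.sub_const _).const_mul _
  have := Complex.borelCaratheodory_zero hM0 hd (fun v hv => ?_) hz
    (mem_ball_zero_iff.2 (by linarith) : w - z ∈ Metric.ball (0 : ℂ) z.im) (by simp)
  · simp only [add_sub_cancel, norm_mul, norm_neg, Complex.norm_I, one_mul] at this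
    refine this.trans ?_
    rw [div_le_iff₀ (by linarith)]
    nlinarith [norm_nonneg (w - z)]
  · have h3 := hf.im_logDeriv_nonpos (him v hv)
    show (-Complex.I * (logDeriv f (z + v) - logDeriv f z)).re ≤ M
    simp only [Complex.mul_re, Complex.neg_re, Complex.I_re, Complex.neg_im, Complex.I_im,
      Complex.sub_im, Complex.sub_re]
    linarith

/-- Cauchy estimates on discs of radius `Im z / 4`, with the strict bound `M` that Borel-Carathéodory
requires. -/
lemma SimpleRealZeroEven.norm_deriv_logDeriv_le_aux {f : ℂ → ℂ} (hf : SimpleRealZeroEven f) {z : ℂ}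
    (hz : 0 < z.im) {M : ℝ} (hM : -(logDeriv f z).im < M) :
    ‖deriv (logDeriv f) z‖ ≤ 32 * M / z.im ∧
      ‖deriv (deriv (logDeriv f)) z‖ ≤ 32 * M / z.im ^ 2 := by
  have hM0 : 0 < M := lt_of_le_of_lt (by linarith [hf.im_logDeriv_nonpos hz]) hM
  have him : ∀ v ∈ Metric.ball z z.im, 0 < v.im := by
    intro v hv
    have h1 := Complex.abs_im_le_norm (v - z)
    have h2 := neg_abs_le (v - z).im
    rw [mem_ball_iff_norm] at hv
    rw [Complex.sub_im] at h1 h2; linarith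
  have hd : DifferentiableOn ℂ (logDeriv f) (Metric.ball z z.im) := fun v hv =>
    ((hf.diff.deriv _).div (hf.diff _) (hf.ne_zero (him v hv))).differentiableWithinAt
  have b1 : ∀ v : ℂ, ‖v - z‖ ≤ z.im / 4 → ‖deriv (logDeriv f) v‖ ≤ 2 * M / (z.im / 4) := by
    intro v hv
    have hsub : ∀ w ∈ Metric.closedBall v (z.im / 4), ‖w - z‖ ≤ z.im / 2 := by
      intro w hw
      rw [mem_closedBall_iff_norm] at hw
      have := norm_sub_le_norm_sub_add_norm_sub w v z
      linarith
    have he : deriv (logDeriv f) v = deriv (fun w => logDeriv f w - logDeriv f z) v := by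
      rw [deriv_sub_const]
    rw [he]
    refine Complex.norm_deriv_le_of_forall_mem_sphere_norm_le (by positivity) ?_
      (fun w hw => hf.norm_logDeriv_sub_le hz hM (hsub w (Metric.sphere_subset_closedBall hw)))
    refine DifferentiableOn.diffContOnCl ((hd.sub_const _).mono fun w hw => ?_)
    rw [closure_ball _ (by positivity)] at hw
    rw [mem_ball_iff_norm]
    linarith [hsub w hw]
  have hd' : DifferentiableOn ℂ (deriv (logDeriv f)) (Metric.ball z z.im) :=
    hd.deriv Metric.isOpen_ball
  constructor
  · refine (b1 z (by simp; positivity)).trans ?_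
    rw [div_le_div_iff₀ (by positivity) hz]
    nlinarith [mul_pos hM0 hz]
  · have := Complex.norm_deriv_le_of_forall_mem_sphere_norm_le (c := z) (R := z.im / 4)
      (f := deriv (logDeriv f)) (by positivity)
      (DifferentiableOn.diffContOnCl (hd'.mono fun w hw => by
        rw [closure_ball _ (by positivity), mem_closedBall_iff_norm] at hw
        rw [mem_ball_iff_norm]; linarith))
      (fun w hw => b1 w (by rw [mem_sphere_iff_norm] at hw; exact hw.le))
    refine this.trans (le_of_eq ?_)
    field_simp; ring

lemma SimpleRealZeroEven.norm_deriv_logDeriv_le {f : ℂ → ℂ} (hf : SimpleRealZeroEven f) {z : ℂ}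
    (hz : 0 < z.im) : ‖deriv (logDeriv f) z‖ ≤ 32 * -(logDeriv f z).im / z.im ∧
      ‖deriv (deriv (logDeriv f)) z‖ ≤ 32 * -(logDeriv f z).im / z.im ^ 2 := by
  have h : ∀ δ > (0 : ℝ), _ := fun δ (hδ : (0 : ℝ) < δ) =>
    hf.norm_deriv_logDeriv_le_aux hz (M := -(logDeriv f z).im + δ) (by linarith)
  constructor
  · rw [le_div_iff₀ hz, ← div_le_iff₀' (by norm_num)]
    refine le_of_forall_pos_le_add fun δ hδ => ?_
    have := (h δ hδ).1
    rwa [le_div_iff₀ hz, ← div_le_iff₀' (by norm_num)] at this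
  · have hz2 : 0 < z.im ^ 2 := by positivity
    rw [le_div_iff₀ hz2, ← div_le_iff₀' (by norm_num)]
    refine le_of_forall_pos_le_add fun δ hδ => ?_
    have := (h δ hδ).2
    rwa [le_div_iff₀ hz2, ← div_le_iff₀' (by norm_num)] at this

/-- All zeros of `H_t` are real and simple. (For `t ≤ 0` the other conditions in
`SimpleRealZeroEven` hold automatically.) -/
def RealSimpleAt (t : ℝ) : Prop := SimpleRealZeroEven (heatInt 0 t)

lemma RealSimpleAt.ne_zero {t : ℝ} (h : RealSimpleAt t) {z : ℂ} (hz : 0 < z.im) :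
    heatInt 0 t z ≠ 0 := SimpleRealZeroEven.ne_zero h hz

lemma RealSimpleAt.norm_heatLog₁_le {t : ℝ} (h : RealSimpleAt t) {z : ℂ} (hz : 0 < z.im) :
    ‖heatLog₁ t z‖ ≤ 32 * ‖heatLog t z‖ / z.im ∧ ‖heatLog₂ t z‖ ≤ 32 * ‖heatLog t z‖ / z.im ^ 2 := by
  have hb := SimpleRealZeroEven.norm_deriv_logDeriv_le h hz
  rw [logDeriv_heatInt] at hb
  have h1 : deriv (heatLog t) z = heatLog₁ t z := (hasDerivAt_heatLog (h.ne_zero hz)).deriv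
  have h2 : deriv (deriv (heatLog t)) z = heatLog₂ t z := by
    have : deriv (heatLog t) =ᶠ[𝓝 z] heatLog₁ t := by
      filter_upwards [(isOpen_lt continuous_const Complex.continuous_im).mem_nhds hz] with w hw
      exact (hasDerivAt_heatLog (h.ne_zero hw)).deriv
    rw [this.deriv_eq, (hasDerivAt_heatLog₁ (h.ne_zero hz)).deriv]
  rw [h1, h2] at hb
  have h3 : -(heatLog t z).im ≤ ‖heatLog t z‖ :=
    (neg_le_abs _).trans (Complex.abs_im_le_norm _)
  refine ⟨hb.1.trans ?_, hb.2.trans ?_⟩ <;> gcongr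

/-- Riccati-type a priori bound: at height at least `K M` above the real axis the size of `u` at
most doubles during bounded time. -/
lemma norm_heatLog_le_two_mul {T₀ t : ℝ} (ht : t ≤ 0) (htT : -t ≤ T₀)
    (hgood : ∀ s ∈ Icc t 0, RealSimpleAt s) {z : ℂ} {M : ℝ} (hM : 1 ≤ M)
    (h0 : ‖heatLog 0 z‖ ≤ M) (hz : 400 * (T₀ + 1) * M ≤ z.im) {s : ℝ} (hs : s ∈ Icc t 0) :
    ‖heatLog s z‖ ≤ 2 * M := by
  have hT₀ : 0 ≤ T₀ := by linarith
  have hz0 : 0 < z.im := lt_of_lt_of_le (by positivity) hz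
  -- time is reversed, `s = -σ`, since the flow is followed backwards from time zero
  set F : ℝ → ℂ := fun σ => heatLog ((-σ : ℝ) : ℂ) z
  set F' : ℝ → ℂ := fun σ => heatLog₂ ((-σ : ℝ) : ℂ) z
    + 2 * heatLog ((-σ : ℝ) : ℂ) z * heatLog₁ ((-σ : ℝ) : ℂ) z
  have hF : ∀ σ ∈ Icc (0 : ℝ) (-t), HasDerivAt F (F' σ) σ := by
    intro σ hσ
    have hα : HasDerivAt (fun σ : ℝ => ((-σ : ℝ) : ℂ)) ((-1 : ℝ) : ℂ) σ :=
      (hasDerivAt_neg σ).ofReal_comp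
    refine (hasDerivAt_heatLog_curve hα (hasDerivAt_const σ z) ?_).congr_deriv ?_
    · exact (hgood (-σ) ⟨by linarith [hσ.2], by linarith [hσ.1]⟩).ne_zero hz0
    · simp [F']
  have key := image_norm_le_of_norm_deriv_right_lt_deriv_boundary' (a := 0) (b := -t) (f := F)
    (f' := F') (B := fun σ => M * (1 + σ / (T₀ + 1))) (B' := fun _ => M / (T₀ + 1))
    (fun σ hσ => (hF σ hσ).continuousAt.continuousWithinAt)
    (fun σ hσ => (hF σ ⟨hσ.1, hσ.2.le⟩).hasDerivWithinAt) (by simpa [F] using h0)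
    (by fun_prop) (fun σ _ => by
      have : HasDerivAt (fun σ => M * (1 + σ / (T₀ + 1))) (M * (1 / (T₀ + 1))) σ :=
        (((hasDerivAt_id σ).div_const (T₀ + 1)).const_add 1).const_mul M
      rw [mul_one_div] at this
      exact this.hasDerivWithinAt) (fun σ hσ he => ?_)
  · have hs' : -s ∈ Icc (0 : ℝ) (-t) := ⟨by linarith [hs.2], by linarith [hs.1]⟩
    have h1 := key hs'
    simp only [F, neg_neg] at h1
    refine h1.trans ?_
    have : -s / (T₀ + 1) ≤ 1 := by
      rw [div_le_one (by positivity)]; linarith [hs.1]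
    nlinarith
  · have hgs := hgood (-σ) ⟨by linarith [hσ.2], by linarith [hσ.1]⟩
    obtain ⟨b1, b2⟩ := hgs.norm_heatLog₁_le hz0
    set q := ‖F σ‖ with hq
    have hq2 : q ≤ 2 * M := by
      rw [he]
      have : σ / (T₀ + 1) ≤ 1 := by
        rw [div_le_one (by positivity)]; linarith [hσ.2]
      nlinarith
    have hq0 : 0 ≤ q := norm_nonneg _
    have hF' : ‖F' σ‖ ≤ 32 * q / z.im ^ 2 + 2 * q * (32 * q / z.im) := by
      refine (norm_add_le _ _).trans (add_le_add b2 ?_)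
      rw [norm_mul, norm_mul, Complex.norm_ofNat]
      gcongr
    refine lt_of_le_of_lt hF' ?_
    have hz1 : 1 ≤ z.im := le_trans (by nlinarith) hz
    have h3 : 32 * q / z.im ^ 2 ≤ 64 * M ^ 2 / z.im := by
      rw [div_le_div_iff₀ (by positivity) hz0]
      have : 32 * q ≤ 64 * M ^ 2 := by nlinarith
      nlinarith [mul_le_mul_of_nonneg_right this hz0.le, mul_nonneg (sq_nonneg M) hz0.le]
    have h4 : 2 * q * (32 * q / z.im) ≤ 256 * M ^ 2 / z.im := by
      have : 2 * q * (32 * q / z.im) = 64 * q ^ 2 / z.im := by ring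
      rw [this]
      refine div_le_div_of_nonneg_right ?_ hz0.le
      nlinarith
    have h5 : 64 * M ^ 2 / z.im + 256 * M ^ 2 / z.im < M / (T₀ + 1) := by
      rw [← add_div, div_lt_div_iff₀ hz0 (by positivity)]
      nlinarith [mul_le_mul_of_nonneg_left hz (by linarith : 0 ≤ M),
        mul_pos (pow_pos (by linarith : 0 < M) 2) (by linarith : 0 < T₀ + 1)]
    linarith

/-- Following the straight characteristic `z + 2 c (s - t)`, the difference `u - c` is controlled by
Gronwall's inequality. -/
lemma norm_heatLog_sub_le {T₀ t : ℝ} (ht : t ≤ 0) (htT : -t ≤ T₀)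
    (hgood : ∀ s ∈ Icc t 0, RealSimpleAt s) {z c : ℂ} {M δ : ℝ} (hM : 1 ≤ M)
    (h0 : ∀ s ∈ Icc t 0, ‖heatLog 0 (z + 2 * c * (s - t))‖ ≤ M)
    (hz : ∀ s ∈ Icc t 0, 400 * (T₀ + 1) * M ≤ (z + 2 * c * (s - t)).im)
    (hδ : ‖heatLog 0 (z + 2 * c * (0 - t)) - c‖ ≤ δ) :
    ‖heatLog t z - c‖ ≤ (δ + 1) * exp (2 * T₀) := by
  have hT₀ : 0 ≤ T₀ := by linarith
  have hδ0 : 0 ≤ δ := (norm_nonneg _).trans hδ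
  set ζ : ℝ → ℂ := fun σ => z + 2 * c * ((-σ : ℝ) - t) with hζ
  set F : ℝ → ℂ := fun σ => heatLog ((-σ : ℝ) : ℂ) (ζ σ) - c
  set F' : ℝ → ℂ := fun σ => heatLog₂ ((-σ : ℝ) : ℂ) (ζ σ)
    + 2 * F σ * heatLog₁ ((-σ : ℝ) : ℂ) (ζ σ)
  have hmem : ∀ σ ∈ Icc (0 : ℝ) (-t), -σ ∈ Icc t 0 := fun σ hσ =>
    ⟨by linarith [hσ.2], by linarith [hσ.1]⟩
  have hpos : ∀ σ ∈ Icc (0 : ℝ) (-t), 400 * (T₀ + 1) * M ≤ (ζ σ).im := fun σ hσ =>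
    hz (-σ) (hmem σ hσ)
  have hpos' : ∀ σ ∈ Icc (0 : ℝ) (-t), 0 < (ζ σ).im := fun σ hσ =>
    lt_of_lt_of_le (by positivity) (hpos σ hσ)
  have hF : ∀ σ ∈ Icc (0 : ℝ) (-t), HasDerivAt F (F' σ) σ := by
    intro σ hσ
    have hα : HasDerivAt (fun σ : ℝ => ((-σ : ℝ) : ℂ)) ((-1 : ℝ) : ℂ) σ :=
      (hasDerivAt_neg σ).ofReal_comp
    have hβ : HasDerivAt ζ (2 * c * ((-1 : ℝ) : ℂ)) σ :=
      ((hα.sub_const (t : ℂ)).const_mul (2 * c)).const_add z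
    refine ((hasDerivAt_heatLog_curve hα hβ ?_).sub_const c).congr_deriv ?_
    · exact (hgood _ (hmem σ hσ)).ne_zero (hpos' σ hσ)
    · simp only [F', F]; push_cast; ring
  have key := norm_le_gronwallBound_of_norm_deriv_right_le (f := F) (f' := F') (δ := δ) (K := 2)
    (ε := 1) (a := 0) (b := -t) (fun σ hσ => (hF σ hσ).continuousAt.continuousWithinAt)
    (fun σ hσ => (hF σ ⟨hσ.1, hσ.2.le⟩).hasDerivWithinAt)
    (by simpa [F, hζ] using hδ) (fun σ hσ => ?_) (-t) (right_mem_Icc.2 (by linarith))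
  · rw [gronwallBound_of_K_ne_0 two_ne_zero] at key
    have h1 : F (-t) = heatLog t z - c := by simp [F, hζ]
    rw [h1] at key
    refine key.trans ?_
    have h2 : exp (2 * (-t - 0)) ≤ exp (2 * T₀) := Real.exp_le_exp.2 (by linarith)
    have h3 := Real.exp_pos (2 * T₀)
    nlinarith [mul_le_mul_of_nonneg_left h2 hδ0]
  · have hσ' : σ ∈ Icc (0 : ℝ) (-t) := ⟨hσ.1, hσ.2.le⟩
    have hy0 := hpos' σ hσ'
    have hy := hpos σ hσ'
    obtain ⟨b1, b2⟩ := (hgood _ (hmem σ hσ')).norm_heatLog₁_le hy0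
    have hu := norm_heatLog_le_two_mul ht htT hgood hM (h0 (-σ) (hmem σ hσ')) hy (hmem σ hσ')
    have hy1 : 400 * M ≤ (ζ σ).im := le_trans (by nlinarith) hy
    have c1 : ‖heatLog₁ ((-σ : ℝ) : ℂ) (ζ σ)‖ ≤ 1 := by
      refine b1.trans ?_
      rw [div_le_one hy0]; linarith
    have c2 : ‖heatLog₂ ((-σ : ℝ) : ℂ) (ζ σ)‖ ≤ 1 := by
      refine b2.trans ?_
      rw [div_le_one (by positivity)]; nlinarith
    calc ‖F' σ‖ ≤ 1 + 2 * ‖F σ‖ * 1 := by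
          refine (norm_add_le _ _).trans (add_le_add c2 ?_)
          rw [norm_mul, norm_mul, Complex.norm_ofNat]
          gcongr
      _ = 2 * ‖F σ‖ + 1 := by ring

/-! ### The digamma function -/

/-- The summand of `log (s Γ(s))` in Euler's product. -/
def eulerTerm (k : ℕ) (s : ℂ) : ℂ :=
  s * log (1 + 1 / ((k : ℝ) + 1)) - Complex.log (1 + s / ((k : ℂ) + 1))

lemma one_add_div_mem_slitPlane {s : ℂ} (hs : 0 < s.re) (k : ℕ) :
    1 + s / ((k : ℂ) + 1) ∈ Complex.slitPlane := by
  refine Or.inl ?_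
  have : ((k : ℂ) + 1) = (((k : ℝ) + 1 : ℝ) : ℂ) := by push_cast; rfl
  rw [this, Complex.add_re, Complex.one_re, Complex.div_ofReal_re]
  positivity

lemma hasDerivAt_eulerTerm (k : ℕ) {s : ℂ} (hs : 0 < s.re) :
    HasDerivAt (eulerTerm k) (log (1 + 1 / ((k : ℝ) + 1)) - 1 / (s + (k + 1))) s := by
  have h1 : HasDerivAt (fun s : ℂ => 1 + s / ((k : ℂ) + 1)) (1 / ((k : ℂ) + 1)) s :=
    ((hasDerivAt_id s).div_const _).const_add 1
  have h2 := h1.clog (one_add_div_mem_slitPlane hs k)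
  have h3 := ((hasDerivAt_id s).mul_const ((log (1 + 1 / ((k : ℝ) + 1)) : ℝ) : ℂ)).sub h2
  refine h3.congr_deriv ?_
  have hk : (k : ℂ) + 1 ≠ 0 := by exact_mod_cast Nat.succ_ne_zero k
  have hsk := Complex.slitPlane_ne_zero (one_add_div_mem_slitPlane hs k)
  have hsk' : s + (k + 1) ≠ 0 := by
    intro h
    apply hsk
    field_simp
    linear_combination h
  rw [one_mul, div_div]
  congr 2
  field_simp
  ring

lemma norm_add_natCast_ge {s : ℂ} (hs : 0 ≤ s.re) (k : ℕ) : (k : ℝ) ≤ ‖s + k‖ := by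
  have := Complex.re_le_norm (s + k)
  simp at this
  linarith

lemma norm_deriv_eulerTerm_le (k : ℕ) {s : ℂ} (hs : 0 < s.re) :
    ‖(log (1 + 1 / ((k : ℝ) + 1)) : ℂ) - 1 / (s + (k + 1))‖ ≤ (1 + ‖s‖) * (1 / ((k : ℝ) + 1) ^ 2) := by
  have hk : (0 : ℝ) < (k : ℝ) + 1 := by positivity
  have hkc : (k : ℂ) + 1 ≠ 0 := by exact_mod_cast Nat.succ_ne_zero k
  have hn : (k : ℝ) + 1 ≤ ‖s + (k + 1)‖ := by
    have := norm_add_natCast_ge hs.le (k + 1)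
    push_cast at this; exact this
  have hne : s + (k + 1) ≠ 0 := norm_pos_iff.1 (hk.trans_le hn)
  have h1 : |log (1 + 1 / ((k : ℝ) + 1)) - 1 / ((k : ℝ) + 1)| ≤ 1 / ((k : ℝ) + 1) ^ 2 := by
    have hx : 0 < 1 / ((k : ℝ) + 1) := by positivity
    have hu : log (1 + 1 / ((k : ℝ) + 1)) ≤ 1 / ((k : ℝ) + 1) := by
      have := Real.log_le_sub_one_of_pos (by positivity : 0 < 1 + 1 / ((k : ℝ) + 1))
      linarith
    have hl := Real.one_sub_inv_le_log_of_pos (by positivity : 0 < 1 + 1 / ((k : ℝ) + 1))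
    have e : 1 - (1 + 1 / ((k : ℝ) + 1))⁻¹ = 1 / ((k : ℝ) + 2) := by field_simp; ring
    rw [e] at hl
    have e2 : 1 / ((k : ℝ) + 1) - 1 / ((k : ℝ) + 2) ≤ 1 / ((k : ℝ) + 1) ^ 2 := by
      rw [div_sub_div _ _ (by positivity) (by positivity), div_le_div_iff₀ (by positivity) (by positivity)]
      nlinarith
    rw [abs_le]; constructor <;> linarith
  have h2 : ‖1 / ((k : ℂ) + 1) - 1 / (s + (k + 1))‖ ≤ ‖s‖ * (1 / ((k : ℝ) + 1) ^ 2) := by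
    have : 1 / ((k : ℂ) + 1) - 1 / (s + (k + 1)) = s / (((k : ℂ) + 1) * (s + (k + 1))) := by
      field_simp; ring
    have hnk : ‖(k : ℂ) + 1‖ = (k : ℝ) + 1 := by
      have : ((k : ℂ) + 1) = (((k : ℝ) + 1 : ℝ) : ℂ) := by push_cast; rfl
      rw [this, Complex.norm_real, Real.norm_of_nonneg hk.le]
    rw [this, norm_div, norm_mul, hnk, div_eq_mul_one_div]
    gcongr
    rw [sq]; gcongr
  have h3 : (log (1 + 1 / ((k : ℝ) + 1)) : ℂ) - 1 / (s + (k + 1))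
      = ((log (1 + 1 / ((k : ℝ) + 1)) - 1 / ((k : ℝ) + 1) : ℝ) : ℂ)
        + (1 / ((k : ℂ) + 1) - 1 / (s + (k + 1))) := by push_cast; ring
  rw [h3]
  refine (norm_add_le _ _).trans ?_
  rw [Complex.norm_real, Real.norm_eq_abs]
  linarith

lemma eulerTerm_one (k : ℕ) : eulerTerm k 1 = 0 := by
  unfold eulerTerm
  have : (1 : ℂ) + 1 / ((k : ℂ) + 1) = ((1 + 1 / ((k : ℝ) + 1) : ℝ) : ℂ) := by push_cast; rfl
  rw [this, ← Complex.ofReal_log (by positivity)]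
  simp

lemma hasDerivAt_tsum_eulerTerm {s : ℂ} (hs : 0 < s.re) :
    (Summable fun k => eulerTerm k s) ∧ HasDerivAt (fun s => ∑' k, eulerTerm k s)
      (∑' k : ℕ, ((log (1 + 1 / ((k : ℝ) + 1)) : ℂ) - 1 / (s + (k + 1)))) s := by
  set U : Set ℂ := {s : ℂ | 0 < s.re} ∩ Metric.ball 0 (‖s‖ + 2) with hU
  have hUo : IsOpen U := (isOpen_lt continuous_const Complex.continuous_re).inter Metric.isOpen_ball
  have hUc : IsPreconnected U :=
    ((convex_halfSpace_re_gt 0).inter (convex_ball _ _)).isPreconnected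
  have hsU : s ∈ U := ⟨hs, by simp⟩
  have h1U : (1 : ℂ) ∈ U := ⟨by simp, by simp; linarith [norm_nonneg s]⟩
  have hsum := summable_inv_succ_sq.mul_left (1 + (‖s‖ + 2))
  have hb : ∀ (k : ℕ), ∀ v ∈ U, ‖(log (1 + 1 / ((k : ℝ) + 1)) : ℂ) - 1 / (v + (k + 1))‖
      ≤ (1 + (‖s‖ + 2)) * (1 / ((k : ℝ) + 1) ^ 2) := by
    intro k v hv
    refine (norm_deriv_eulerTerm_le k hv.1).trans ?_
    have := (mem_ball_zero_iff.1 hv.2).le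
    gcongr
  have h1 : Summable fun k => eulerTerm k 1 := by simp only [eulerTerm_one]; exact summable_zero
  exact ⟨summable_of_summable_hasDerivAt_of_isPreconnected hsum hUo hUc
    (fun k v hv => hasDerivAt_eulerTerm k hv.1) hb h1U h1 hsU,
    hasDerivAt_tsum_of_isPreconnected hsum hUo hUc
    (fun k v hv => hasDerivAt_eulerTerm k hv.1) hb h1U h1 hsU⟩

/-- Partial products of Euler's product for the Gamma function. -/
lemma exp_sum_eulerTerm {s : ℂ} (hs : 0 < s.re) (n : ℕ) :
    Complex.exp (∑ k ∈ Finset.range n, eulerTerm k s) * ∏ k ∈ Finset.range n, (s + (k + 1))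
      = ((n : ℂ) + 1) ^ s * n.factorial := by
  induction n with
  | zero => simp
  | succ n ih =>
    rw [Finset.sum_range_succ, Finset.prod_range_succ, Complex.exp_add]
    have hk : (n : ℂ) + 1 ≠ 0 := by exact_mod_cast Nat.succ_ne_zero n
    have hk2 : (n : ℂ) + 1 + 1 ≠ 0 := by exact_mod_cast Nat.succ_ne_zero (n + 1)
    have h0 := Complex.slitPlane_ne_zero (one_add_div_mem_slitPlane hs n)
    have h1 : Complex.exp (eulerTerm n s) * (s + (n + 1)) * ((n : ℂ) + 1) ^ s
        = ((n : ℂ) + 1 + 1) ^ s * ((n : ℂ) + 1) := by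
      unfold eulerTerm
      rw [Complex.exp_sub, Complex.exp_log h0, Complex.cpow_def_of_ne_zero hk,
        Complex.cpow_def_of_ne_zero hk2]
      have e1 : ((n : ℂ) + 1) = (((n : ℝ) + 1 : ℝ) : ℂ) := by push_cast; rfl
      have e2 : ((n : ℂ) + 1 + 1) = (((n : ℝ) + 1 + 1 : ℝ) : ℂ) := by push_cast; rfl
      have e3 : log (1 + 1 / ((n : ℝ) + 1)) = log ((n : ℝ) + 1 + 1) - log ((n : ℝ) + 1) := by
        rw [← Real.log_div (by positivity) (by positivity)]
        congr 1; field_simp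
      have e4 : Complex.log ((n : ℂ) + 1) = ((log ((n : ℝ) + 1) : ℝ) : ℂ) := by
        rw [e1, Complex.ofReal_log (by positivity)]
      have e5 : Complex.log ((n : ℂ) + 1 + 1) = ((log ((n : ℝ) + 1 + 1) : ℝ) : ℂ) := by
        rw [e2, Complex.ofReal_log (by positivity)]
      rw [e3, e4, e5]
      have e6 : Complex.exp (((log ((n : ℝ) + 1 + 1) : ℝ) : ℂ) * s)
          = Complex.exp (s * ((log ((n : ℝ) + 1 + 1) - log ((n : ℝ) + 1) : ℝ) : ℂ))
            * Complex.exp (((log ((n : ℝ) + 1) : ℝ) : ℂ) * s) := by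
        rw [← Complex.exp_add]; congr 1; push_cast; ring
      rw [e6]
      have e7 : s + (n + 1) = (1 + s / ((n : ℂ) + 1)) * ((n : ℂ) + 1) := by field_simp; ring
      rw [e7]
      field_simp
      refine div_self fun h => h0 ?_
      field_simp
      simpa using h
    rw [Nat.factorial_succ]
    push_cast
    linear_combination (Complex.exp (eulerTerm n s) * (s + (n + 1))) * ih + (n.factorial : ℂ) * h1

/-- Euler's product, in exponential form. -/
lemma Gamma_eq_exp_tsum {s : ℂ} (hs : 0 < s.re) :
    Complex.Gamma s = Complex.exp (∑' k, eulerTerm k s) / s := by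
  have hs0 : s ≠ 0 := by rintro rfl; simp at hs
  have h1 := Complex.GammaSeq_tendsto_Gamma s
  have h2 := (Complex.continuous_exp.tendsto _).comp
    (hasDerivAt_tsum_eulerTerm hs).1.hasSum.tendsto_sum_nat
  have h3 : Tendsto (fun n : ℕ => ((n : ℂ) / (n + 1)) ^ s) atTop (𝓝 1) := by
    have := (tendsto_natCast_div_add_atTop (𝕜 := ℂ) 1).cpow
      (tendsto_const_nhds (x := s)) (by simp)
    simpa using this
  refine tendsto_nhds_unique h1 ?_
  have h4 := (h3.mul h2).div_const s
  rw [one_mul] at h4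
  refine h4.congr fun n => ?_
  have hprod : ∏ k ∈ Finset.range n, (s + (k + 1)) ≠ 0 := by
    rw [Finset.prod_ne_zero_iff]
    intro k _ h
    have := congrArg Complex.re h
    simp at this
    have hk : (0 : ℝ) ≤ k := Nat.cast_nonneg k
    linarith
  have he := exp_sum_eulerTerm hs n
  have hn1 : ((n : ℂ) + 1) ^ s ≠ 0 := by
    rw [Ne, Complex.cpow_eq_zero_iff]
    rintro ⟨h, -⟩
    exact absurd h (by exact_mod_cast Nat.succ_ne_zero n)
  have hdiv : ((n : ℂ) / (n + 1)) ^ s = (n : ℂ) ^ s / ((n : ℂ) + 1) ^ s := by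
    have e1 : (n : ℂ) / (n + 1) = (((n : ℝ) / ((n : ℝ) + 1) : ℝ) : ℂ) := by push_cast; rfl
    have e2 : (n : ℂ) + 1 = (((n : ℝ) + 1 : ℝ) : ℂ) := by push_cast; rfl
    have e3 : (n : ℂ) = ((n : ℝ) : ℂ) := by push_cast; rfl
    rw [e1, div_eq_mul_inv, Complex.ofReal_mul, Complex.mul_cpow_ofReal_nonneg (by positivity)
      (by positivity), Complex.ofReal_inv, Complex.inv_cpow, ← e2, ← e3, div_eq_mul_inv]
    rw [← e2, ← Nat.cast_one (R := ℂ), ← Nat.cast_add, Complex.natCast_arg]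
    exact Real.pi_pos.ne
  simp only [Function.comp_apply]
  rw [Complex.GammaSeq, Finset.prod_range_succ', hdiv]
  simp only [Nat.cast_add, Nat.cast_one, Nat.cast_zero, add_zero]
  field_simp
  linear_combination (n : ℂ) ^ s * he

/-- Logarithmic differentiation of Euler's product. -/
lemma digamma_eq_tsum {s : ℂ} (hs : 0 < s.re) : Complex.digamma s
    = (∑' k : ℕ, ((log (1 + 1 / ((k : ℝ) + 1)) : ℂ) - 1 / (s + (k + 1)))) - 1 / s := by
  have hs0 : s ≠ 0 := by rintro rfl; simp at hs
  have h1 := ((hasDerivAt_tsum_eulerTerm hs).2.cexp).div (hasDerivAt_id s) hs0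
  have h2 : Complex.Gamma =ᶠ[𝓝 s] fun s => Complex.exp (∑' k, eulerTerm k s) / id s := by
    filter_upwards [(isOpen_lt continuous_const Complex.continuous_re).mem_nhds hs] with w hw
    exact Gamma_eq_exp_tsum hw
  have h3 := (h1.congr_of_eventuallyEq h2).deriv
  rw [Complex.digamma_def, logDeriv_apply, h3, Gamma_eq_exp_tsum hs]
  have := Complex.exp_ne_zero (∑' k, eulerTerm k s)
  simp only [id]
  field_simp

/-- Telescoping bound for the error terms in Stirling's formula. -/
lemma sum_two_div_sq_le {r : ℝ} (hr : 2 ≤ r) (n : ℕ) :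
    ∑ k ∈ Finset.range n, 2 / (r + k) ^ 2 ≤ 2 / (r - 1) - 2 / (r + n - 1) := by
  induction n with
  | zero => simp
  | succ n ih =>
    rw [Finset.sum_range_succ]
    have hn : (0 : ℝ) ≤ n := Nat.cast_nonneg n
    have : 2 / (r + n) ^ 2 ≤ 2 / (r + n - 1) - 2 / (r + n) := by
      rw [div_sub_div _ _ (by linarith) (by linarith), div_le_div_iff₀ (by positivity)
        (mul_pos (by linarith) (by linarith))]
      nlinarith
    push_cast
    have e : r + (n + 1) - 1 = r + n := by ring
    rw [e]
    linarith

/-- Stirling's formula for the digamma function. -/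
lemma norm_digamma_sub_log_le {s : ℂ} (hs : 2 ≤ s.re) :
    ‖Complex.digamma s - Complex.log s‖ ≤ 4 / ‖s‖ := by
  have hs0 : 0 < s.re := by linarith
  have hr : 2 ≤ ‖s‖ := hs.trans (Complex.re_le_norm s)
  have hsum : Summable fun k : ℕ => ((log (1 + 1 / ((k : ℝ) + 1)) : ℂ) - 1 / (s + (k + 1))) :=
    Summable.of_norm_bounded (summable_inv_succ_sq.mul_left (1 + ‖s‖))
      fun k => norm_deriv_eulerTerm_le k hs0
  have hre : ∀ k : ℕ, 2 ≤ (s + k).re := fun k => by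
    have : (0 : ℝ) ≤ k := Nat.cast_nonneg k
    simp; linarith
  have hslit : ∀ k : ℕ, s + k ∈ Complex.slitPlane := fun k => Or.inl (by linarith [hre k])
  have hne : ∀ k : ℕ, s + k ≠ 0 := fun k => Complex.slitPlane_ne_zero (hslit k)
  -- logarithm of a product of numbers in the right half-plane
  have hlogadd : ∀ (w v : ℂ), 0 < w.re → 0 < v.re → Complex.log w - Complex.log v
      = Complex.log (w / v) := by
    intro w v hw hv
    have hw0 : w ≠ 0 := by rintro rfl; simp at hw
    have hv0 : v ≠ 0 := by rintro rfl; simp at hv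
    have ha := abs_lt.1 (Complex.abs_arg_lt_pi_div_two_iff.2 (Or.inl hw))
    have hb := abs_lt.1 (Complex.abs_arg_lt_pi_div_two_iff.2 (Or.inl hv))
    have him : (Complex.log w - Complex.log v).im = w.arg - v.arg := by
      rw [Complex.sub_im, Complex.log_im, Complex.log_im]
    rw [← Complex.log_exp (x := Complex.log w - Complex.log v) (by rw [him]; linarith)
      (by rw [him]; linarith), Complex.exp_sub, Complex.exp_log hw0, Complex.exp_log hv0]
  have hterm : ∀ k : ℕ, ‖Complex.log (s + (k + 1)) - Complex.log (s + k) - 1 / (s + k)‖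
      ≤ 2 / (‖s‖ + k) ^ 2 := by
    intro k
    have hk : (0 : ℝ) ≤ k := Nat.cast_nonneg k
    have h1 : 2 ≤ ‖s + k‖ := (hre k).trans (Complex.re_le_norm _)
    have h2 : ‖1 / (s + k)‖ ≤ 1 / 2 := by
      rw [norm_div, norm_one]; gcongr
    have e : (s + (k + 1)) / (s + k) = 1 + 1 / (s + k) := by
      have := hne k
      field_simp
      ring
    have hre1 : 0 < (s + (k + 1)).re := by simp; linarith
    rw [hlogadd _ _ hre1 (by linarith [hre k]), e]
    have h3 := Complex.norm_log_one_add_sub_self_le (z := 1 / (s + k)) (by linarith)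
    refine h3.trans ?_
    have h4 : (1 - ‖1 / (s + k)‖)⁻¹ ≤ 2 := by
      rw [inv_le_comm₀ (by linarith) (by norm_num)]
      linarith
    have h5 : (‖s‖ + k) ^ 2 ≤ 2 * ‖s + k‖ ^ 2 := by
      have : ‖s + k‖ ^ 2 = ‖s‖ ^ 2 + 2 * k * s.re + k ^ 2 := by
        rw [Complex.sq_norm, Complex.sq_norm, Complex.normSq_apply, Complex.normSq_apply]
        simp; ring
      nlinarith [sq_nonneg (‖s‖ - k), mul_nonneg hk hs0.le]
    calc ‖1 / (s + k)‖ ^ 2 * (1 - ‖1 / (s + k)‖)⁻¹ / 2 ≤ ‖1 / (s + k)‖ ^ 2 * 2 / 2 := by gcongr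
      _ = 1 / ‖s + k‖ ^ 2 := by rw [norm_div, norm_one]; ring
      _ ≤ 2 / (‖s‖ + k) ^ 2 := by
        rw [div_le_div_iff₀ (by positivity) (by positivity)]; linarith
  have hpartial : ∀ n : ℕ, (∑ k ∈ Finset.range n, ((log (1 + 1 / ((k : ℝ) + 1)) : ℂ)
      - 1 / (s + (k + 1)))) - 1 / s - Complex.log s
      = (Complex.log ((n : ℂ) + 1) - Complex.log (s + (n + 1)))
        + ∑ k ∈ Finset.range (n + 1), (Complex.log (s + (k + 1)) - Complex.log (s + k)
          - 1 / (s + k)) := by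
    intro n
    induction n with
    | zero => simp; ring
    | succ n ih =>
      rw [Finset.sum_range_succ, Finset.sum_range_succ (n := n + 1)]
      have e3 : log (1 + 1 / ((n : ℝ) + 1)) = log ((n : ℝ) + 1 + 1) - log ((n : ℝ) + 1) := by
        rw [← Real.log_div (by positivity) (by positivity)]
        congr 1; field_simp
      have e4 : Complex.log ((n : ℂ) + 1) = ((log ((n : ℝ) + 1) : ℝ) : ℂ) := by
        rw [Complex.ofReal_log (by positivity)]; push_cast; rfl
      have e5 : Complex.log ((n : ℂ) + 1 + 1) = ((log ((n : ℝ) + 1 + 1) : ℝ) : ℂ) := by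
        rw [Complex.ofReal_log (by positivity)]; push_cast; rfl
      rw [e3]
      push_cast
      rw [e5]
      rw [e4] at ih
      linear_combination ih
  have hlim1 := ((hsum.hasSum.tendsto_sum_nat.sub_const (1 / s)).sub_const (Complex.log s))
  rw [← digamma_eq_tsum hs0] at hlim1
  have hlim2 : Tendsto (fun n : ℕ => Complex.log ((n : ℂ) + 1) - Complex.log (s + (n + 1)))
      atTop (𝓝 0) := by
    have h1 : Tendsto (fun n : ℕ => (1 : ℂ) + s / ((n : ℂ) + 1)) atTop (𝓝 1) := by
      have h := (tendsto_one_div_add_atTop_nhds_zero_nat (𝕜 := ℂ)).const_mul s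
      have h' := h.const_add 1
      simp only [mul_zero, add_zero, mul_one_div] at h'
      exact h'
    have h2 := (h1.clog (by simp)).neg
    rw [Complex.log_one, neg_zero] at h2
    refine h2.congr fun n => ?_
    have hn0 : (n : ℂ) + 1 ≠ 0 := by exact_mod_cast Nat.succ_ne_zero n
    have hk : (0 : ℝ) ≤ n := Nat.cast_nonneg n
    rw [← neg_sub (Complex.log (s + (n + 1))), hlogadd _ _ (by simp; linarith)
      (by simp; linarith)]
    congr 2
    field_simp
    ring
  have hlim3 := (hlim1.sub hlim2).norm
  rw [sub_zero] at hlim3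
  refine le_of_tendsto' hlim3 fun n => ?_
  rw [hpartial n, add_sub_cancel_left]
  refine (norm_sum_le _ _).trans ((Finset.sum_le_sum fun k _ => hterm k).trans
    ((sum_two_div_sq_le hr _).trans ?_))
  have h5 : 0 ≤ 2 / (‖s‖ + ((n + 1 : ℕ) : ℝ) - 1) := by
    refine div_nonneg (by norm_num) ?_
    push_cast
    have : (0 : ℝ) ≤ n := Nat.cast_nonneg n
    linarith
  have h6 : 2 / (‖s‖ - 1) ≤ 4 / ‖s‖ := by
    rw [div_le_div_iff₀ (by linarith) (by linarith)]; linarith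
  linarith

/-! ### Riemann's formula for `H_0` -/

/-- The positive half `∑_{n ≥ 1} n^k exp(-π n² x)` of a theta series with weight `n^k`. -/
def thetaHalf (k : ℕ) (x : ℝ) : ℝ :=
  ∑' n : ℕ, ((n : ℝ) + 1) ^ k * exp (-π * ((n : ℝ) + 1) ^ 2 * x)

lemma summable_thetaHalf (k : ℕ) {x : ℝ} (hx : 0 < x) :
    Summable fun n : ℕ => ((n : ℝ) + 1) ^ k * exp (-π * ((n : ℝ) + 1) ^ 2 * x) := by
  have h := (summable_nat_add_iff 1).2 (Real.summable_pow_mul_exp_neg_nat_mul k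
    (show 0 < π * x by positivity))
  refine Summable.of_nonneg_of_le (fun n => by positivity) (fun n => ?_) h
  push_cast
  have h1 : (n : ℝ) + 1 ≤ ((n : ℝ) + 1) ^ 2 := by nlinarith [(Nat.cast_nonneg n : (0 : ℝ) ≤ n)]
  have h2 := mul_le_mul_of_nonneg_left h1 (show 0 ≤ π * x by positivity)
  refine mul_le_mul_of_nonneg_left (exp_le_exp.2 ?_) (by positivity)
  linarith

lemma aestronglyMeasurable_thetaHalf (k : ℕ) :
    AEStronglyMeasurable (fun x => (thetaHalf k x : ℂ)) (volume.restrict (Ioi 0)) := by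
  refine aestronglyMeasurable_of_tendsto_ae (u := atTop)
    (f := fun N x => ((∑ n ∈ Finset.range N,
      ((n : ℝ) + 1) ^ k * exp (-π * ((n : ℝ) + 1) ^ 2 * x) : ℝ) : ℂ)) (fun N => ?_) ?_
  · exact Continuous.aestronglyMeasurable (by fun_prop)
  · refine (ae_restrict_iff' measurableSet_Ioi).2 (Eventually.of_forall fun x hx => ?_)
    exact (Complex.continuous_ofReal.tendsto _).comp
      (summable_thetaHalf k hx).hasSum.tendsto_sum_nat

/-- Integrating `n^k exp(-π n² x)` term by term; the Mellin transform at `(s + k) / 2` produces the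
Dirichlet series of `ζ(s)`. -/
lemma mellin_thetaHalf (k : ℕ) {s : ℂ} (hs : 1 < s.re) :
    mellin (fun x => (thetaHalf k x : ℂ)) ((s + k) / 2) = Complex.Gammaℝ (s + k) * riemannZeta s := by
  have hpos : ∀ n : ℕ, (0 : ℝ) < (n : ℝ) + 1 := fun n => by positivity
  have hdiv : ∀ (n : ℕ) (w : ℂ), ((n : ℂ) + 1) ^ k / ((n : ℂ) + 1) ^ (w + k) = 1 / ((n : ℂ) + 1) ^ w := by
    intro n w
    have hne : (n : ℂ) + 1 ≠ 0 := by exact_mod_cast Nat.succ_ne_zero n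
    rw [Complex.cpow_add _ _ hne, Complex.cpow_natCast]
    field_simp
  have h := hasSum_mellin_pi_mul_sq (a := fun n : ℕ => ((n : ℂ) + 1) ^ k)
    (r := fun n : ℕ => (n : ℝ) + 1) (F := fun x => (thetaHalf k x : ℂ)) (s := s + k)
    (by simp; positivity) (fun t ht => by
      have := (Complex.hasSum_ofReal).2 (summable_thetaHalf k ht).hasSum
      simpa [(hpos _).ne', thetaHalf] using this)
    (by
      have h0 := (summable_nat_add_iff 1).2 (Complex.summable_one_div_nat_cpow.2 hs).norm
      refine h0.congr fun n => ?_
      have h1 : ‖((n : ℂ) + 1) ^ (s + k)‖ = |(n : ℝ) + 1| ^ (s + k).re := by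
        rw [abs_of_pos (hpos n), ← Complex.norm_cpow_eq_rpow_re_of_pos (hpos n)]
        push_cast; rfl
      rw [← h1, ← norm_div, hdiv]
      push_cast; rfl)
  rw [zeta_eq_tsum_one_div_nat_add_one_cpow hs, ← tsum_mul_left, ← h.tsum_eq]
  refine tsum_congr fun n => ?_
  rw [abs_of_pos (hpos n)]
  push_cast
  rw [mul_div_assoc, hdiv]

/-- Convergence is not part of `mellin_thetaHalf`, whose left-hand side is zero for a divergent
integral. It suffices to consider real `s > 1`, and there the right-hand side is not zero. -/
lemma mellinConvergent_thetaHalf (k : ℕ) {s : ℂ} (hs : 1 < s.re) :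
    MellinConvergent (fun x => (thetaHalf k x : ℂ)) ((s + k) / 2) := by
  have h1 := mellin_thetaHalf k (s := (s.re : ℂ)) (by simpa using hs)
  have h2 : MellinConvergent (fun x => (thetaHalf k x : ℂ)) (((s.re : ℂ) + k) / 2) := by
    by_contra hcon
    -- a divergent integral has the junk value zero, which contradicts `h1`
    rw [mellin, integral_undef hcon] at h1
    have h3 : Complex.Gammaℝ ((s.re : ℂ) + k) ≠ 0 :=
      Complex.Gammaℝ_ne_zero_of_re_pos (by simp; positivity)
    exact mul_ne_zero h3 (riemannZeta_ne_zero_of_one_lt_re (by simpa using hs)) h1.symm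
  unfold MellinConvergent at h2 ⊢
  rw [mellin_convergent_iff_norm subset_rfl measurableSet_Ioi (aestronglyMeasurable_thetaHalf k)]
    at h2 ⊢
  convert h2 using 4
  simp

lemma Phi_eq_thetaHalf (u : ℝ) : Phi u = 2 * π ^ 2 * exp (9 * u) * thetaHalf 4 (exp (4 * u))
    - 3 * π * exp (5 * u) * thetaHalf 2 (exp (4 * u)) := by
  unfold Phi thetaHalf
  rw [← tsum_mul_left, ← tsum_mul_left, ← Summable.tsum_sub]
  · refine tsum_congr fun n => ?_
    have : -π * ((n : ℝ) + 1) ^ 2 * exp (4 * u) = -(π * ((n : ℝ) + 1) ^ 2 * exp (4 * u)) := by ring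
    rw [this]; ring
  · exact (summable_thetaHalf 4 (exp_pos _)).mul_left _
  · exact (summable_thetaHalf 2 (exp_pos _)).mul_left _

/-- The substitution `x = e^{4u}` turns the two-sided Laplace transform of `Φ` into Mellin
transforms of theta series. -/
lemma integral_Phi_mul_exp {z : ℂ} (hz : 1 < z.im) :
    ∫ u : ℝ, (Phi u : ℂ) * Complex.exp (-(Complex.I * z) * u)
      = 1 / 8 * ((1 - Complex.I * z) / 2) * ((1 - Complex.I * z) / 2 - 1) *
        Complex.Gammaℝ ((1 - Complex.I * z) / 2) * riemannZeta ((1 - Complex.I * z) / 2) := by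
  set s := (1 - Complex.I * z) / 2 with hs
  have hre : 1 < s.re := by rw [hs]; simp; linarith
  have hs0 : s ≠ 0 := fun h => by rw [h] at hre; norm_num at hre
  have hs2 : s + 2 ≠ 0 := fun h => by
    have := congrArg Complex.re h
    simp at this; linarith
  have h4 := mellin_thetaHalf 4 hre
  have h2 := mellin_thetaHalf 2 hre
  have c4 := mellinConvergent_thetaHalf 4 hre
  have c2 := mellinConvergent_thetaHalf 2 hre
  set g : ℝ → ℂ := fun x => 1 / 4 * (2 * π ^ 2 * ((x : ℂ) ^ ((s + (4 : ℕ)) / 2 - 1) • (thetaHalf 4 x : ℂ))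
    - 3 * π * ((x : ℂ) ^ ((s + (2 : ℕ)) / 2 - 1) • (thetaHalf 2 x : ℂ))) with hg
  have hgI : ∫ x in Ioi 0, g x = 1 / 4 * (2 * π ^ 2 * (Complex.Gammaℝ (s + (4 : ℕ)) * riemannZeta s)
      - 3 * π * (Complex.Gammaℝ (s + (2 : ℕ)) * riemannZeta s)) := by
    rw [hg, integral_const_mul, integral_sub (c4.const_mul _) (c2.const_mul _), integral_const_mul,
      integral_const_mul, ← h4, ← h2]
    rfl
  have himg : (fun u : ℝ => exp (4 * u)) '' univ = Ioi 0 := by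
    ext x
    simp only [image_univ, mem_range, mem_Ioi]
    refine ⟨fun ⟨u, hu⟩ => hu ▸ exp_pos _, fun hx => ⟨log x / 4, ?_⟩⟩
    rw [mul_div_cancel₀ _ (by norm_num), exp_log hx]
  have hchg := integral_image_eq_integral_abs_deriv_smul (s := univ) MeasurableSet.univ
    (f := fun u : ℝ => exp (4 * u)) (f' := fun u => 4 * exp (4 * u))
    (fun u _ => by
      have := ((hasDerivAt_id u).const_mul 4).exp
      simpa [mul_comm] using this)
    (fun u _ v _ h => by simpa using h) g
  rw [himg, hgI, setIntegral_univ] at hchg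
  have hcong : ∀ u : ℝ, |4 * exp (4 * u)| • g (exp (4 * u))
      = (Phi u : ℂ) * Complex.exp (-(Complex.I * z) * u) := by
    intro u
    have hcp : ∀ w : ℂ, ((exp (4 * u) : ℝ) : ℂ) ^ w = Complex.exp (4 * u * w) := by
      intro w
      rw [Complex.cpow_def_of_ne_zero (by exact_mod_cast (exp_pos _).ne'), ← Complex.ofReal_log
        (exp_pos _).le, Real.log_exp]
      push_cast; rfl
    rw [Phi_eq_thetaHalf, abs_of_pos (by positivity), hg]
    simp only [hcp, smul_eq_mul, Complex.real_smul]
    push_cast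
    have e9 : Complex.exp (4 * u) * Complex.exp (4 * u * ((s + 4) / 2 - 1))
        = Complex.exp (9 * u) * Complex.exp (-(Complex.I * z) * u) := by
      rw [← Complex.exp_add, ← Complex.exp_add, hs]; congr 1; ring
    have e5 : Complex.exp (4 * u) * Complex.exp (4 * u * ((s + 2) / 2 - 1))
        = Complex.exp (5 * u) * Complex.exp (-(Complex.I * z) * u) := by
      rw [← Complex.exp_add, ← Complex.exp_add, hs]; congr 1; ring
    linear_combination (2 * π ^ 2 * thetaHalf 4 (exp (4 * u)) : ℂ) * e9
      - (3 * π * thetaHalf 2 (exp (4 * u)) : ℂ) * e5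
  simp only [hcong] at hchg
  rw [← hchg]
  have e4 : s + (4 : ℕ) = (s + 2) + 2 := by push_cast; ring
  have e2 : s + (2 : ℕ) = s + 2 := by push_cast; ring
  rw [e4, e2, Complex.Gammaℝ_add_two hs2, Complex.Gammaℝ_add_two hs0]
  have hpi : (π : ℂ) ≠ 0 := by exact_mod_cast pi_ne_zero
  field_simp
  ring

lemma integrableOn_Phi_mul_exp (w : ℂ) :
    IntegrableOn (fun u : ℝ => (Phi u : ℂ) * Complex.exp (w * u)) (Ioi 0) := by
  obtain ⟨C, hC, hPhi⟩ := exists_Phi_le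
  refine Integrable.mono' ((integrableOn_majorant 0 0 w.re).const_mul C) ?_ ?_
  · exact (Continuous.mul (Complex.continuous_ofReal.comp continuous_Phi)
      (by fun_prop)).aestronglyMeasurable
  · refine (ae_restrict_iff' measurableSet_Ioi).2 (Eventually.of_forall fun u (hu : 0 < u) => ?_)
    rw [norm_mul, Complex.norm_real, Real.norm_of_nonneg (Phi_pos hu.le).le, Complex.norm_exp]
    calc Phi u * exp (w * u).re ≤ C * exp (-u ^ 4) * exp (w * u).re := by
          gcongr; exact hPhi u hu.le
      _ = _ := by
        rw [mul_assoc, ← Real.exp_add]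
        simp
        left; ring

/-- Since `Φ` is even, the cosine transform is half of a two-sided Laplace transform. -/
lemma two_mul_heatInt_zero (z : ℂ) :
    2 * heatInt 0 0 z = ∫ u : ℝ, (Phi u : ℂ) * Complex.exp (-(Complex.I * z) * u) := by
  have hneg : ∀ w : ℂ, ∫ u in Iic 0, (Phi u : ℂ) * Complex.exp (-w * u)
      = ∫ u in Ioi 0, (Phi u : ℂ) * Complex.exp (w * u) := by
    intro w
    have := integral_comp_neg_Iic 0 (fun u : ℝ => (Phi u : ℂ) * Complex.exp (w * u))
    rw [neg_zero] at this
    rw [← this]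
    refine integral_congr_ae (Eventually.of_forall fun u => ?_)
    simp [Phi_neg]
  have hnegI : IntegrableOn (fun u : ℝ => (Phi u : ℂ) * Complex.exp (-(Complex.I * z) * u)) (Iic 0) := by
    have := (integrableOn_Phi_mul_exp (Complex.I * z))
    rw [← neg_zero, ← integrableOn_Ici_iff_integrableOn_Ioi] at this
    have h2 := this.comp_neg
    simpa [Phi_neg] using h2
  rw [← intervalIntegral.integral_Iic_add_Ioi hnegI (integrableOn_Phi_mul_exp _), hneg,
    ← integral_add (integrableOn_Phi_mul_exp _) (integrableOn_Phi_mul_exp _), heatInt,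
    ← integral_const_mul]
  refine integral_congr_ae (Eventually.of_forall fun u => ?_)
  simp only [heatIntegrand, Complex.cos]
  simp
  have : Complex.I * z * u = z * u * Complex.I := by ring
  rw [this]; ring

/-- Riemann's formula: `H_0(z) = s (s - 1) π^{-s/2} Γ(s/2) ζ(s) / 16` with `s = (1 - iz)/2`. -/
lemma heatInt_zero_eq {z : ℂ} (hz : 1 < z.im) : heatInt 0 0 z
      = 1 / 16 * ((1 - Complex.I * z) / 2) * ((1 - Complex.I * z) / 2 - 1) *
        Complex.Gammaℝ ((1 - Complex.I * z) / 2) * riemannZeta ((1 - Complex.I * z) / 2) := by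
  linear_combination (1 / 2 : ℂ) * two_mul_heatInt_zero z + (1 / 2 : ℂ) * integral_Phi_mul_exp hz

/-! ### Stirling asymptotics of `H_0'/H_0` -/

/-- Termwise comparison of the Dirichlet series of `ζ'/ζ` at `s` and at `2`; it starts with `n = 2`. -/
lemma exists_norm_zeta_logDeriv_le : ∃ C : ℝ, 0 < C ∧ ∀ s : ℂ, 2 ≤ s.re →
    ‖deriv riemannZeta s / riemannZeta s‖ ≤ C * exp (-s.re / 2) := by
  set f : ℕ → ℂ := fun n => (ArithmeticFunction.vonMangoldt n : ℂ) with hf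
  have hsum : Summable fun n => ‖LSeries.term f 2 n‖ :=
    (ArithmeticFunction.LSeriesSummable_vonMangoldt (s := 2) (by norm_num)).norm
  refine ⟨4 * ((∑' n, ‖LSeries.term f 2 n‖) + 1),
    by positivity, fun s hs => ?_⟩
  have h1 : deriv riemannZeta s / riemannZeta s = -LSeries f s := by
    rw [hf, ArithmeticFunction.LSeries_vonMangoldt_eq_deriv_riemannZeta_div (by linarith)]; ring
  rw [h1, norm_neg, LSeries]
  have hterm : ∀ n, ‖LSeries.term f s n‖ ≤ (4 * exp (-s.re / 2)) * ‖LSeries.term f 2 n‖ := by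
    intro n
    rcases Nat.lt_or_ge n 2 with h | h
    · have hz : f n = 0 := by
        interval_cases n <;> simp [hf]
      rcases eq_or_ne n 0 with rfl | h0
      · simp
      · rw [LSeries.term_of_ne_zero h0, LSeries.term_of_ne_zero h0, hz]; simp
    · rw [LSeries.norm_term_eq, LSeries.norm_term_eq]
      simp only [show n ≠ 0 by omega, if_false]
      have hn : (2 : ℝ) ≤ n := by exact_mod_cast h
      have hn0 : (0 : ℝ) < n := by linarith
      have h2 : (n : ℝ) ^ (Complex.re 2) ≤ 4 * exp (-s.re / 2) * (n : ℝ) ^ s.re := by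
        have e1 : (n : ℝ) ^ s.re = (n : ℝ) ^ (Complex.re 2) * (n : ℝ) ^ (s.re - 2) := by
          rw [← Real.rpow_add hn0]; congr 1; simp
        have e2 : exp (s.re / 2) ≤ 4 * (n : ℝ) ^ (s.re - 2) := by
          have l2 := Real.log_two_gt_d9
          have e3 : (2 : ℝ) ^ (s.re - 2) ≤ (n : ℝ) ^ (s.re - 2) :=
            Real.rpow_le_rpow (by norm_num) hn (by linarith)
          have e4 : exp (s.re / 2) ≤ 4 * (2 : ℝ) ^ (s.re - 2) := by
            have e5 : 4 * (2 : ℝ) ^ (s.re - 2) = 2 ^ s.re := by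
              rw [Real.rpow_sub (by norm_num)]; norm_num; ring
            rw [e5, Real.rpow_def_of_pos (by norm_num)]
            apply exp_le_exp.2; nlinarith
          linarith
        rw [e1]
        have e6 : exp (-s.re / 2) * exp (s.re / 2) = 1 := by rw [← Real.exp_add]; simp; ring
        calc (n : ℝ) ^ (Complex.re 2) = (n : ℝ) ^ (Complex.re 2) * (exp (-s.re / 2) * exp (s.re / 2)) := by
              rw [e6, mul_one]
          _ ≤ (n : ℝ) ^ (Complex.re 2) * (exp (-s.re / 2) * (4 * (n : ℝ) ^ (s.re - 2))) := by gcongr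
          _ = _ := by ring
      rw [mul_div_assoc', div_le_div_iff₀ (by positivity) (by positivity)]
      calc ‖f n‖ * (n : ℝ) ^ (Complex.re 2) ≤ ‖f n‖ * (4 * exp (-s.re / 2) * (n : ℝ) ^ s.re) := by gcongr
        _ = _ := by ring
  have hs2 := hsum.mul_left (4 * exp (-s.re / 2))
  have hsn : Summable fun n => ‖LSeries.term f s n‖ :=
    Summable.of_nonneg_of_le (fun n => norm_nonneg _) hterm hs2
  calc ‖∑' n, LSeries.term f s n‖ ≤ ∑' n, ‖LSeries.term f s n‖ := norm_tsum_le_tsum_norm hsn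
    _ ≤ ∑' n, (4 * exp (-s.re / 2)) * ‖LSeries.term f 2 n‖ := hsn.tsum_le_tsum hterm hs2
    _ = (4 * exp (-s.re / 2)) * ∑' n, ‖LSeries.term f 2 n‖ := tsum_mul_left
    _ ≤ _ := by nlinarith [exp_pos (-s.re / 2)]

lemma logDeriv_xi {s : ℂ} (hs : 1 < s.re) :
    logDeriv (fun s => 1 / 16 * s * (s - 1) * Complex.Gammaℝ s * riemannZeta s) s
      = 1 / s + 1 / (s - 1) + (-(log π : ℂ) / 2 + Complex.digamma (s / 2) / 2)
        + deriv riemannZeta s / riemannZeta s := by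
  have hs0 : s ≠ 0 := fun h => by rw [h] at hs; norm_num at hs
  have hs1 : s ≠ 1 := fun h => by rw [h] at hs; norm_num at hs
  have hs1' : s - 1 ≠ 0 := sub_ne_zero.2 hs1
  have hz : riemannZeta s ≠ 0 := riemannZeta_ne_zero_of_one_lt_re hs
  have hG : Complex.Gammaℝ s ≠ 0 := Complex.Gammaℝ_ne_zero_of_re_pos (by linarith)
  have hpi : (π : ℂ) ≠ 0 := by exact_mod_cast pi_ne_zero
  have hG2 : DifferentiableAt ℂ Complex.Gamma (s / 2) := by
    refine Complex.differentiableAt_Gamma _ fun m h => ?_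
    have := congrArg Complex.re h
    simp at this
    have hm : (0 : ℝ) ≤ m := Nat.cast_nonneg m
    linarith
  have hGne : Complex.Gamma (s / 2) ≠ 0 := Complex.Gamma_ne_zero_of_re_pos (by simp; linarith)
  have hp : HasDerivAt (fun s : ℂ => (π : ℂ) ^ (-s / 2)) ((π : ℂ) ^ (-s / 2) * Complex.log π * (-1 / 2)) s :=
    (((hasDerivAt_id s).neg.div_const 2).const_cpow (Or.inl hpi))
  have hq : HasDerivAt (fun s : ℂ => Complex.Gamma (s / 2)) (deriv Complex.Gamma (s / 2) * (1 / 2)) s :=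
    hG2.hasDerivAt.comp s ((hasDerivAt_id s).div_const 2)
  have hGd : HasDerivAt Complex.Gammaℝ _ s := hp.mul hq
  have hzd := (differentiableAt_riemannZeta hs1).hasDerivAt
  have h0 := ((((hasDerivAt_id s).const_mul (1 / 16)).mul ((hasDerivAt_id s).sub_const 1)).mul
    hGd).mul hzd
  have hpne : (π : ℂ) ^ (-s / 2) ≠ 0 := by rw [Complex.cpow_def_of_ne_zero hpi]; exact Complex.exp_ne_zero _
  have h1 : logDeriv (fun s => 1 / 16 * s * (s - 1) * Complex.Gammaℝ s * riemannZeta s) s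
    = _ / _ := congrArg (· / _) h0.deriv
  rw [h1, Complex.ofReal_log pi_pos.le, Complex.digamma_def, logDeriv_apply]
  simp only [Complex.Gammaℝ_def, id, Pi.mul_apply]
  field_simp

lemma heatLog_zero_eq {z : ℂ} (hz : 1 < z.im) : heatLog 0 z = -(Complex.I / 2) *
    (1 / ((1 - Complex.I * z) / 2) + 1 / ((1 - Complex.I * z) / 2 - 1)
      + (-(log π : ℂ) / 2 + Complex.digamma ((1 - Complex.I * z) / 2 / 2) / 2)
      + deriv riemannZeta ((1 - Complex.I * z) / 2) / riemannZeta ((1 - Complex.I * z) / 2)) := by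
  have hre : 1 < ((1 - Complex.I * z) / 2).re := by simp; linarith
  have hev : heatInt 0 0 =ᶠ[𝓝 z] (fun s => 1 / 16 * s * (s - 1) * Complex.Gammaℝ s * riemannZeta s)
      ∘ (fun z => (1 - Complex.I * z) / 2) := by
    filter_upwards [(isOpen_lt continuous_const Complex.continuous_im).mem_nhds hz] with w hw
    exact heatInt_zero_eq hw
  have hs1 : (1 - Complex.I * z) / 2 ≠ 1 := fun h => by rw [h] at hre; norm_num at hre
  have hdG : DifferentiableAt ℂ Complex.Gammaℝ ((1 - Complex.I * z) / 2) := by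
    have h := Complex.differentiable_Gammaℝ_inv ((1 - Complex.I * z) / 2)
    have h2 := h.inv (inv_ne_zero (Complex.Gammaℝ_ne_zero_of_re_pos (by linarith)))
    rwa [show (fun s => (Complex.Gammaℝ s)⁻¹)⁻¹ = Complex.Gammaℝ from funext fun s => inv_inv _] at h2
  have hd : DifferentiableAt ℂ (fun s => 1 / 16 * s * (s - 1) * Complex.Gammaℝ s * riemannZeta s)
      ((1 - Complex.I * z) / 2) :=
    ((by fun_prop : DifferentiableAt ℂ (fun s : ℂ => 1 / 16 * s * (s - 1)) _).mul hdG).mul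
      (differentiableAt_riemannZeta hs1)
  have hlin : HasDerivAt (fun z : ℂ => (1 - Complex.I * z) / 2) (-(Complex.I / 2)) z := by
    have := (((hasDerivAt_id z).const_mul Complex.I).const_sub 1).div_const 2
    rw [show -(Complex.I / 2) = -(Complex.I * 1) / 2 by ring]
    exact this
  rw [← logDeriv_heatInt, (logDeriv_congr_nhds hev).eq_of_nhds, logDeriv_comp (g := fun z : ℂ => (1 - Complex.I * z) / 2) hd hlin.differentiableAt,
    logDeriv_xi hre, hlin.deriv]
  ring

/-- Stirling's formula for `H_0'/H_0`, with the error from `ζ'/ζ` decaying exponentially in the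
height. -/
lemma exists_norm_heatLog_zero_add_le : ∃ C : ℝ, 0 < C ∧ ∀ z : ℂ, 7 ≤ z.im →
    ‖heatLog 0 z + Complex.I / 4 * Complex.log (-(Complex.I * z) / (4 * π))‖
      ≤ C * (1 / ‖z‖ + exp (-z.im / 4)) := by
  obtain ⟨C, hC, hzeta⟩ := exists_norm_zeta_logDeriv_le
  refine ⟨8 + C, by positivity, fun z hz => ?_⟩
  set w : ℂ := -(Complex.I * z) with hw
  have hwre : w.re = z.im := by simp [hw]
  have hwn : ‖w‖ = ‖z‖ := by simp [hw]
  have hzn : 7 ≤ ‖z‖ := hz.trans ((le_abs_self _).trans (Complex.abs_im_le_norm z))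
  have hw0 : w ≠ 0 := by rw [← norm_pos_iff, hwn]; linarith
  set s : ℂ := (1 - Complex.I * z) / 2 with hs
  have hsw : s = (1 + w) / 2 := by rw [hs, hw]; ring
  have hsre : s.re = (1 + z.im) / 2 := by rw [hsw]; simp [hwre]
  have h1w : ‖z‖ ≤ ‖1 + w‖ := by
    rw [← hwn]
    refine abs_le_of_sq_le_sq' ?_ (norm_nonneg _) |>.2
    rw [Complex.sq_norm, Complex.sq_norm, Complex.normSq_apply, Complex.normSq_apply]
    simp; nlinarith
  have hsn : ‖z‖ / 2 ≤ ‖s‖ := by rw [hsw, norm_div, Complex.norm_ofNat]; linarith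
  have hs1n : ‖z‖ / 4 ≤ ‖s - 1‖ := by
    have : s - 1 = (w - 1) / 2 := by rw [hsw]; ring
    rw [this, norm_div, Complex.norm_ofNat]
    have := norm_sub_norm_le w 1
    rw [norm_one, hwn] at this
    linarith
  have hpi := pi_pos
  have hw4 : w / (4 * π) ≠ 0 := div_ne_zero hw0 (by exact_mod_cast (by positivity : (4 * π : ℝ) ≠ 0))
  have hinv : ‖1 / w‖ ≤ 1 / 7 := by
    rw [norm_div, norm_one, hwn]; exact one_div_le_one_div_of_le (by norm_num) hzn
  have hlog : Complex.log (s / 2) = Complex.log (1 + 1 / w) + (log π : ℂ) + Complex.log (w / (4 * π)) := by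
    have hpc : (π : ℂ) ≠ 0 := by exact_mod_cast pi_ne_zero
    have e1 : s / 2 = (1 + 1 / w) * ((π : ℝ) * (w / (4 * π))) := by rw [hsw]; field_simp; ring
    have e2 : ((π : ℝ) : ℂ) * (w / (4 * π)) = w / 4 := by field_simp
    have r1 : 0 < (1 + 1 / w).re := by
      have := Complex.abs_re_le_norm (1 / w)
      have := neg_abs_le (1 / w).re
      rw [Complex.add_re, Complex.one_re]; linarith
    have r2 : 0 < (w / 4).re := by simp [hwre]; linarith
    have n1 : 1 + 1 / w ≠ 0 := fun h => by rw [h] at r1; simp at r1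
    have n2 : w / 4 ≠ 0 := fun h => by rw [h] at r2; simp at r2
    rw [e1, Complex.log_mul n1 (e2 ▸ n2), Complex.log_ofReal_mul pi_pos hw4]
    · ring
    · rw [e2]
      have a1 := abs_lt.1 (Complex.abs_arg_lt_pi_div_two_iff.2 (Or.inl r1))
      have a2 := abs_lt.1 (Complex.abs_arg_lt_pi_div_two_iff.2 (Or.inl r2))
      constructor <;> linarith [a1.1, a1.2, a2.1, a2.2]
  have hdig := norm_digamma_sub_log_le (s := s / 2) (by simp [hsre]; linarith)
  have hlog1 := Complex.norm_log_one_add_half_le_self (z := 1 / w) (hinv.trans (by norm_num))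
  have hz2 := hzeta s (by rw [hsre]; linarith)
  have hid : heatLog 0 z + Complex.I / 4 * Complex.log (w / (4 * π))
      = -(Complex.I / 2) * (1 / s + 1 / (s - 1) + (Complex.digamma (s / 2) - Complex.log (s / 2)) / 2
        + Complex.log (1 + 1 / w) / 2 + deriv riemannZeta s / riemannZeta s) := by
    rw [heatLog_zero_eq (by linarith), ← hs, hlog]; ring
  rw [hid, norm_mul, norm_neg, norm_div, Complex.norm_I, Complex.norm_ofNat]
  have hzpos : 0 < ‖z‖ := by linarith
  have b1 : ‖1 / s‖ ≤ 2 / ‖z‖ := by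
    rw [norm_div, norm_one, div_le_div_iff₀ (by linarith) hzpos]; linarith
  have b2 : ‖1 / (s - 1)‖ ≤ 4 / ‖z‖ := by
    rw [norm_div, norm_one, div_le_div_iff₀ (by linarith) hzpos]; linarith
  have b3 : ‖(Complex.digamma (s / 2) - Complex.log (s / 2)) / 2‖ ≤ 8 / ‖z‖ := by
    rw [norm_div, Complex.norm_ofNat]
    have : 4 / ‖s / 2‖ ≤ 16 / ‖z‖ := by
      rw [norm_div, Complex.norm_ofNat, div_le_div_iff₀ (by linarith) hzpos]; linarith
    have e : 16 / ‖z‖ = 2 * (8 / ‖z‖) := by ring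
    linarith
  have b4 : ‖Complex.log (1 + 1 / w) / 2‖ ≤ 2 / ‖z‖ := by
    rw [norm_div, Complex.norm_ofNat]
    rw [norm_div, norm_one, hwn] at hlog1
    have e : 2 / ‖z‖ = 2 * (1 / ‖z‖) := by ring
    have : 0 ≤ 1 / ‖z‖ := by positivity
    linarith
  have b5 : ‖deriv riemannZeta s / riemannZeta s‖ ≤ C * exp (-z.im / 4) := by
    refine hz2.trans (mul_le_mul_of_nonneg_left (exp_le_exp.2 ?_) hC.le)
    rw [hsre]; linarith
  have n := (norm_add_le (1 / s + 1 / (s - 1) + (Complex.digamma (s / 2) - Complex.log (s / 2)) / 2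
        + Complex.log (1 + 1 / w) / 2) (deriv riemannZeta s / riemannZeta s)).trans
    (add_le_add (norm_add₄_le) le_rfl)
  have e : (8 + C) * (1 / ‖z‖ + exp (-z.im / 4)) = (2 / ‖z‖ + 4 / ‖z‖ + 8 / ‖z‖ + 2 / ‖z‖) / 2
    + C / ‖z‖ + 8 * exp (-z.im / 4) + C * exp (-z.im / 4) := by ring
  have p1 : 0 ≤ C / ‖z‖ := by positivity
  have p2 := exp_pos (-z.im / 4)
  have p3 : 0 ≤ C * exp (-z.im / 4) := by positivity
  rw [e]
  linarith

lemma log_neg_I_mul_div {z : ℂ} (hz : 0 < z.im) : (Complex.log (-(Complex.I * z) / (4 * π))).re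
      = log (‖z‖ / (4 * π)) ∧ |(Complex.log (-(Complex.I * z) / (4 * π))).im| ≤ π / 2 := by
  have hn : ‖-(Complex.I * z) / (4 * π)‖ = ‖z‖ / (4 * π) := by
    rw [norm_div, norm_neg, norm_mul, Complex.norm_I, one_mul]
    congr 1
    rw [norm_mul, Complex.norm_ofNat, Complex.norm_real, Real.norm_of_nonneg pi_pos.le]
  refine ⟨by rw [Complex.log_re, hn], ?_⟩
  rw [Complex.log_im]
  refine Complex.abs_arg_le_pi_div_two_iff.2 ?_
  have e : -(Complex.I * z) / (4 * π) = (((4 * π)⁻¹ : ℝ) : ℂ) * -(Complex.I * z) := by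
    push_cast; rw [div_eq_inv_mul]
  rw [e, Complex.re_ofReal_mul]
  have : (-(Complex.I * z)).re = z.im := by simp
  rw [this]; positivity

/-- The imaginary part of Stirling's formula. -/
lemma exists_abs_im_heatLog_zero_le : ∃ C : ℝ, 0 < C ∧ ∀ z : ℂ, 7 ≤ z.im →
    |-(heatLog 0 z).im - 1 / 4 * log (‖z‖ / (4 * π))| ≤ C * (1 / ‖z‖ + exp (-z.im / 4)) := by
  obtain ⟨C, hC, h⟩ := exists_norm_heatLog_zero_add_le
  refine ⟨C, hC, fun z hz => le_trans ?_ (h z hz)⟩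
  have := Complex.abs_im_le_norm (heatLog 0 z + Complex.I / 4 * Complex.log (-(Complex.I * z) / (4 * π)))
  refine le_trans (le_of_eq ?_) this
  rw [← (log_neg_I_mul_div (z := z) (by linarith)).1, ← abs_neg]
  congr 1
  simp
  ring

/-- The argument of `-i z` is bounded on the upper half-plane, so `H_0'/H_0` is within `O(1)` of a
real multiple of `i`. -/
lemma exists_norm_heatLog_zero_log_le : ∃ C : ℝ, 0 < C ∧ ∀ z : ℂ, 7 ≤ z.im →
    ‖heatLog 0 z + Complex.I / 4 * (log ‖z‖ : ℂ)‖ ≤ C := by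
  obtain ⟨C, hC, h⟩ := exists_norm_heatLog_zero_add_le
  refine ⟨2 * C + log (4 * π) + 1, ?_, fun z hz => ?_⟩
  · have : 0 ≤ log (4 * π) := log_nonneg (by linarith [pi_gt_three])
    positivity
  have hzn : 7 ≤ ‖z‖ := hz.trans ((le_abs_self _).trans (Complex.abs_im_le_norm z))
  have h1 := h z hz
  obtain ⟨h2, h3⟩ := log_neg_I_mul_div (z := z) (by linarith)
  set L := Complex.log (-(Complex.I * z) / (4 * π)) with hL
  have hlp : 0 ≤ log (4 * π) := log_nonneg (by linarith [pi_gt_three])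
  have h4 : ‖L - (log ‖z‖ : ℂ)‖ ≤ log (4 * π) + π / 2 := by
    refine (Complex.norm_le_abs_re_add_abs_im _).trans (add_le_add ?_ ?_)
    · rw [Complex.sub_re, h2, Complex.ofReal_re, Real.log_div (by linarith) (by positivity)]
      rw [show log ‖z‖ - log (4 * π) - log ‖z‖ = -log (4 * π) by ring, abs_neg, abs_of_nonneg hlp]
    · simpa using h3
  have h5 : heatLog 0 z + Complex.I / 4 * (log ‖z‖ : ℂ) = (heatLog 0 z + Complex.I / 4 * L)
      - Complex.I / 4 * (L - (log ‖z‖ : ℂ)) := by ring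
  rw [h5]
  refine (norm_sub_le _ _).trans ?_
  rw [norm_mul, norm_div, Complex.norm_I, Complex.norm_ofNat]
  have h6 : 1 / ‖z‖ ≤ 1 := by rw [div_le_one (by linarith)]; linarith
  have h7 : exp (-z.im / 4) ≤ 1 := exp_le_one_iff.2 (by linarith)
  have h8 : C * (1 / ‖z‖ + exp (-z.im / 4)) ≤ C * (1 + 1) := by gcongr
  have := pi_lt_four
  linarith

/-! ### Integrating the Burgers equation over a segment -/

/-- On the whole time interval `[t, 0]`, of length at most `T₀`, all zeros of the heat flow are real
and simple. -/
structure RealSimpleFrom (T₀ t : ℝ) : Prop where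
  nonpos : t ≤ 0
  neg_le : -t ≤ T₀
  good : ∀ s ∈ Icc t 0, RealSimpleAt s

/-- The quantity `u'' + 2 u u' = -∂_t u` at the point `x + i y`. -/
def burgers (y x s : ℝ) : ℂ := heatLog₂ s (x + y * Complex.I)
    + 2 * heatLog s (x + y * Complex.I) * heatLog₁ s (x + y * Complex.I)

lemma RealSimpleFrom.continuousOn_burgers {T₀ t : ℝ} (h : RealSimpleFrom T₀ t) {y : ℝ} (hy : 0 < y) :
    ContinuousOn (fun p : ℝ × ℝ => burgers y p.1 p.2) (univ ×ˢ Icc t 0) := by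
  have him : ∀ x : ℝ, 0 < ((x : ℂ) + y * Complex.I).im := fun x => by simpa using hy
  have hk : ∀ k, ContinuousOn (fun p : ℝ × ℝ => heatInt k p.2 (p.1 + y * Complex.I))
      (univ ×ˢ Icc t 0) := fun k =>
    ((continuous_heatInt k).comp (by fun_prop : Continuous fun p : ℝ × ℝ =>
      ((p.2 : ℂ), (p.1 : ℂ) + y * Complex.I))).continuousOn
  have hne : ∀ p ∈ (univ : Set ℝ) ×ˢ Icc t 0, heatInt 0 (p.2 : ℝ) ((p.1 : ℝ) + y * Complex.I) ≠ 0 :=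
    fun p hp => (h.good p.2 hp.2).ne_zero (him p.1)
  have hc0 : ContinuousOn (fun p : ℝ × ℝ => heatLog p.2 (p.1 + y * Complex.I)) (univ ×ˢ Icc t 0) :=
    (hk 1).div (hk 0) hne
  have hc1 : ContinuousOn (fun p : ℝ × ℝ => heatLog₁ p.2 (p.1 + y * Complex.I)) (univ ×ˢ Icc t 0) :=
    ((hk 2).div (hk 0) hne).sub (hc0.pow 2)
  have hc2 : ContinuousOn (fun p : ℝ × ℝ => heatLog₂ p.2 (p.1 + y * Complex.I)) (univ ×ˢ Icc t 0) :=
    (((hk 3).div (hk 0) hne).sub (((hk 1).mul (hk 2)).div ((hk 0).pow 2)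
      fun p hp => pow_ne_zero 2 (hne p hp))).sub ((continuousOn_const.mul hc0).mul hc1)
  exact hc2.add ((continuousOn_const.mul hc0).mul hc1)

lemma RealSimpleFrom.integral_burgers_time {T₀ t : ℝ} (h : RealSimpleFrom T₀ t) {y : ℝ} (hy : 0 < y)
    (x : ℝ) : ∫ s in t..0, burgers y x s
      = heatLog t (x + y * Complex.I) - heatLog 0 (x + y * Complex.I) := by
  have huIcc : uIcc t 0 = Icc t 0 := uIcc_of_le h.nonpos
  have hcg : ContinuousOn (burgers y x) (uIcc t 0) := by
    rw [huIcc]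
    exact (h.continuousOn_burgers hy).comp (f := fun s : ℝ => (x, s)) (by fun_prop)
      fun s hs => ⟨mem_univ _, hs⟩
  have hd : ∀ s ∈ uIcc t 0, HasDerivAt (fun s : ℝ => -heatLog s (x + y * Complex.I))
      (burgers y x s) s := by
    intro s hs
    rw [huIcc] at hs
    have h0 := (hasDerivAt_heatLog_curve (Complex.ofRealCLM.hasDerivAt (x := s))
      (hasDerivAt_const s ((x : ℂ) + y * Complex.I))
      ((h.good s hs).ne_zero (by simpa using hy))).neg
    refine h0.congr_deriv ?_
    simp [burgers]
  rw [intervalIntegral.integral_eq_sub_of_hasDerivAt hd hcg.intervalIntegrable]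
  push_cast; ring

lemma RealSimpleFrom.integral_burgers_space {T₀ t : ℝ} (h : RealSimpleFrom T₀ t) {y : ℝ} (hy : 0 < y)
    (T : ℝ) {s : ℝ} (hs : s ∈ Icc t 0) : ∫ x in (0 : ℝ)..T, burgers y x s
      = (heatLog₁ s (T + y * Complex.I) + heatLog s (T + y * Complex.I) ^ 2)
        - (heatLog₁ s (y * Complex.I) + heatLog s (y * Complex.I) ^ 2) := by
  have hcg : ContinuousOn (fun x => burgers y x s) (uIcc 0 T) :=
    (h.continuousOn_burgers hy).comp (f := fun x : ℝ => (x, s)) (by fun_prop)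
      fun x _ => ⟨mem_univ _, hs⟩
  have hd : ∀ x ∈ uIcc 0 T, HasDerivAt (fun x : ℝ => heatLog₁ s (x + y * Complex.I)
      + heatLog s (x + y * Complex.I) ^ 2) (burgers y x s) x := by
    intro x _
    have hz := (h.good s hs).ne_zero (z := (x : ℂ) + y * Complex.I) (by simpa using hy)
    have hin : HasDerivAt (fun x : ℝ => (x : ℂ) + y * Complex.I) 1 x :=
      (Complex.ofRealCLM.hasDerivAt (x := x)).add_const _
    have e1 := (hasDerivAt_heatLog₁ hz).comp x hin
    have e0 := (hasDerivAt_heatLog hz).comp x hin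
    refine (e1.add (e0.pow 2)).congr_deriv ?_
    simp [burgers]
  rw [intervalIntegral.integral_eq_sub_of_hasDerivAt hd hcg.intervalIntegrable]
  simp

/-- Integrating `∂_t u = -∂_z (u' + u²)` over a horizontal segment. -/
lemma RealSimpleFrom.integral_heatLog_sub {T₀ t : ℝ} (h : RealSimpleFrom T₀ t) (T : ℝ) {y : ℝ}
    (hy : 0 < y) :
    ∫ x in (0 : ℝ)..T, (heatLog t (x + y * Complex.I) - heatLog 0 (x + y * Complex.I))
      = ∫ s in t..0, ((heatLog₁ s (T + y * Complex.I) + heatLog s (T + y * Complex.I) ^ 2)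
        - (heatLog₁ s (y * Complex.I) + heatLog s (y * Complex.I) ^ 2)) := by
  have huIcc : uIcc t 0 = Icc t 0 := uIcc_of_le h.nonpos
  have hint : IntegrableOn (Function.uncurry (burgers y)) (uIoc 0 T ×ˢ uIoc t 0) := by
    have : IntegrableOn (fun p : ℝ × ℝ => burgers y p.1 p.2) (uIcc 0 T ×ˢ uIcc t 0) := by
      refine ContinuousOn.integrableOn_compact (isCompact_uIcc.prod isCompact_uIcc) ?_
      rw [huIcc]
      exact (h.continuousOn_burgers hy).mono (prod_mono (subset_univ _) subset_rfl)
    exact this.mono_set (prod_mono uIoc_subset_uIcc uIoc_subset_uIcc)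
  have hswap := intervalIntegral_intervalIntegral_swap hint
  simp only [h.integral_burgers_time hy] at hswap
  rw [hswap]
  exact intervalIntegral.integral_congr fun s hs => h.integral_burgers_space hy T (huIcc ▸ hs)

/-! ### The Riemann-von Mangoldt formula along the flow -/

lemma logPlus_nonneg_eq {x : ℝ} (hx : 0 ≤ x) : logPlus x = log (2 + x) := by
  rw [logPlus, abs_of_nonneg hx]

lemma half_lt_logPlus (x : ℝ) : 1 / 2 < logPlus x := by
  have h2 := Real.log_two_gt_d9
  have : log 2 ≤ logPlus x := Real.log_le_log (by norm_num) (by linarith [abs_nonneg x])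
  linarith

/-- A height constant which beats the logarithm of itself. -/
lemma exists_log_le_self (a b : ℝ) (ha : 0 ≤ a) (hb : 0 ≤ b) :
    ∃ K : ℝ, 14 ≤ K ∧ a + b * log (K + 1) ≤ K := by
  set r := 2 * b + a + 4 with hr
  refine ⟨r ^ 2 - 1, by nlinarith, ?_⟩
  have h1 : log (r ^ 2) ≤ 2 * r := by
    rw [Real.log_pow]
    have := Real.log_le_self (show 0 ≤ r by positivity)
    push_cast; linarith
  rw [sub_add_cancel]
  nlinarith

/-- At heights `K log T` over `[0, T]` the logarithmic derivative is `O(log T)` for the whole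
time interval. -/
lemma exists_norm_heatLog_le (T₀ : ℝ) (hT₀ : 0 ≤ T₀) : ∃ K A : ℝ, 14 ≤ K ∧ 2 ≤ A ∧ ∀ t, RealSimpleFrom T₀ t →
    ∀ T, 0 ≤ T → ∀ x ∈ Icc 0 T, ∀ s ∈ Icc t 0,
      ‖heatLog s (x + (K * logPlus T : ℝ) * Complex.I)‖ ≤ A * logPlus T ∧
      ‖heatLog₁ s (x + (K * logPlus T : ℝ) * Complex.I)‖ ≤ A * logPlus T := by
  obtain ⟨C, hC, hB⟩ := exists_norm_heatLog_zero_log_le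
  obtain ⟨K, hK, hK2⟩ := exists_log_le_self (400 * (T₀ + 1) * (2 + 2 * C)) (400 * (T₀ + 1) * 2)
    (by positivity) (by positivity)
  -- `log |z| ≤ log (K + 1) + log T` on the segment, so `A` depends on `K` logarithmically, and
  -- `K` can still be chosen so large that the a priori estimate applies at height `K log T`
  set A := 2 + 2 * C + 2 * log (K + 1) with hA
  have hlK : 0 ≤ log (K + 1) := log_nonneg (by linarith)
  refine ⟨K, 2 * A, hK, by linarith, fun t ht T hT x hx s hs => ?_⟩
  set L := logPlus T with hL
  have hL2 := half_lt_logPlus T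
  rw [← hL] at hL2
  set y := K * L with hy
  set z : ℂ := x + (y : ℝ) * Complex.I with hz
  have hzim : z.im = y := by simp [hz]
  have hy7 : 7 ≤ y := by rw [hy]; nlinarith
  have hzn : 7 ≤ ‖z‖ := by
    have := Complex.abs_im_le_norm z
    rw [hzim] at this
    linarith [le_abs_self y]
  have hzle : ‖z‖ ≤ (K + 1) * (2 + T) := by
    have h1 : ‖z‖ ≤ |x| + |y| := by
      refine (Complex.norm_le_abs_re_add_abs_im z).trans ?_
      rw [hzim]; simp [hz]
    rw [abs_of_nonneg hx.1, abs_of_nonneg (by linarith)] at h1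
    have h2 : L ≤ 2 + T := by
      rw [hL, logPlus_nonneg_eq hT]; exact Real.log_le_self (by linarith)
    have : y ≤ K * (2 + T) := by rw [hy]; gcongr
    linarith [hx.2]
  have hlogz : log ‖z‖ ≤ log (K + 1) + L := by
    have := Real.log_le_log (by linarith) hzle
    rwa [Real.log_mul (by linarith) (by linarith), ← logPlus_nonneg_eq hT] at this
  have hlogz0 : 0 ≤ log ‖z‖ := log_nonneg (by linarith)
  have hM : 1 ≤ A * L := by
    have : 2 * L ≤ A * L := by gcongr; linarith
    linarith
  have h0 : ‖heatLog 0 z‖ ≤ A * L := by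
    have h1 := hB z (by linarith)
    have h2 : heatLog 0 z = (heatLog 0 z + Complex.I / 4 * (log ‖z‖ : ℂ))
      - Complex.I / 4 * (log ‖z‖ : ℂ) := by ring
    have h3 : ‖Complex.I / 4 * (log ‖z‖ : ℂ)‖ = log ‖z‖ / 4 := by
      rw [norm_mul, norm_div, Complex.norm_I, Complex.norm_ofNat, Complex.norm_real,
        Real.norm_of_nonneg hlogz0]; ring
    rw [h2]
    refine (norm_sub_le _ _).trans ?_
    rw [h3, hA]
    nlinarith
  have hhz : 400 * (T₀ + 1) * (A * L) ≤ z.im := by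
    rw [hzim, hy]
    have : 400 * (T₀ + 1) * A ≤ K := by rw [hA]; linarith
    nlinarith
  have hu := norm_heatLog_le_two_mul ht.nonpos ht.neg_le ht.good hM h0 hhz hs
  have hu1 := ((ht.good s hs).norm_heatLog₁_le (z := z) (by linarith)).1
  have hAL : 2 * (A * L) = 2 * A * L := by ring
  refine ⟨by rw [← hAL]; exact hu, hu1.trans ?_⟩
  rw [div_le_iff₀ (by linarith), hzim]
  nlinarith

/-- `H_0` has no zeros where the Euler product converges, whatever the value of `Λ`. -/
lemma heatInt_zero_zero_ne {z : ℂ} (hz : 1 < z.im) : heatInt 0 0 z ≠ 0 := by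
  have hre : 1 < ((1 - Complex.I * z) / 2).re := by simp; linarith
  rw [heatInt_zero_eq hz]
  set s := (1 - Complex.I * z) / 2
  have hs0 : s ≠ 0 := fun h => by rw [h] at hre; norm_num at hre
  have hs1 : s - 1 ≠ 0 := fun h => by rw [sub_eq_zero.1 h] at hre; norm_num at hre
  exact mul_ne_zero (mul_ne_zero (mul_ne_zero (mul_ne_zero (by norm_num) hs0) hs1)
    (Complex.Gammaℝ_ne_zero_of_re_pos (by linarith))) (riemannZeta_ne_zero_of_one_lt_re hre)

/-- Comparison of `-Im (H_0'/H_0)` with the density `¼ log (x / 4π)` of the classical locations. -/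
lemma exists_integral_im_heatLog_zero : ∃ C : ℝ, 0 < C ∧ ∀ T y : ℝ, 0 < T → 7 ≤ y → 4 * logPlus T ≤ y →
    |(∫ x in (0 : ℝ)..T, -(heatLog 0 (x + y * Complex.I)).im) - π * Psi T|
      ≤ C * (1 + logPlus T) + y * (1 + logPlus T) := by
  obtain ⟨C, hC, hA⟩ := exists_abs_im_heatLog_zero_le
  refine ⟨2 * C, by positivity, fun T y hT hy hyL => ?_⟩
  set L := logPlus T with hL
  have hLe : L = log (2 + T) := logPlus_nonneg_eq hT.le
  have hL2 := half_lt_logPlus T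
  have hy0 : 0 < y := by linarith
  have hloglin : ∫ x in (0 : ℝ)..T, 1 / 4 * log (x / (4 * π)) = π * Psi T := by
    have e : ∫ x in (0 : ℝ)..T, 1 / 4 * log (x / (4 * π))
        = ∫ x in (0 : ℝ)..T, (1 / 4 * log x - 1 / 4 * log (4 * π)) := by
      refine intervalIntegral.integral_congr_ae (Eventually.of_forall fun x hx => ?_)
      rw [uIoc_of_le hT.le] at hx
      rw [Real.log_div hx.1.ne' (by positivity)]; ring
    rw [e, intervalIntegral.integral_sub (intervalIntegral.intervalIntegrable_log'.const_mul _)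
      intervalIntegrable_const, intervalIntegral.integral_const_mul, integral_log,
      intervalIntegral.integral_const, Psi, Real.log_div hT.ne' (by positivity)]
    simp only [smul_eq_mul, log_zero]
    field_simp
    ring
  have hI1 : IntervalIntegrable (fun x : ℝ => -(heatLog 0 (x + y * Complex.I)).im) volume 0 T := by
    have : Continuous fun x : ℝ => heatLog 0 (x + y * Complex.I) :=
      ((differentiable_heatInt 1 0).continuous.comp (by fun_prop)).div
        ((differentiable_heatInt 0 0).continuous.comp (by fun_prop)) fun x =>
        heatInt_zero_zero_ne (by simp; linarith)
    exact (Complex.continuous_im.comp this).neg.intervalIntegrable _ _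
  have hI2 : IntervalIntegrable (fun x : ℝ => 1 / 4 * log (x / (4 * π))) volume 0 T := by
    refine (((intervalIntegral.intervalIntegrable_log' (a := 0) (b := T)).const_mul (1 / 4)).sub
      (intervalIntegrable_const (c := 1 / 4 * log (4 * π)))).congr ?_
    intro x hx
    rw [uIoc_of_le hT.le] at hx
    simp only
    rw [Real.log_div hx.1.ne' (by positivity)]; ring
  have hlogy : ContinuousOn (fun x : ℝ => log (x + y)) (uIcc 0 T) := by
    refine ContinuousOn.log (by fun_prop) fun x hx => ?_
    rw [uIcc_of_le hT.le] at hx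
    linarith [hx.1]
  have hinvy : ContinuousOn (fun x : ℝ => (x + y)⁻¹) (uIcc 0 T) := by
    refine ContinuousOn.inv₀ (by fun_prop) fun x hx => ?_
    rw [uIcc_of_le hT.le] at hx
    linarith [hx.1]
  set b : ℝ → ℝ := fun x => C * (2 * (x + y)⁻¹ + 1 / (2 + T)) + 1 / 4 * (log (x + y) - log x) with hb
  have hbI1 : IntervalIntegrable (fun x : ℝ => C * (2 * (x + y)⁻¹ + 1 / (2 + T))) volume 0 T :=
    ((hinvy.intervalIntegrable.const_mul 2).add intervalIntegrable_const).const_mul C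
  have hbI2 : IntervalIntegrable (fun x : ℝ => 1 / 4 * (log (x + y) - log x)) volume 0 T :=
    (hlogy.intervalIntegrable.sub intervalIntegral.intervalIntegrable_log').const_mul _
  have hbound : ∀ x ∈ Ioc 0 T, ‖-(heatLog 0 (x + y * Complex.I)).im - 1 / 4 * log (x / (4 * π))‖ ≤ b x := by
    intro x hx
    have hx0 := hx.1
    set z : ℂ := x + y * Complex.I with hz
    have hzim : z.im = y := by simp [hz]
    have hzre : z.re = x := by simp [hz]
    have h1 := hA z (by rw [hzim]; exact hy)
    have hzle : ‖z‖ ≤ x + y := by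
      have := Complex.norm_le_abs_re_add_abs_im z
      rwa [hzim, hzre, abs_of_pos hx0, abs_of_pos hy0] at this
    have hxz : x ≤ ‖z‖ := by
      have := Complex.abs_re_le_norm z
      rwa [hzre, abs_of_pos hx0] at this
    have hyz : y ≤ ‖z‖ := by
      have := Complex.abs_im_le_norm z
      rwa [hzim, abs_of_pos hy0] at this
    have hzpos : 0 < ‖z‖ := by linarith
    have h2 : 1 / ‖z‖ ≤ 2 * (x + y)⁻¹ := by
      rw [← div_eq_mul_inv, div_le_div_iff₀ hzpos (by linarith)]; linarith
    have h3 : exp (-z.im / 4) ≤ 1 / (2 + T) := by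
      rw [one_div, ← Real.exp_log (show 0 < (2 + T)⁻¹ by positivity), Real.log_inv, ← hLe, hzim]
      apply exp_le_exp.2; linarith
    have h4 : 0 ≤ log ‖z‖ - log x := sub_nonneg.2 (Real.log_le_log hx0 hxz)
    have h5 : log ‖z‖ - log x ≤ log (x + y) - log x :=
      sub_le_sub_right (Real.log_le_log hzpos hzle) _
    have h6 : -(heatLog 0 z).im - 1 / 4 * log (x / (4 * π))
        = (-(heatLog 0 z).im - 1 / 4 * log (‖z‖ / (4 * π))) + 1 / 4 * (log ‖z‖ - log x) := by
      rw [Real.log_div hx0.ne' (by positivity), Real.log_div hzpos.ne' (by positivity)]; ring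
    rw [h6, hb]
    refine (norm_add_le _ _).trans (add_le_add (h1.trans ?_) ?_)
    · gcongr
    · rw [Real.norm_of_nonneg (by linarith)]; linarith
  have hmain := intervalIntegral.norm_integral_le_of_norm_le hT.le
    (Eventually.of_forall hbound) (hbI1.add hbI2)
  rw [intervalIntegral.integral_sub hI1 hI2, hloglin, Real.norm_eq_abs] at hmain
  refine hmain.trans ?_
  have hshift : ∫ x in (0 : ℝ)..T, log (x + y) = (T + y) * log (T + y) - y * log y - T := by
    rw [intervalIntegral.integral_comp_add_right (fun x => log x) y, integral_log]; ring_nf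
  have hshift2 : ∫ x in (0 : ℝ)..T, (x + y)⁻¹ = log (T + y) - log y := by
    rw [intervalIntegral.integral_comp_add_right (fun x => x⁻¹) y, integral_inv_of_pos (by linarith)
      (by linarith), Real.log_div (by linarith) (by linarith)]
    simp
  rw [hb, intervalIntegral.integral_add hbI1 hbI2, intervalIntegral.integral_const_mul,
    intervalIntegral.integral_const_mul, intervalIntegral.integral_add
      (hinvy.intervalIntegrable.const_mul 2) intervalIntegrable_const,
    intervalIntegral.integral_const_mul, hshift2, intervalIntegral.integral_const,
    intervalIntegral.integral_sub hlogy.intervalIntegrable intervalIntegral.intervalIntegrable_log',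
    hshift, integral_log]
  have k1 : log (T + y) - log y ≤ L := by
    rw [hLe, ← Real.log_div (by linarith) (by linarith)]
    refine Real.log_le_log (by positivity) ?_
    rw [div_le_iff₀ hy0]; nlinarith
  have k2 : T * (log (T + y) - log T) ≤ y := by
    rw [← Real.log_div (by linarith) (by linarith)]
    have := Real.log_le_sub_one_of_pos (show 0 < (T + y) / T by positivity)
    have e : (T + y) / T - 1 = y / T := by field_simp; ring
    rw [e] at this
    calc T * log ((T + y) / T) ≤ T * (y / T) := by gcongr
      _ = y := by field_simp
  have k3 : (T - 0) • (1 / (2 + T)) ≤ 1 := by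
    rw [smul_eq_mul, mul_one_div, div_le_one (by linarith)]; linarith
  simp only [log_zero]
  have k4 : C * (2 * (log (T + y) - log y) + (T - 0) • (1 / (2 + T))) ≤ C * (2 * L + 1) := by gcongr
  have k5 : y * (log (T + y) - log y) ≤ y * L := by gcongr
  nlinarith

/-- The Riemann-von Mangoldt formula, uniformly along the heat flow. -/
lemma exists_abs_zeroCount_sub_Psi_le (T₀ : ℝ) (hT₀ : 0 ≤ T₀) : ∃ C : ℝ, 0 < C ∧
    ∀ t : ℝ, RealSimpleFrom T₀ t → ∀ T, 0 < T →
      |(zeroCount (heatInt 0 t) T : ℝ) - Psi T| ≤ C * logPlus T ^ 2 := by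
  obtain ⟨K, A, hK, hA, hKA⟩ := exists_norm_heatLog_le T₀ hT₀
  obtain ⟨C, hC, hC0⟩ := exists_integral_im_heatLog_zero
  refine ⟨6 * K * A + T₀ * (2 * (A + A) ^ 2) + 6 * C + 3 * K, by positivity, fun t ht T hT => ?_⟩
  have hb := hKA t ht T hT.le
  set L := logPlus T with hL
  have hL2 : 1 / 2 < L := half_lt_logPlus T
  set y := K * L with hy
  have hy7 : 7 ≤ y := by rw [hy]; nlinarith
  have hy0 : 0 < y := by linarith
  have hyL : 4 * L ≤ y := by rw [hy]; nlinarith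
  have hmem0 : (0 : ℝ) ∈ Icc t 0 := ⟨ht.nonpos, le_rfl⟩
  have hmemt : t ∈ Icc t 0 := ⟨le_rfl, ht.nonpos⟩
  have hcount := SimpleRealZeroEven.abs_zeroCount_sub_le (ht.good t hmemt) hT.le hy0
  rw [logDeriv_heatInt] at hcount
  have hend := (hb T ⟨hT.le, le_rfl⟩ t hmemt).1
  have hW : ∀ x ∈ Icc 0 T, ∀ s ∈ Icc t 0, ‖heatLog₁ s (x + y * Complex.I)
      + heatLog s (x + y * Complex.I) ^ 2‖ ≤ (A + A) ^ 2 * L ^ 2 := by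
    intro x hx s hs
    obtain ⟨h0, h1⟩ := hb x hx s hs
    refine (norm_add_le _ _).trans ?_
    rw [norm_pow]
    have h2 : ‖heatLog s (x + y * Complex.I)‖ ^ 2 ≤ (A * L) ^ 2 := by gcongr
    have h3 : 1 ≤ A * L := by nlinarith
    nlinarith
  have hcontu : ∀ s ∈ Icc t 0, Continuous fun x : ℝ => heatLog s (x + y * Complex.I) := by
    intro s hs
    refine Continuous.div ((differentiable_heatInt 1 s).continuous.comp (by fun_prop))
      ((differentiable_heatInt 0 s).continuous.comp (by fun_prop)) fun x =>
      (ht.good s hs).ne_zero (by simpa using hy0)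
  have hflow : |(∫ x in (0 : ℝ)..T, -(heatLog t (x + y * Complex.I)).im)
      - ∫ x in (0 : ℝ)..T, -(heatLog 0 (x + y * Complex.I)).im| ≤ T₀ * (2 * (A + A) ^ 2) * L ^ 2 := by
    have h1 := ht.integral_heatLog_sub T hy0
    have h2 : ‖∫ s in t..0, ((heatLog₁ s (T + y * Complex.I) + heatLog s (T + y * Complex.I) ^ 2)
        - (heatLog₁ s (y * Complex.I) + heatLog s (y * Complex.I) ^ 2))‖
        ≤ (2 * (A + A) ^ 2 * L ^ 2) * |0 - t| := by
      refine intervalIntegral.norm_integral_le_of_norm_le_const fun s hs => ?_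
      rw [uIoc_of_le ht.nonpos] at hs
      have hs' : s ∈ Icc t 0 := ⟨hs.1.le, hs.2⟩
      have a1 := hW T ⟨hT.le, le_rfl⟩ s hs'
      have a2 := hW 0 ⟨le_rfl, hT.le⟩ s hs'
      rw [Complex.ofReal_zero, zero_add] at a2
      refine (norm_sub_le _ _).trans ?_
      linarith
    rw [← h1] at h2
    have hc0 := hcontu 0 hmem0
    rw [Complex.ofReal_zero] at hc0
    have hct := hcontu t hmemt
    have h3 : (∫ x in (0 : ℝ)..T, -(heatLog t (x + y * Complex.I)).im)
        - (∫ x in (0 : ℝ)..T, -(heatLog 0 (x + y * Complex.I)).im)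
        = -(∫ x in (0 : ℝ)..T, (heatLog t (x + y * Complex.I) - heatLog 0 (x + y * Complex.I))).im := by
      rw [← intervalIntegral.integral_sub]
      · have := (Complex.imCLM.intervalIntegral_comp_comm (μ := volume) (a := 0) (b := T)
          (f := fun x : ℝ => heatLog t (x + y * Complex.I) - heatLog 0 (x + y * Complex.I))
          ((hct.sub hc0).intervalIntegrable _ _))
        simp only [Complex.imCLM_apply] at this
        rw [← this, ← intervalIntegral.integral_neg]
        refine intervalIntegral.integral_congr fun x _ => ?_
        simp; ring
      · exact (Complex.continuous_im.comp hct).neg.intervalIntegrable _ _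
      · exact (Complex.continuous_im.comp hc0).neg.intervalIntegrable _ _
    rw [h3, abs_neg]
    refine (Complex.abs_im_le_norm _).trans (h2.trans ?_)
    rw [zero_sub, abs_of_nonneg (by linarith [ht.nonpos])]
    have := ht.neg_le
    calc 2 * (A + A) ^ 2 * L ^ 2 * -t ≤ 2 * (A + A) ^ 2 * L ^ 2 * T₀ := by gcongr
      _ = _ := by ring
  have hzero := hC0 T y hT hy7 hyL
  have e1 : |y * (heatLog t (T + y * Complex.I)).re| ≤ K * A * L ^ 2 := by
    rw [abs_mul, abs_of_pos hy0]
    calc y * |(heatLog t (T + y * Complex.I)).re| ≤ y * (A * L) := by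
          gcongr; exact (Complex.abs_re_le_norm _).trans hend
      _ = _ := by rw [hy]; ring
  have e2 : 5 * y * -(heatLog t (T + y * Complex.I)).im ≤ 5 * K * A * L ^ 2 := by
    calc 5 * y * -(heatLog t (T + y * Complex.I)).im ≤ 5 * y * (A * L) := by
          gcongr; exact (neg_le_abs _).trans ((Complex.abs_im_le_norm _).trans hend)
      _ = _ := by rw [hy]; ring
  have e3 : C * (1 + L) + y * (1 + L) ≤ 6 * C * L ^ 2 + 3 * K * L ^ 2 := by
    have : 1 + L ≤ 6 * L ^ 2 := by nlinarith
    have : 1 + L ≤ 3 * L := by linarith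
    have h1 : C * (1 + L) ≤ C * (6 * L ^ 2) := by gcongr
    have h2 : y * (1 + L) ≤ y * (3 * L) := by gcongr
    have h3 : y * (3 * L) = 3 * K * L ^ 2 := by rw [hy]; ring
    linarith
  have hfin : |π * ((zeroCount (heatInt 0 t) T : ℝ) - Psi T)|
      ≤ (6 * K * A + T₀ * (2 * (A + A) ^ 2) + 6 * C + 3 * K) * L ^ 2 := by
    have g0 := abs_le.1 hcount
    have g1 := abs_le.1 e1
    have g2 := abs_le.1 hflow
    have g3 := abs_le.1 hzero
    rw [abs_le]
    constructor <;> linarith [g0.1, g0.2, g1.1, g1.2, g2.1, g2.2, g3.1, g3.2]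
  rw [abs_mul, abs_of_pos pi_pos] at hfin
  have := abs_nonneg ((zeroCount (heatInt 0 t) T : ℝ) - Psi T)
  nlinarith [pi_gt_three]

/-! ### Equidistribution of zeros at the logarithmic scale -/

/-- A two-constants lemma: a bounded holomorphic function on a disc which is very small on a
concentric disc is small on every smaller concentric disc. -/
lemma exists_small_on_closedBall {ρ r R M ε : ℝ} (hρ : 0 < ρ) (hρR : ρ < R) (hr : 0 ≤ r) (hrR : r < R)
    (hM : 0 ≤ M) (hε : 0 < ε) : ∃ δ : ℝ, 0 < δ ∧ ∀ (f : ℂ → ℂ) (a : ℂ),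
      DifferentiableOn ℂ f (Metric.ball a R) → (∀ w ∈ Metric.ball a R, ‖f w‖ ≤ M) →
      (∀ w ∈ Metric.closedBall a ρ, ‖f w‖ ≤ δ) → ∀ w ∈ Metric.closedBall a r, ‖f w‖ ≤ ε := by
  set R₁ := (r + R) / 2 with hR₁
  have hR₁0 : 0 < R₁ := by linarith
  set q := r / R₁ with hq
  have hq0 : 0 ≤ q := by positivity
  have hq1 : q < 1 := by rw [hq, div_lt_one hR₁0]; linarith
  obtain ⟨N, hN⟩ : ∃ N : ℕ, M * q ^ N * (1 - q)⁻¹ ≤ ε / 2 := by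
    have h1 : Tendsto (fun N : ℕ => M * q ^ N * (1 - q)⁻¹) atTop (𝓝 0) := by
      simpa using ((tendsto_pow_atTop_nhds_zero_of_lt_one hq0 hq1).const_mul M).mul_const (1 - q)⁻¹
    exact (h1.eventually (Iic_mem_nhds (by positivity : 0 < ε / 2))).exists
  set S := ∑ n ∈ Finset.range N, (r / ρ) ^ n with hS
  have hS0 : 0 ≤ S := Finset.sum_nonneg fun n _ => by positivity
  refine ⟨ε / 2 / (S + 1), by positivity, fun f a hf hfM hfδ w hw => ?_⟩
  set δ := ε / 2 / (S + 1) with hδ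
  have hw' : w ∈ Metric.ball a R := Metric.closedBall_subset_ball hrR hw
  have hwr : ‖w - a‖ ≤ r := by rwa [mem_closedBall_iff_norm] at hw
  have hsum := Complex.hasSum_taylorSeries_on_ball hf hw'
  set c : ℕ → ℂ := fun n => (n.factorial : ℂ)⁻¹ • (w - a) ^ n • iteratedDeriv n f a with hc
  have hcoef : ∀ (n : ℕ) (R' C : ℝ), 0 < R' → R' < R → (∀ z ∈ Metric.sphere a R', ‖f z‖ ≤ C) →
      0 ≤ C → ‖c n‖ ≤ C * (r / R') ^ n := by
    intro n R' C hR' hR'R hC hC0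
    have h1 := Complex.norm_iteratedDeriv_le_of_forall_mem_sphere_norm_le n hR'
      (DifferentiableOn.diffContOnCl (hf.mono (by
        rw [closure_ball _ hR'.ne']; exact Metric.closedBall_subset_ball hR'R))) hC
    have hfac : (0 : ℝ) < n.factorial := by exact_mod_cast n.factorial_pos
    rw [hc]
    simp only [norm_smul, norm_inv, norm_pow, Complex.norm_natCast]
    calc (n.factorial : ℝ)⁻¹ * (‖w - a‖ ^ n * ‖iteratedDeriv n f a‖)
        ≤ (n.factorial : ℝ)⁻¹ * (r ^ n * (n.factorial * C / R' ^ n)) := by gcongr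
      _ = C * (r / R') ^ n := by rw [div_pow]; field_simp
  have hlow : ∀ n, ‖c n‖ ≤ δ * (r / ρ) ^ n := fun n => hcoef n ρ δ hρ hρR
    (fun z hz => hfδ z (Metric.sphere_subset_closedBall hz)) (by positivity)
  have hhigh : ∀ n, ‖c n‖ ≤ M * q ^ n := fun n => hcoef n R₁ M hR₁0 (by linarith)
    (fun z hz => hfM z (by
      rw [mem_sphere_iff_norm] at hz
      rw [mem_ball_iff_norm, hz]; linarith)) hM
  rw [← hsum.tsum_eq, ← hsum.summable.sum_add_tsum_nat_add N]
  have htail : ‖∑' n, c (n + N)‖ ≤ ε / 2 := by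
    have hg : HasSum (fun n : ℕ => M * q ^ N * q ^ n) (M * q ^ N * (1 - q)⁻¹) :=
      (hasSum_geometric_of_lt_one hq0 hq1).mul_left _
    refine (tsum_of_norm_bounded hg fun n => ?_).trans hN
    refine (hhigh (n + N)).trans (le_of_eq ?_)
    rw [pow_add]; ring
  have hhead : ‖∑ n ∈ Finset.range N, c n‖ ≤ ε / 2 := by
    calc ‖∑ n ∈ Finset.range N, c n‖ ≤ ∑ n ∈ Finset.range N, δ * (r / ρ) ^ n :=
          norm_sum_le_of_le _ fun n _ => hlow n
      _ = δ * S := by rw [← Finset.mul_sum]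
      _ ≤ δ * (S + 1) := by gcongr; linarith
      _ = ε / 2 := by rw [hδ]; field_simp
  exact (norm_add_le _ _).trans (by linarith)

lemma tendsto_logPlus : Tendsto logPlus atTop atTop := by
  refine Tendsto.congr' ?_ (Real.tendsto_log_atTop.comp (tendsto_atTop_add_const_left atTop 2 tendsto_id))
  filter_upwards [eventually_ge_atTop 0] with x hx
  rw [logPlus_nonneg_eq hx]; rfl

lemma eventually_mul_logPlus_le (B : ℝ) : ∀ᶠ X in atTop, B * logPlus X ≤ X / 2 := by
  have h1 := (Real.isLittleO_log_id_atTop.bound (show (0 : ℝ) < 1 / (4 * (|B| + 1)) by positivity))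
  have h2 := (tendsto_atTop_add_const_left atTop (2 : ℝ) tendsto_id).eventually h1
  filter_upwards [h2, eventually_ge_atTop 2] with X hX hX2
  simp only [id] at hX
  rw [Real.norm_of_nonneg (log_nonneg (by linarith)), Real.norm_of_nonneg (by linarith)] at hX
  rw [logPlus_nonneg_eq (by linarith)]
  have hB := le_abs_self B
  have hB0 := abs_nonneg B
  have hl : 0 ≤ log (2 + X) := log_nonneg (by linarith)
  calc B * log (2 + X) ≤ (|B| + 1) * log (2 + X) := by gcongr; linarith
    _ ≤ (|B| + 1) * (1 / (4 * (|B| + 1)) * (2 + X)) := by gcongr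
    _ = (2 + X) / 4 := by field_simp
    _ ≤ X / 2 := by linarith

/-- At height `K log X` near a large point `X`, the logarithmic derivative stays within `O(1)` of the
constant `-(i/4) log X`, uniformly along the heat flow. -/
lemma exists_norm_heatLog_add_le (T₀ : ℝ) (hT₀ : 0 ≤ T₀) : ∃ K C : ℝ, 1 ≤ K ∧ 0 < C ∧ ∀ B : ℝ,
    ∀ᶠ X in atTop, ∀ t, RealSimpleFrom T₀ t → ∀ z : ℂ, |z.re - X| ≤ B * logPlus X →
      K * logPlus X ≤ z.im → z.im ≤ B * logPlus X →
      ‖heatLog t z + Complex.I / 4 * (logPlus X : ℝ)‖ ≤ C := by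
  obtain ⟨C, hC, hB0⟩ := exists_norm_heatLog_zero_log_le
  set A := 2 * (C + 1) + 2 with hA
  refine ⟨400 * (T₀ + 1) * A + T₀ / 2 + 14, (C + 1 + 1) * exp (2 * T₀), ?_, by positivity, fun B => ?_⟩
  · have : 0 ≤ 400 * (T₀ + 1) * A := by positivity
    linarith
  filter_upwards [eventually_mul_logPlus_le (2 * |B| + T₀), eventually_ge_atTop 2] with X hXB hX2 t ht z
    hzre hzim hzim2
  set L := logPlus X with hL
  have hL2 : 1 / 2 < L := half_lt_logPlus X
  have hX0 : 0 < X := by linarith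
  have hLX : |log X - L| ≤ 1 := by
    have h1 : log X ≤ L := by
      rw [hL, logPlus_nonneg_eq hX0.le]; exact Real.log_le_log hX0 (by linarith)
    have h2 : L ≤ log X + log 2 := by
      rw [hL, logPlus_nonneg_eq hX0.le, ← Real.log_mul hX0.ne' (by norm_num)]
      exact Real.log_le_log (by linarith) (by linarith)
    have := Real.log_two_lt_d9
    rw [abs_le]; constructor <;> linarith
  set c : ℂ := -(Complex.I / 4) * (L : ℝ) with hc
  have hBL : B * L ≤ |B| * L := by gcongr; exact le_abs_self B
  -- the values of `H_0'/H_0` along the characteristic starting at `z`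
  have hchar : ∀ s ∈ Icc t 0, ∀ w : ℂ, w = z + 2 * c * (s - t) →
      400 * (T₀ + 1) * (A * L) ≤ w.im ∧ ‖heatLog 0 w - c‖ ≤ C + 1 := by
    intro s hs w hw
    have hst : 0 ≤ s - t ∧ s - t ≤ T₀ := ⟨by linarith [hs.1], by linarith [hs.2, ht.neg_le]⟩
    have hw2 : w = z + ((-(L / 2 * (s - t)) : ℝ) : ℂ) * Complex.I := by
      rw [hw, hc]; push_cast; ring
    have hwre : w.re = z.re := by rw [hw2]; simp
    have hwim : w.im = z.im - L / 2 * (s - t) := by rw [hw2]; simp; ring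
    have hshift : L / 2 * (s - t) ≤ L / 2 * T₀ := by gcongr; exact hst.2
    have hshift0 : 0 ≤ L / 2 * (s - t) := mul_nonneg (by linarith) hst.1
    have him1 : 400 * (T₀ + 1) * (A * L) + 7 ≤ w.im := by rw [hwim]; nlinarith
    have hAL : 0 ≤ 400 * (T₀ + 1) * (A * L) := by positivity
    refine ⟨by linarith, ?_⟩
    have hdist : ‖w - X‖ ≤ X / 2 := by
      refine (Complex.norm_le_abs_re_add_abs_im _).trans ?_
      rw [Complex.sub_re, Complex.sub_im, Complex.ofReal_re, Complex.ofReal_im, hwre, sub_zero,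
        abs_of_nonneg (by linarith : 0 ≤ w.im)]
      have : 0 ≤ T₀ * L := by positivity
      nlinarith
    have hXn : ‖(X : ℂ)‖ = X := by rw [Complex.norm_real, Real.norm_of_nonneg hX0.le]
    have hw1 : ‖w‖ ≤ 2 * X := by
      have := norm_add_le (w - X) (X : ℂ)
      rw [sub_add_cancel, hXn] at this; linarith
    have hw3 : X / 2 ≤ ‖w‖ := by
      have := norm_sub_norm_le (X : ℂ) w
      rw [hXn, norm_sub_rev] at this; linarith
    have hlogw : |log ‖w‖ - log X| ≤ 1 := by
      have h1 := Real.log_le_log (by linarith) hw1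
      have h2 := Real.log_le_log (by linarith) hw3
      rw [Real.log_mul (by norm_num) hX0.ne'] at h1
      rw [Real.log_div hX0.ne' (by norm_num)] at h2
      have := Real.log_two_lt_d9
      rw [abs_le]; constructor <;> linarith
    have h1 := hB0 w (by linarith)
    have h2 : heatLog 0 w - c = (heatLog 0 w + Complex.I / 4 * (log ‖w‖ : ℂ))
        - Complex.I / 4 * ((log ‖w‖ - L : ℝ) : ℂ) := by rw [hc]; push_cast; ring
    rw [h2]
    refine (norm_sub_le _ _).trans (add_le_add h1 ?_)
    rw [norm_mul, norm_div, Complex.norm_I, Complex.norm_ofNat, Complex.norm_real, Real.norm_eq_abs]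
    have : |log ‖w‖ - L| ≤ 2 := by
      have := abs_add_le (log ‖w‖ - log X) (log X - L)
      rw [sub_add_sub_cancel] at this; linarith
    linarith
  have hcn : ‖c‖ = L / 4 := by
    rw [hc, norm_mul, norm_neg, norm_div, Complex.norm_I, Complex.norm_ofNat, Complex.norm_real,
      Real.norm_of_nonneg (by linarith)]; ring
  have hfin := norm_heatLog_sub_le (z := z) (c := c) (M := A * L) (δ := C + 1) ht.nonpos ht.neg_le
    ht.good (by nlinarith) (fun s hs => by
      have h1 := (hchar s hs _ rfl).2
      have h2 := norm_add_le (heatLog 0 (z + 2 * c * (s - t)) - c) c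
      rw [sub_add_cancel, hcn] at h2
      nlinarith) (fun s hs => (hchar s hs _ rfl).1)
    (hchar 0 ⟨ht.nonpos, le_rfl⟩ _ (by push_cast; ring)).2
  have h3 : heatLog t z + Complex.I / 4 * (L : ℝ) = heatLog t z - c := by rw [hc]; ring
  rw [h3]; exact hfin

/-- At heights comparable to `log X` near a large point `X`, the logarithmic derivative is
`O(log X)`, uniformly along the heat flow. -/
lemma exists_norm_heatLog_add_le_mul (T₀ : ℝ) (hT₀ : 0 ≤ T₀) (B : ℝ) {η : ℝ} (hη : 0 < η) :
    ∃ M : ℝ, 0 ≤ M ∧ ∀ᶠ X in atTop, ∀ t, RealSimpleFrom T₀ t → ∀ z : ℂ,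
      |z.re - X| ≤ B * logPlus X → η * logPlus X ≤ z.im → z.im ≤ B * logPlus X →
      ‖heatLog t z + Complex.I / 4 * (logPlus X : ℝ)‖ ≤ M * logPlus X := by
  obtain ⟨K, C, hK, hC, hKC⟩ := exists_norm_heatLog_add_le T₀ hT₀
  set A := 2 * C + 1 with hA
  refine ⟨A + 32 * (K * A / η) / η * K, by positivity, ?_⟩
  filter_upwards [hKC (max B K)] with X hX t ht z hre him him2
  set L := logPlus X with hL
  have hL2 : 1 / 2 < L := half_lt_logPlus X
  have hBm : B * L ≤ max B K * L := by gcongr; exact le_max_left _ _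
  have hKm : K * L ≤ max B K * L := by gcongr; exact le_max_right _ _
  rcases le_or_gt (K * L) z.im with hcase | hcase
  · have h1 := hX t ht z (hre.trans hBm) hcase (him2.trans hBm)
    have h2 : C ≤ A * L := by rw [hA]; nlinarith
    have h3 : 0 ≤ 32 * (K * A / η) / η * K * L := by positivity
    nlinarith
  have hgood := ht.good t ⟨le_rfl, ht.nonpos⟩
  set w : ℂ := z.re + (K * L : ℝ) * Complex.I with hw
  have hwre : w.re = z.re := by simp [hw]
  have hwim : w.im = K * L := by simp [hw]
  have h1 := hX t ht w (by rw [hwre]; exact hre.trans hBm) (by rw [hwim]) (by rw [hwim]; exact hKm)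
  have hKL : 0 < K * L := by positivity
  have hηL : 0 < η * L := by positivity
  have huw : ‖heatLog t w‖ ≤ A * L := by
    have h2 : ‖Complex.I / 4 * ((L : ℝ) : ℂ)‖ = L / 4 := by
      rw [norm_mul, norm_div, Complex.norm_I, Complex.norm_ofNat, Complex.norm_real,
        Real.norm_of_nonneg (by linarith)]; ring
    have h3 := norm_sub_le (heatLog t w + Complex.I / 4 * ((L : ℝ) : ℂ)) (Complex.I / 4 * ((L : ℝ) : ℂ))
    rw [add_sub_cancel_right, h2] at h3
    rw [hA]; nlinarith
  -- the derivative along the vertical segment from `w` down to `z`, where `y (-Im u)` is at most its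
  -- value at `w`
  have hder : ∀ v ∈ segment ℝ w z, ‖heatLog₁ t v‖ ≤ 32 * (K * A / η) / η ∧ 0 < v.im := by
    intro v hv
    have hvre : v.re = z.re := by
      obtain ⟨a, b, ha, hb, hab, rfl⟩ := hv
      simp [hwre]
      rw [← add_mul, hab, one_mul]
    have hvim : η * L ≤ v.im ∧ v.im ≤ K * L := by
      obtain ⟨a, b, ha, hb, hab, rfl⟩ := hv
      simp [hwim]
      constructor <;> nlinarith
    have hvpos : 0 < v.im := by linarith [hvim.1]
    refine ⟨?_, hvpos⟩
    have hb := (SimpleRealZeroEven.norm_deriv_logDeriv_le hgood hvpos).1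
    rw [logDeriv_heatInt, (hasDerivAt_heatLog (hgood.ne_zero hvpos)).deriv] at hb
    have hmono := SimpleRealZeroEven.mul_im_logDeriv_mono hgood z.re hvpos hvim.2
    rw [logDeriv_heatInt, ← hvre, Complex.re_add_im, hvre, ← hw] at hmono
    have hp : -(heatLog t w).im ≤ A * L :=
      (neg_le_abs _).trans ((Complex.abs_im_le_norm _).trans huw)
    have hp2 : v.im * -(heatLog t v).im ≤ K * L * (A * L) := hmono.trans (by gcongr)
    refine hb.trans ?_
    have hvi : v.im ^ 2 ≥ (η * L) ^ 2 := by have := hvim.1; gcongr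
    calc 32 * -(heatLog t v).im / v.im = 32 * (v.im * -(heatLog t v).im) / v.im ^ 2 := by field_simp
      _ ≤ 32 * (K * L * (A * L)) / v.im ^ 2 := by gcongr
      _ ≤ 32 * (K * L * (A * L)) / (η * L) ^ 2 := by gcongr
      _ = _ := by field_simp
  have hmv := (convex_segment (𝕜 := ℝ) w z).norm_image_sub_le_of_norm_hasDerivWithin_le
    (f := heatLog t) (f' := heatLog₁ t) (C := 32 * (K * A / η) / η)
    (fun v hv => (hasDerivAt_heatLog (hgood.ne_zero (hder v hv).2)).hasDerivWithinAt)
    (fun v hv => (hder v hv).1) (left_mem_segment ℝ w z) (right_mem_segment ℝ w z)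
  have hzw : ‖z - w‖ ≤ K * L := by
    have : z - w = ((z.im - K * L : ℝ) : ℂ) * Complex.I := by
      apply Complex.ext <;> simp [hwre, hwim]
    rw [this, norm_mul, Complex.norm_I, mul_one, Complex.norm_real, Real.norm_eq_abs, abs_le]
    constructor <;> linarith
  have hsplit : heatLog t z + Complex.I / 4 * (L : ℝ) = (heatLog t z - heatLog t w)
    + (heatLog t w + Complex.I / 4 * (L : ℝ)) := by ring
  rw [hsplit]
  refine (norm_add_le _ _).trans ?_
  have h4 : 32 * (K * A / η) / η * ‖z - w‖ ≤ 32 * (K * A / η) / η * (K * L) := by gcongr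
  nlinarith

/-- At any height `η log X` near a large point `X`, the logarithmic derivative is
`-(i/4) log X + o(log X)`, uniformly along the heat flow. -/
lemma eventually_norm_heatLog_add_le (T₀ : ℝ) (hT₀ : 0 ≤ T₀) (B : ℝ) {η ε : ℝ} (hη : 0 < η) (hη1 : η ≤ 1)
    (hε : 0 < ε) : ∀ᶠ X in atTop, ∀ t, RealSimpleFrom T₀ t → ∀ x : ℝ, |x - X| ≤ B * logPlus X →
      ‖heatLog t (x + (η * logPlus X : ℝ) * Complex.I) + Complex.I / 4 * (logPlus X : ℝ)‖
        ≤ ε * logPlus X := by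
  obtain ⟨K, C, hK, hC, hKC⟩ := exists_norm_heatLog_add_le T₀ hT₀
  set B' := |B| + 2 * (K + 2) with hB'
  obtain ⟨M, hM, hMX⟩ := exists_norm_heatLog_add_le_mul T₀ hT₀ B' (half_pos hη)
  obtain ⟨δ, hδ, hsmall⟩ := exists_small_on_closedBall (ρ := 1) (r := K + 2 - η) (R := K + 2 - η / 2)
    (M := M) (ε := ε) one_pos (by linarith) (by linarith) (by linarith) hM hε
  filter_upwards [hMX, hKC B', tendsto_logPlus.eventually_ge_atTop (C / δ)] with X h1 h2 h3 t ht x hx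
  set L := logPlus X with hL
  have hL2 : 1 / 2 < L := half_lt_logPlus X
  have hL0 : 0 < L := by linarith
  have hLc : (L : ℂ) ≠ 0 := by exact_mod_cast hL0.ne'
  have hgood := ht.good t ⟨le_rfl, ht.nonpos⟩
  -- rescaling by `log X`: the error is `O(1)` on a large disc and `O(1 / log X)` on the unit disc
  -- about its centre `(K + 2) i`
  set f : ℂ → ℂ := fun ζ => heatLog t (x + L * ζ) / L + Complex.I / 4 with hf
  set a : ℂ := ((K + 2 : ℝ) : ℂ) * Complex.I with ha
  have hfn : ∀ ζ, ‖f ζ‖ = ‖heatLog t (x + L * ζ) + Complex.I / 4 * (L : ℝ)‖ / L := by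
    intro ζ
    have : f ζ = (heatLog t (x + L * ζ) + Complex.I / 4 * (L : ℝ)) / L := by
      simp only [hf]; field_simp
    rw [this, norm_div, Complex.norm_real, Real.norm_of_nonneg hL0.le]
  have hgeom : ∀ ζ, ∀ R' : ℝ, ‖ζ - a‖ ≤ R' → R' ≤ K + 2 → K + 2 - R' ≤ ζ.im ∧ ζ.im ≤ 2 * (K + 2) ∧
      |(x + L * ζ : ℂ).re - X| ≤ B' * L ∧ (x + L * ζ : ℂ).im = L * ζ.im := by
    intro ζ R' hζ hR'
    have h4 := (Complex.abs_im_le_norm (ζ - a)).trans hζ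
    have h5 := (Complex.abs_re_le_norm (ζ - a)).trans hζ
    simp [ha] at h4 h5
    rw [abs_le] at h4
    refine ⟨by linarith [h4.1], by linarith [h4.2], ?_, by simp⟩
    have e : (x + L * ζ : ℂ).re - X = (x - X) + L * ζ.re := by simp; ring
    rw [e]
    refine (abs_add_le _ _).trans ?_
    rw [abs_mul, abs_of_pos hL0]
    have h6 : L * |ζ.re| ≤ L * (2 * (K + 2)) := by gcongr; linarith
    have h7 : B * L ≤ |B| * L := by gcongr; exact le_abs_self B
    rw [hB']; linarith
  have hdiff : DifferentiableOn ℂ f (Metric.ball a (K + 2 - η / 2)) := by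
    intro ζ hζ
    rw [mem_ball_iff_norm] at hζ
    obtain ⟨g1, g2, g3, g4⟩ := hgeom ζ _ hζ.le (by linarith)
    have hpos : 0 < (x + L * ζ : ℂ).im := by rw [g4]; exact mul_pos hL0 (by linarith)
    have hd := (hasDerivAt_heatLog (hgood.ne_zero hpos)).differentiableAt
    have : DifferentiableAt ℂ (fun ζ : ℂ => heatLog t (x + L * ζ)) ζ :=
      hd.comp (f := fun ζ : ℂ => (x : ℂ) + L * ζ) ζ (by fun_prop)
    exact ((this.div_const _).add_const _).differentiableWithinAt
  have hB'L : ∀ q, q ≤ 2 * (K + 2) → L * q ≤ B' * L := fun q hq => by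
    have : q ≤ B' := by rw [hB']; linarith [abs_nonneg B]
    nlinarith
  have hres := hsmall f a hdiff (fun ζ hζ => by
      rw [mem_ball_iff_norm] at hζ
      obtain ⟨g1, g2, g3, g4⟩ := hgeom ζ _ hζ.le (by linarith)
      rw [hfn, div_le_iff₀ hL0]
      exact h1 t ht _ g3 (by rw [g4]; nlinarith) (by rw [g4]; exact hB'L _ g2))
    (fun ζ hζ => by
      rw [mem_closedBall_iff_norm] at hζ
      obtain ⟨g1, g2, g3, g4⟩ := hgeom ζ _ hζ (by linarith)
      rw [hfn, div_le_iff₀ hL0]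
      refine (h2 t ht _ g3 (by rw [g4]; nlinarith) (by rw [g4]; exact hB'L _ g2)).trans ?_
      rwa [div_le_iff₀' hδ] at h3)
    ((η : ℂ) * Complex.I) (by
      rw [mem_closedBall_iff_norm, ha, ← sub_mul, norm_mul, Complex.norm_I, mul_one, ← Complex.ofReal_sub,
        Complex.norm_real, Real.norm_eq_abs, abs_le]
      constructor <;> linarith)
  rw [hfn, div_le_iff₀ hL0] at hres
  have e : (x : ℂ) + (η * L : ℝ) * Complex.I = x + L * (η * Complex.I) := by push_cast; ring
  rw [e]; exact hres

/-- Zeros are equidistributed, with density `log X / 4π`, at the scale `log X` around a large point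
`X`, uniformly along the heat flow. -/
lemma eventually_abs_zeroCount_sub_le (T₀ : ℝ) (hT₀ : 0 ≤ T₀) {B ε : ℝ} (hB : 0 < B) (hε : 0 < ε) :
    ∀ᶠ X in atTop, ∀ t, RealSimpleFrom T₀ t → ∀ T₁ T₂ : ℝ, |T₁ - X| ≤ B * logPlus X →
      |T₂ - X| ≤ B * logPlus X →
      |(zeroCount (heatInt 0 t) T₂ : ℝ) - zeroCount (heatInt 0 t) T₁ - (T₂ - T₁) * logPlus X / (4 * π)|
        ≤ ε * logPlus X ^ 2 := by
  -- `ε'` controls the integral over a segment of length `2 B log X`, and `η` the counting error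
  -- `5 y (-Im u)` at the height `y = η log X`
  set ε' := min (1 / 4) (ε / (4 * B)) with hε'
  have hε'0 : 0 < ε' := lt_min (by norm_num) (by positivity)
  have hε'1 : ε' ≤ 1 / 4 := min_le_left _ _
  have hε'2 : B * ε' ≤ ε / 4 := by
    have : ε' ≤ ε / (4 * B) := min_le_right _ _
    rw [le_div_iff₀ (by positivity)] at this; linarith
  set η := min 1 (ε / 16) with hη
  have hη0 : 0 < η := lt_min one_pos (by positivity)
  have hη1 : η ≤ 1 := min_le_left _ _
  have hη2 : η ≤ ε / 16 := min_le_right _ _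
  filter_upwards [eventually_norm_heatLog_add_le T₀ hT₀ B hη0 hη1 hε'0, eventually_mul_logPlus_le B,
    eventually_ge_atTop 2] with X hX hXB hX2 t ht T₁ T₂ h1 h2
  set L := logPlus X with hL
  have hL2 : 1 / 2 < L := half_lt_logPlus X
  have hL0 : 0 < L := by linarith
  have hgood := ht.good t ⟨le_rfl, ht.nonpos⟩
  set y := η * L with hy
  have hy0 : 0 < y := by positivity
  have hu : ∀ x : ℝ, |x - X| ≤ B * L → |-(heatLog t (x + y * Complex.I)).im - L / 4| ≤ ε' * L ∧
      |(heatLog t (x + y * Complex.I)).re| ≤ ε' * L := by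
    intro x hx
    have h3 := hX t ht x hx
    have him := (Complex.abs_im_le_norm _).trans h3
    have hre := (Complex.abs_re_le_norm _).trans h3
    have e1 : (Complex.I / 4 * ((L : ℝ) : ℂ)).im = L / 4 := by
      rw [Complex.im_mul_ofReal]; simp; ring
    have e2 : (Complex.I / 4 * ((L : ℝ) : ℂ)).re = 0 := by
      rw [Complex.re_mul_ofReal]; simp
    rw [Complex.add_im, e1] at him
    rw [Complex.add_re, e2, add_zero] at hre
    exact ⟨by rwa [← abs_neg, neg_sub, sub_neg_eq_add, add_comm], hre⟩
  have c1 := SimpleRealZeroEven.abs_zeroCount_sub_le hgood (T := T₁) (by linarith [(abs_le.1 h1).1]) hy0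
  have c2 := SimpleRealZeroEven.abs_zeroCount_sub_le hgood (T := T₂) (by linarith [(abs_le.1 h2).1]) hy0
  rw [logDeriv_heatInt] at c1 c2
  have hcont : Continuous fun x : ℝ => -(heatLog t (x + y * Complex.I)).im := by
    refine (Complex.continuous_im.comp ?_).neg
    exact ((differentiable_heatInt 1 t).continuous.comp (by fun_prop)).div
      ((differentiable_heatInt 0 t).continuous.comp (by fun_prop)) fun x =>
      hgood.ne_zero (by simpa using hy0)
  have hint : |(∫ x in T₁..T₂, -(heatLog t (x + y * Complex.I)).im) - (T₂ - T₁) * (L / 4)|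
      ≤ ε' * L * (2 * B * L) := by
    have e : (∫ x in T₁..T₂, -(heatLog t (x + y * Complex.I)).im) - (T₂ - T₁) * (L / 4)
        = ∫ x in T₁..T₂, (-(heatLog t (x + y * Complex.I)).im - L / 4) := by
      rw [intervalIntegral.integral_sub (hcont.intervalIntegrable _ _) intervalIntegrable_const,
        intervalIntegral.integral_const, smul_eq_mul]
    rw [e, ← Real.norm_eq_abs]
    refine (intervalIntegral.norm_integral_le_of_norm_le_const (C := ε' * L) fun x hx => ?_).trans ?_
    · have hx' := uIoc_subset_uIcc hx
      refine (hu x ?_).1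
      have : x ∈ Icc (X - B * L) (X + B * L) := by
        have ha : T₁ ∈ Icc (X - B * L) (X + B * L) := by
          rw [abs_le] at h1; exact ⟨by linarith [h1.1], by linarith [h1.2]⟩
        have hb : T₂ ∈ Icc (X - B * L) (X + B * L) := by
          rw [abs_le] at h2; exact ⟨by linarith [h2.1], by linarith [h2.2]⟩
        exact ordConnected_Icc.uIcc_subset ha hb hx'
      rw [abs_le]; exact ⟨by linarith [this.1], by linarith [this.2]⟩
    · gcongr
      have e2 : T₂ - T₁ = (T₂ - X) - (T₁ - X) := by ring
      rw [e2]
      refine (abs_sub _ _).trans ?_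
      linarith
  rw [← intervalIntegral.integral_interval_sub_left (a := 0) (hcont.intervalIntegrable _ _)
    (hcont.intervalIntegrable _ _)] at hint
  obtain ⟨p1, r1⟩ := hu T₁ h1
  obtain ⟨p2, r2⟩ := hu T₂ h2
  have ey : ∀ T : ℝ, |T - X| ≤ B * L → |y * (heatLog t (T + y * Complex.I)).re| ≤ η * L ^ 2 / 4 ∧
      5 * y * -(heatLog t (T + y * Complex.I)).im ≤ 5 / 2 * η * L ^ 2 := by
    intro T hT
    obtain ⟨p, r⟩ := hu T hT
    have hεL : ε' * L ≤ L / 4 := by nlinarith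
    constructor
    · rw [abs_mul, abs_of_pos hy0]
      calc y * |(heatLog t (T + y * Complex.I)).re| ≤ y * (L / 4) := by gcongr; linarith
        _ = _ := by rw [hy]; ring
    · have : -(heatLog t (T + y * Complex.I)).im ≤ L / 2 := by linarith [(abs_le.1 p).2]
      calc 5 * y * -(heatLog t (T + y * Complex.I)).im ≤ 5 * y * (L / 2) := by gcongr
        _ = _ := by rw [hy]; ring
  have q1 := ey T₁ h1
  have q2 := ey T₂ h2
  have hηL : η * L ^ 2 ≤ ε / 16 * L ^ 2 := by gcongr
  have hεL : ε' * L * (2 * B * L) ≤ ε / 2 * L ^ 2 := by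
    have : B * ε' * L ^ 2 ≤ ε / 4 * L ^ 2 := by gcongr
    nlinarith
  set N₁ : ℝ := (zeroCount (heatInt 0 t) T₁ : ℝ)
  set N₂ : ℝ := (zeroCount (heatInt 0 t) T₂ : ℝ)
  have hfin : |π * (N₂ - N₁ - (T₂ - T₁) * L / (4 * π))| ≤ ε * L ^ 2 := by
    have e : π * (N₂ - N₁ - (T₂ - T₁) * L / (4 * π)) = π * N₂ - π * N₁ - (T₂ - T₁) * (L / 4) := by
      have := pi_ne_zero
      field_simp
    rw [e]
    have a1 := abs_le.1 c1
    have a2 := abs_le.1 c2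
    have a3 := abs_le.1 hint
    have a4 := abs_le.1 q1.1
    have a5 := abs_le.1 q2.1
    rw [abs_le]
    constructor <;> linarith [a1.1, a1.2, a2.1, a2.2, a3.1, a3.2, a4.1, a4.2, a5.1, a5.2, q1.2, q2.2]
  rw [abs_mul, abs_of_pos pi_pos] at hfin
  have := abs_nonneg (N₂ - N₁ - (T₂ - T₁) * L / (4 * π))
  nlinarith [pi_gt_three]

/-! ### Classical locations -/

/-- A constant `c` with `c ξ_n log ξ_n ≤ n` for all `n ≥ 1`. -/
def densityConst : ℝ := 1 / (120 * π)

lemma densityConst_pos : 0 < densityConst := by unfold densityConst; positivity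

/-- `Ψ(s) / s` is nondecreasing. -/
lemma Psi_mul_le {a b : ℝ} (ha : 0 < a) (hab : a ≤ b) : Psi a * b ≤ Psi b * a := by
  have hb : 0 < b := by linarith
  have h := Real.log_le_log (show 0 < a / (4 * π) by positivity)
    (show a / (4 * π) ≤ b / (4 * π) by gcongr)
  unfold Psi
  have e : b / (4 * π) * log (b / (4 * π)) * a - a / (4 * π) * log (a / (4 * π)) * b
      = a * b / (4 * π) * (log (b / (4 * π)) - log (a / (4 * π))) := by ring
  have : 0 ≤ a * b / (4 * π) * (log (b / (4 * π)) - log (a / (4 * π))) :=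
    mul_nonneg (by positivity) (sub_nonneg.2 h)
  have e2 : b / (4 * π) * a = a / (4 * π) * b := by ring
  nlinarith

lemma classicalLocationNat_spec (n : ℕ) :
    1 < classicalLocationNat n ∧ Psi (classicalLocationNat n) = n :=
  (existsUnique_Psi (n : ℝ) (Nat.cast_nonneg n)).choose_spec.1

lemma logPlus_le_two_mul {x : ℝ} (hx : 1 ≤ x) : logPlus x ≤ 2 * x := by
  rw [logPlus_nonneg_eq (by linarith)]
  have := Real.log_le_sub_one_of_pos (show 0 < 2 + x by linarith)
  linarith

lemma logPlus_mul_le {x y c : ℝ} (hx : 0 ≤ x) (hy : 0 ≤ y) (hc : 1 ≤ c) (h : 2 + y ≤ c * (2 + x)) :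
    logPlus y ≤ (1 + 2 * log c) * logPlus x := by
  rw [logPlus_nonneg_eq hy]
  have h1 := Real.log_le_log (by linarith) h
  rw [Real.log_mul (by linarith) (by linarith), ← logPlus_nonneg_eq hx] at h1
  have h2 := half_lt_logPlus x
  have h3 := Real.log_nonneg hc
  nlinarith

lemma logPlus_mono {x y : ℝ} (hx : 0 ≤ x) (hxy : x ≤ y) : logPlus x ≤ logPlus y := by
  rw [logPlus_nonneg_eq hx, logPlus_nonneg_eq (hx.trans hxy)]
  exact Real.log_le_log (by linarith) (by linarith)

/-- `j / log ξ_j` is comparable to `ξ_j`. -/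
lemma classicalLocationNat_bounds {n : ℕ} (hn : 1 ≤ n) :
    densityConst * logPlus (classicalLocationNat n) * classicalLocationNat n ≤ n ∧
    (n : ℝ) ≤ classicalLocationNat n * logPlus (classicalLocationNat n) := by
  obtain ⟨h1, hPsi⟩ := classicalLocationNat_spec n
  set ξ := classicalLocationNat n with hξ
  have hn' : (1 : ℝ) ≤ n := by exact_mod_cast hn
  have hpi3 := pi_gt_three
  have hpi4 := pi_lt_four
  set ℓ := log (ξ / (4 * π)) with hℓ
  have hξ0 : 0 < ξ := by linarith
  have hPsi' : ξ / (4 * π) * (ℓ - 1) = n := by rw [← hPsi, Psi, hℓ]; ring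
  have hexp : ξ / (4 * π) = exp ℓ := by rw [hℓ, Real.exp_log (by positivity)]
  have hℓ1 : 6 / 5 ≤ ℓ := by
    by_contra hcon
    push Not at hcon
    have h2 : exp ℓ ≤ 4 := by
      have h3 : exp ℓ ≤ exp (6 / 5) := exp_le_exp.2 hcon.le
      have h4 : exp (6 / 5 : ℝ) ≤ 4 := by
        have e : (6 / 5 : ℝ) = 1 + 1 / 5 := by norm_num
        rw [e, Real.exp_add]
        have a1 := Real.exp_one_lt_d9
        have a2 : exp (1 / 5 : ℝ) ≤ 5 / 4 := by
          have := Real.exp_bound_div_one_sub_of_interval (x := 1 / 5) (by norm_num) (by norm_num)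
          linarith
        nlinarith [exp_pos (1 / 5 : ℝ)]
      linarith
    rw [hexp] at hPsi'
    nlinarith [exp_pos ℓ]
  have hL : logPlus ξ = log (2 + ξ) := logPlus_nonneg_eq hξ0.le
  have hL5 : logPlus ξ ≤ 5 * ℓ := by
    have h2 : logPlus ξ ≤ log 32 + ℓ := by
      rw [hL, hℓ, ← Real.log_mul (by norm_num) (by positivity)]
      refine Real.log_le_log (by linarith) ?_
      rw [mul_div_assoc', le_div_iff₀ (by positivity)]
      have : 0 ≤ ξ - 1 := by linarith
      have h5 : 4 * π ≤ ξ := by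
        have h6 : 1 ≤ ξ / (4 * π) := by rw [hexp]; exact Real.one_le_exp (by linarith)
        rwa [one_le_div (by positivity)] at h6
      nlinarith
    have h3 : log 32 ≤ 4 := by
      have : log (32 : ℝ) = 5 * log 2 := by
        rw [show (32 : ℝ) = 2 ^ 5 by norm_num, Real.log_pow]; norm_num
      rw [this]; linarith [Real.log_two_lt_d9]
    linarith
  have hLℓ : ℓ ≤ logPlus ξ := by
    rw [hL, hℓ]
    refine Real.log_le_log (by positivity) ?_
    rw [div_le_iff₀ (by positivity)]; nlinarith
  constructor
  · rw [← hPsi', densityConst]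
    have : logPlus ξ ≤ 30 * (ℓ - 1) := by linarith
    calc 1 / (120 * π) * logPlus ξ * ξ ≤ 1 / (120 * π) * (30 * (ℓ - 1)) * ξ := by gcongr
      _ = ξ / (4 * π) * (ℓ - 1) := by field_simp; ring
  · rw [← hPsi']
    have h2 : ξ / (4 * π) ≤ ξ := div_le_self hξ0.le (by linarith)
    have : ℓ - 1 ≤ logPlus ξ := by linarith
    have h0 : 0 ≤ ℓ - 1 := by linarith
    gcongr

lemma classicalLocationNat_le {n : ℕ} (hn : 1 ≤ n) :
    classicalLocationNat n ≤ 2 / densityConst * n := by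
  have h := (classicalLocationNat_bounds hn).1
  have h1 := (classicalLocationNat_spec n).1
  have h2 := half_lt_logPlus (classicalLocationNat n)
  have hc := densityConst_pos
  rw [div_mul_eq_mul_div, le_div_iff₀ hc]
  have : densityConst * (1 / 2) * classicalLocationNat n
      ≤ densityConst * logPlus (classicalLocationNat n) * classicalLocationNat n := by gcongr
  linarith

lemma le_two_mul_classicalLocationNat_sq {n : ℕ} (hn : 1 ≤ n) :
    (n : ℝ) ≤ 2 * classicalLocationNat n ^ 2 := by
  have h := (classicalLocationNat_bounds hn).2
  have h1 := (classicalLocationNat_spec n).1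
  have := logPlus_le_two_mul h1.le
  nlinarith

lemma tendsto_classicalLocationNat : Tendsto classicalLocationNat atTop atTop := by
  rw [tendsto_atTop]
  intro b
  have h1 : Tendsto (fun n : ℕ => (n : ℝ)) atTop atTop := tendsto_natCast_atTop_atTop
  filter_upwards [h1.eventually_gt_atTop (2 * b ^ 2), eventually_ge_atTop 1] with n hn hn1
  by_contra hcon
  push Not at hcon
  have h2 := le_two_mul_classicalLocationNat_sq hn1
  have h3 := (classicalLocationNat_spec n).1
  nlinarith

/-- Consecutive blocks of `log² ξ_j` classical locations have length `O(log ξ_j)`. -/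
lemma classicalLocationNat_sub_le {j k : ℕ} (hj : 1 ≤ j) (hjk : j < k)
    (hk : (k : ℝ) ≤ j + logPlus (classicalLocationNat j) ^ 2) :
    classicalLocationNat j ≤ classicalLocationNat k ∧ classicalLocationNat k
      ≤ classicalLocationNat j + 1 / densityConst * logPlus (classicalLocationNat j) := by
  obtain ⟨h1, hPj⟩ := classicalLocationNat_spec j
  obtain ⟨h2, hPk⟩ := classicalLocationNat_spec k
  have hb := (classicalLocationNat_bounds hj).1
  set ξ := classicalLocationNat j
  set ζ := classicalLocationNat k
  have hjk' : (j : ℝ) < k := by exact_mod_cast hjk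
  have hj0 : (1 : ℝ) ≤ j := by exact_mod_cast hj
  have hle : ξ ≤ ζ := by
    by_contra hcon
    push Not at hcon
    have := Psi_mul_le (by linarith) hcon.le
    rw [hPj, hPk] at this
    nlinarith
  refine ⟨hle, ?_⟩
  have h3 := Psi_mul_le (by linarith) hle
  rw [hPj, hPk] at h3
  have hL := half_lt_logPlus ξ
  set L := logPlus ξ
  have hc := densityConst_pos
  have h4 : (ζ - ξ) * j ≤ L ^ 2 * ξ := by nlinarith
  have h5 : (ζ - ξ) * (densityConst * L * ξ) ≤ L ^ 2 * ξ :=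
    (mul_le_mul_of_nonneg_left hb (by linarith)).trans h4
  have h6 : (ζ - ξ) * densityConst ≤ L := by
    have : 0 < L * ξ := by positivity
    refine le_of_mul_le_mul_right ?_ this
    linarith
  rw [← le_div_iff₀ hc] at h6
  have : L / densityConst = 1 / densityConst * L := by ring
  linarith

/-- A counting function within `O(log²)` of `Ψ` reaches the value `n` within `O(log ξ_n)` of
`ξ_n`. -/
lemma exists_count_classicalLocationNat (C : ℝ) (hC : 0 < C) : ∃ D : ℝ, 0 < D ∧
    ∀ N : ℝ → ℕ, (∀ T, 0 < T → |(N T : ℝ) - Psi T| ≤ C * logPlus T ^ 2) → ∀ n : ℕ, 1 ≤ n →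
      n ≤ N (classicalLocationNat n + D * logPlus (classicalLocationNat n)) ∧
      (0 < classicalLocationNat n - D * logPlus (classicalLocationNat n) →
        N (classicalLocationNat n - D * logPlus (classicalLocationNat n)) < n) := by
  have hc := densityConst_pos
  obtain ⟨D, hD⟩ : ∃ D : ℝ, 1 ≤ D ∧ C * (1 + 2 * log (1 + D)) ^ 2 < densityConst * D := by
    have h1 : Tendsto (fun D : ℝ => log (1 + D) ^ 2 / (1 * (1 + D) + 0)) atTop (𝓝 0) :=
      (Real.tendsto_pow_log_div_mul_add_atTop 1 0 2 one_ne_zero).comp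
        (tendsto_atTop_add_const_left atTop 1 tendsto_id)
    have h2 := h1.eventually (Iio_mem_nhds (show (0 : ℝ) < densityConst / (32 * C) by positivity))
    have h3 := (eventually_ge_atTop (exp 1)).and (eventually_gt_atTop (0 : ℝ))
    obtain ⟨D, h4, h5, h6⟩ := (h2.and h3).exists
    have hD1 : 1 ≤ D := (Real.one_le_exp zero_le_one).trans h5
    refine ⟨D, hD1, ?_⟩
    have h7 : 1 ≤ log (1 + D) := by
      rw [Real.le_log_iff_exp_le (by linarith)]; linarith
    rw [one_mul, add_zero, div_lt_div_iff₀ (by linarith) (by positivity)] at h4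
    have h8 : (1 + 2 * log (1 + D)) ^ 2 ≤ 9 * log (1 + D) ^ 2 := by nlinarith
    have h9 : C * (1 + 2 * log (1 + D)) ^ 2 ≤ C * (9 * log (1 + D) ^ 2) := by gcongr
    nlinarith
  obtain ⟨hD1, hD⟩ := hD
  refine ⟨D, by linarith, fun N hN n hn => ?_⟩
  obtain ⟨h1, hP⟩ := classicalLocationNat_spec n
  have hb := (classicalLocationNat_bounds hn).1
  set ξ := classicalLocationNat n
  have hL := half_lt_logPlus ξ
  set L := logPlus ξ with hLdef
  have hξ0 : 0 < ξ := by linarith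
  have hLD : 0 < D * L := by positivity
  have hbig : C * (1 + 2 * log (1 + D)) ^ 2 * L ^ 2 < densityConst * D * L ^ 2 := by gcongr
  have hlogD : 0 ≤ log (1 + D) := Real.log_nonneg (by linarith)
  have hC1 : C * L ^ 2 ≤ C * (1 + 2 * log (1 + D)) ^ 2 * L ^ 2 := by
    have : 1 ≤ (1 + 2 * log (1 + D)) ^ 2 := by nlinarith
    gcongr
    nlinarith
  constructor
  · have hT0 : 0 < ξ + D * L := by linarith
    have hT := abs_le.1 (hN _ hT0)
    have hm := Psi_mul_le hξ0 (by linarith : ξ ≤ ξ + D * L)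
    rw [hP] at hm
    have hLle : L ≤ 2 + ξ := by
      rw [hLdef, logPlus_nonneg_eq hξ0.le]; exact Real.log_le_self (by linarith)
    have hmul : logPlus (ξ + D * L) ≤ (1 + 2 * log (1 + D)) * L :=
      logPlus_mul_le hξ0.le hT0.le (by linarith) (by nlinarith)
    have hpos := half_lt_logPlus (ξ + D * L)
    have hsq : C * logPlus (ξ + D * L) ^ 2 ≤ C * (1 + 2 * log (1 + D)) ^ 2 * L ^ 2 := by
      calc C * logPlus (ξ + D * L) ^ 2 ≤ C * ((1 + 2 * log (1 + D)) * L) ^ 2 := by gcongr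
        _ = _ := by ring
    have h3 : n + densityConst * D * L ^ 2 ≤ Psi (ξ + D * L) := by
      have : D * L * (densityConst * L * ξ) ≤ D * L * n := by gcongr
      refine le_of_mul_le_mul_right ?_ hξ0
      nlinarith
    have h4 : (n : ℝ) ≤ N (ξ + D * L) := by linarith [hT.1]
    exact_mod_cast h4
  · intro h0
    have hT := abs_le.1 (hN _ h0)
    have hm := Psi_mul_le h0 (by linarith : ξ - D * L ≤ ξ)
    rw [hP] at hm
    have hmono : logPlus (ξ - D * L) ≤ L := logPlus_mono h0.le (by linarith)
    have hpos := half_lt_logPlus (ξ - D * L)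
    have hsq : C * logPlus (ξ - D * L) ^ 2 ≤ C * L ^ 2 := by gcongr
    have h3 : Psi (ξ - D * L) ≤ n - densityConst * D * L ^ 2 := by
      have : D * L * (densityConst * L * ξ) ≤ D * L * n := by gcongr
      refine le_of_mul_le_mul_right ?_ hξ0
      nlinarith
    have h4 : (N (ξ - D * L) : ℝ) < n := by linarith [hT.2]
    exact_mod_cast h4

/-! ### Enumeration of the zeros -/

lemma zeroCount_mono {f : ℂ → ℂ} (hf : SimpleRealZeroEven f) {a b : ℝ} (hab : a ≤ b) :
    zeroCount f a ≤ zeroCount f b :=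
  ncard_le_ncard (inter_subset_inter_right _ (Iic_subset_Iic.2 hab)) (hf.finite_zeros b)

lemma H_eq_heatInt_zero (t : ℝ) : H t = heatInt 0 t := funext fun z => H_eq_heatInt t z

/-- The next zero after a point `a ≥ 0`, as an infimum, is attained. -/
lemma exists_next_zero {f : ℂ → ℂ} (hf : SimpleRealZeroEven f) (hinf : ∀ n, ∃ T, n ≤ zeroCount f T)
    {a : ℝ} (ha : 0 ≤ a) : IsLeast {y : ℝ | a < y ∧ f y = 0} (sInf {y : ℝ | a < y ∧ f y = 0}) := by
  have hne : {y : ℝ | a < y ∧ f y = 0}.Nonempty := by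
    by_contra hcon
    rw [not_nonempty_iff_eq_empty] at hcon
    obtain ⟨T, hT⟩ := hinf (zeroCount f a + 1)
    have : zeroCount f T ≤ zeroCount f a := by
      refine ncard_le_ncard (fun y hy => ⟨hy.1, ?_⟩) (hf.finite_zeros a)
      by_contra hya
      have : y ∈ {y : ℝ | a < y ∧ f y = 0} := ⟨not_le.1 hya, hy.1.2⟩
      rw [hcon] at this
      exact this
    omega
  obtain ⟨b, hb⟩ := hne
  have hfin : ({y : ℝ | a < y ∧ f y = 0} ∩ Iic b).Finite :=
    (hf.finite_zeros b).subset fun y hy => ⟨⟨ha.trans_lt hy.1.1, hy.1.2⟩, hy.2⟩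
  obtain ⟨m, hm, hmin⟩ := hfin.exists_minimalFor id _ ⟨b, hb, self_mem_Iic⟩
  have hleast : IsLeast {y : ℝ | a < y ∧ f y = 0} m := by
    refine ⟨hm.1, fun y hy => ?_⟩
    by_contra hcon
    push Not at hcon
    have := hmin (j := y) ⟨hy, hcon.le.trans hm.2⟩ hcon.le
    exact absurd this (not_le.2 hcon)
  rwa [hleast.csInf_eq]

section Enumeration

variable {t : ℝ}

lemma posZero_nonneg (hf : RealSimpleAt t) (hinf : ∀ n, ∃ T, n ≤ zeroCount (heatInt 0 t) T) (n : ℕ) :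
    0 ≤ posZero t n := by
  induction n with
  | zero => exact le_rfl
  | succ n ih =>
    have := (exists_next_zero hf hinf ih).1.1
    rw [← H_eq_heatInt_zero] at this
    exact ih.trans this.le

lemma posZero_succ_isLeast (hf : RealSimpleAt t) (hinf : ∀ n, ∃ T, n ≤ zeroCount (heatInt 0 t) T)
    (n : ℕ) : IsLeast {y : ℝ | posZero t n < y ∧ heatInt 0 t y = 0} (posZero t (n + 1)) := by
  have := exists_next_zero hf hinf (posZero_nonneg hf hinf n)
  rwa [← H_eq_heatInt_zero] at this ⊢

lemma strictMono_posZero (hf : RealSimpleAt t) (hinf : ∀ n, ∃ T, n ≤ zeroCount (heatInt 0 t) T) :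
    StrictMono (posZero t) :=
  strictMono_nat_of_lt_succ fun n => (posZero_succ_isLeast hf hinf n).1.1

lemma zeroCount_posZero (hf : RealSimpleAt t) (hinf : ∀ n, ∃ T, n ≤ zeroCount (heatInt 0 t) T)
    (n : ℕ) : zeroCount (heatInt 0 t) (posZero t n) = n := by
  induction n with
  | zero =>
    have : posZeros (heatInt 0 t) ∩ Iic (posZero t 0) = ∅ := by
      ext y
      simp only [mem_inter_iff, mem_Iic, mem_empty_iff_false, iff_false, not_and, not_le]
      exact fun hy => hy.1
    rw [zeroCount, this, ncard_empty]
  | succ n ih =>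
    have hl := posZero_succ_isLeast hf hinf n
    have : posZeros (heatInt 0 t) ∩ Iic (posZero t (n + 1))
        = insert (posZero t (n + 1)) (posZeros (heatInt 0 t) ∩ Iic (posZero t n)) := by
      ext y
      constructor
      · rintro ⟨hy, hy2⟩
        rcases le_or_gt y (posZero t n) with h | h
        · exact Or.inr ⟨hy, h⟩
        · exact Or.inl (le_antisymm hy2 (hl.2 ⟨h, hy.2⟩))
      · rintro (rfl | ⟨hy, hy2⟩)
        · exact ⟨⟨(posZero_nonneg hf hinf n).trans_lt hl.1.1, hl.1.2⟩, self_mem_Iic⟩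
        · exact ⟨hy, le_trans hy2 hl.1.1.le⟩
    rw [zeroCount, this, ncard_insert_of_notMem (fun h => absurd h.2 (not_le.2 hl.1.1))
      (hf.finite_zeros _)]
    exact congrArg (· + 1) ih

lemma posZero_le_of_le_zeroCount (hf : RealSimpleAt t)
    (hinf : ∀ n, ∃ T, n ≤ zeroCount (heatInt 0 t) T) {n : ℕ} {T : ℝ} (hT : 0 ≤ T)
    (h : n ≤ zeroCount (heatInt 0 t) T) : posZero t n ≤ T := by
  rcases n with _ | n
  · exact hT
  by_contra hcon
  push Not at hcon
  have hsub : posZeros (heatInt 0 t) ∩ Iic T ⊆ posZeros (heatInt 0 t) ∩ Iic (posZero t n) := by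
    rintro y ⟨hy, hy2⟩
    refine ⟨hy, ?_⟩
    by_contra hyn
    exact absurd ((posZero_succ_isLeast hf hinf n).2 ⟨not_le.1 hyn, hy.2⟩)
      (not_le.2 (lt_of_le_of_lt hy2 hcon))
  have := ncard_le_ncard hsub (hf.finite_zeros _)
  have h2 := zeroCount_posZero hf hinf n
  unfold zeroCount at h h2
  omega

lemma le_posZero_of_zeroCount_lt (hf : RealSimpleAt t)
    (hinf : ∀ n, ∃ T, n ≤ zeroCount (heatInt 0 t) T) {n : ℕ} {T : ℝ}
    (h : zeroCount (heatInt 0 t) T < n) : T ≤ posZero t n := by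
  by_contra hcon
  push Not at hcon
  have := zeroCount_mono hf hcon.le
  rw [zeroCount_posZero hf hinf] at this
  omega

lemma exists_posZero_eq (hf : RealSimpleAt t) (hinf : ∀ n, ∃ T, n ≤ zeroCount (heatInt 0 t) T)
    {ρ : ℝ} (hρ : ρ ∈ posZeros (heatInt 0 t)) : ∃ n, ρ = posZero t (n + 1) := by
  have hex : ∃ n, ρ ≤ posZero t n := by
    by_contra hcon
    push Not at hcon
    have h1 := zeroCount_mono hf (hcon (zeroCount (heatInt 0 t) ρ + 1)).le
    rw [zeroCount_posZero hf hinf] at h1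
    omega
  classical
  obtain ⟨n, hn, hmin⟩ : ∃ n, ρ ≤ posZero t n ∧ ∀ m < n, ¬ρ ≤ posZero t m :=
    ⟨Nat.find hex, Nat.find_spec hex, fun m hm => Nat.find_min hex hm⟩
  rcases n with _ | n
  · exact absurd hρ.1 (not_lt.2 hn)
  · exact ⟨n, le_antisymm hn ((posZero_succ_isLeast hf hinf n).2
      ⟨not_le.1 (hmin n (Nat.lt_succ_self n)), hρ.2⟩)⟩

lemma zeroAt_natCast {n : ℕ} (hn : 1 ≤ n) : zeroAt t n = posZero t n := by
  unfold zeroAt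
  rw [Int.sign_eq_one_of_pos (by omega)]
  simp

lemma zeroAt_neg (j : ℤ) : zeroAt t (-j) = -zeroAt t j := by
  unfold zeroAt
  simp

lemma isZeroEnumeration_zeroAt (hf : RealSimpleAt t)
    (hinf : ∀ n, ∃ T, n ≤ zeroCount (heatInt 0 t) T) : IsZeroEnumeration (H t) (zeroAt t) := by
  have hmono := strictMono_posZero hf hinf
  have hzero : ∀ n : ℕ, heatInt 0 t (posZero t (n + 1) : ℝ) = 0 := fun n =>
    (posZero_succ_isLeast hf hinf n).1.2
  have hzj : ∀ j : ℤ, j ≠ 0 → heatInt 0 t (zeroAt t j : ℝ) = 0 := by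
    intro j hj
    obtain ⟨n, hn⟩ : ∃ n : ℕ, j.natAbs = n + 1 := ⟨j.natAbs - 1, by omega⟩
    rcases Int.natAbs_eq j with h | h
    · rw [h, zeroAt_natCast (by omega), hn]; exact hzero n
    · rw [h, zeroAt_neg, zeroAt_natCast (by omega), hn]
      push_cast
      rw [heatInt_zero_neg]; exact hzero n
  refine ⟨?_, ?_, fun j _ => zeroAt_neg j, ?_, ?_⟩
  · have h := zeroAt_natCast (t := t) (n := 1) le_rfl
    rw [Nat.cast_one] at h
    rw [h]
    exact hmono one_pos
  · intro j k hj hjk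
    lift j to ℕ using by omega
    lift k to ℕ using by omega
    rw [zeroAt_natCast (by omega), zeroAt_natCast (by omega)]
    exact hmono (by exact_mod_cast hjk)
  · intro z
    rw [H_eq_heatInt_zero]
    refine ⟨fun hz => ?_, fun ⟨j, hj, hz⟩ => by rw [hz]; exact hzj j hj⟩
    have him := hf.real z hz
    obtain ⟨x, rfl⟩ : ∃ x : ℝ, z = x := ⟨z.re, by apply Complex.ext <;> simp [him]⟩
    rcases lt_trichotomy x 0 with h | h | h
    · obtain ⟨n, hn⟩ := exists_posZero_eq hf hinf (ρ := -x) ⟨by linarith, by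
        push_cast; rw [heatInt_zero_neg]; exact hz⟩
      refine ⟨-((n + 1 : ℕ) : ℤ), by omega, ?_⟩
      rw [zeroAt_neg, zeroAt_natCast (by omega), ← hn]; simp
    · rw [h] at hz
      exact absurd hz (by simpa using hf.zero_ne)
    · obtain ⟨n, hn⟩ := exists_posZero_eq hf hinf (ρ := x) ⟨h, hz⟩
      exact ⟨((n + 1 : ℕ) : ℤ), by omega, by rw [zeroAt_natCast (by omega), ← hn]⟩
  · intro j hj
    rw [H_eq_heatInt_zero]
    exact hf.simple _ (hzj j hj)

end Enumeration

/-- The positive zeros stay away from the origin, uniformly along the heat flow. -/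
lemma exists_lt_zero_of_heatInt_eq_zero (T₀ : ℝ) : ∃ c : ℝ, 0 < c ∧ ∀ t ∈ Icc (-T₀) 0, ∀ x : ℝ, 0 < x →
    heatInt 0 t x = 0 → c ≤ x := by
  have hcont : Continuous fun p : ℝ × ℝ => heatInt 0 p.1 p.2 :=
    (continuous_heatInt 0).comp (f := fun p : ℝ × ℝ => ((p.1 : ℂ), (p.2 : ℂ))) (by fun_prop)
  have hUo : IsOpen {p : ℝ × ℝ | heatInt 0 p.1 p.2 ≠ 0} := isOpen_compl_singleton.preimage hcont
  obtain ⟨V, W, -, hW, hV1, hW1, hVW⟩ := generalized_tube_lemma (isCompact_Icc (a := -T₀) (b := 0))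
    (isCompact_singleton (x := (0 : ℝ))) hUo (by
      rintro ⟨s, x⟩ ⟨-, hx⟩
      rw [mem_singleton_iff] at hx
      rw [mem_ofPred_eq, hx]
      simpa using heatInt_zero_ne s)
  obtain ⟨c, hc, hball⟩ := Metric.isOpen_iff.1 hW 0 (hW1 (mem_singleton _))
  refine ⟨c, hc, fun t ht x hx h => ?_⟩
  by_contra hcon
  push Not at hcon
  have hxW : x ∈ W := hball (by rw [mem_ball_zero_iff, Real.norm_of_nonneg hx.le]; exact hcon)
  exact hVW (mk_mem_prod (hV1 ht) hxW) h

lemma RealSimpleFrom.of_deBruijnNewman_lt (hneg : deBruijnNewman < 0) {t : ℝ}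
    (ht : deBruijnNewman < t) (ht0 : t ≤ 0) : RealSimpleFrom (-deBruijnNewman) t := by
  refine ⟨ht0, by linarith, fun s hs => ?_⟩
  obtain ⟨h1, h2⟩ := zeros_real_simple hneg (ht.trans_le hs.1)
  exact ⟨realZeroEven_heatInt hs.2 h1, fun x hx => by rw [deriv_heatInt]; exact h2 _ hx⟩

/-! ### Location of the zeros -/

/-- The `n`-th positive zero lies within `O(log ξ_n)` of `ξ_n`, uniformly along the heat flow. -/
lemma exists_abs_posZero_sub_le (T₀ : ℝ) (hT₀ : 0 ≤ T₀) : ∃ D : ℝ, 0 < D ∧ ∀ t, RealSimpleFrom T₀ t →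
    (∀ n, ∃ T, n ≤ zeroCount (heatInt 0 t) T) ∧ ∀ n : ℕ, 1 ≤ n →
      |posZero t n - classicalLocationNat n| ≤ D * logPlus (classicalLocationNat n) := by
  obtain ⟨C, hC, hN⟩ := exists_abs_zeroCount_sub_Psi_le T₀ hT₀
  obtain ⟨D, hD, hloc⟩ := exists_count_classicalLocationNat C hC
  refine ⟨D, hD, fun t ht => ?_⟩
  have hf := ht.good t ⟨le_rfl, ht.nonpos⟩
  have hl := hloc (zeroCount (heatInt 0 t)) (hN t ht)
  have hinf : ∀ n, ∃ T, n ≤ zeroCount (heatInt 0 t) T := fun n =>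
    ⟨_, (Nat.le_succ n).trans (hl (n + 1) (by omega)).1⟩
  refine ⟨hinf, fun n hn => ?_⟩
  obtain ⟨h1, h2⟩ := hl n hn
  have hξ := (classicalLocationNat_spec n).1
  have hL := half_lt_logPlus (classicalLocationNat n)
  have h3 := posZero_le_of_le_zeroCount hf hinf (by positivity) h1
  rw [abs_le]
  refine ⟨?_, by linarith⟩
  rcases le_or_gt (classicalLocationNat n - D * logPlus (classicalLocationNat n)) 0 with h0 | h0
  · have := posZero_nonneg hf hinf n
    linarith
  · have := le_posZero_of_zeroCount_lt hf hinf (h2 h0)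
    linarith

/-- The `n`-th positive zero is comparable to `ξ_n`, uniformly along the heat flow. -/
lemma exists_posZero_comparable (T₀ : ℝ) (hT₀ : 0 ≤ T₀) : ∃ c C : ℝ, 0 < c ∧ 0 < C ∧
    ∀ t, RealSimpleFrom T₀ t → ∀ n : ℕ, 1 ≤ n →
      c * classicalLocationNat n ≤ posZero t n ∧ posZero t n ≤ C * classicalLocationNat n := by
  obtain ⟨D, hD, hloc⟩ := exists_abs_posZero_sub_le T₀ hT₀
  obtain ⟨c₁, hc₁, hfirst⟩ := exists_lt_zero_of_heatInt_eq_zero T₀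
  obtain ⟨X, hX⟩ := eventually_atTop.1 (eventually_mul_logPlus_le D)
  refine ⟨min (1 / 2) (c₁ / (|X| + 1)), 1 + 2 * D, lt_min (by norm_num) (by positivity), by positivity,
    fun t ht n hn => ?_⟩
  obtain ⟨hinf, hx⟩ := hloc t ht
  have hf := ht.good t ⟨le_rfl, ht.nonpos⟩
  have h := abs_le.1 (hx n hn)
  have hξ := (classicalLocationNat_spec n).1
  set ξ := classicalLocationNat n
  constructor
  · rcases le_or_gt X ξ with hcase | hcase
    · have h1 : min (1 / 2) (c₁ / (|X| + 1)) * ξ ≤ 1 / 2 * ξ := by gcongr; exact min_le_left _ _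
      linarith [hX ξ hcase, h.1]
    · have h1 : min (1 / 2) (c₁ / (|X| + 1)) * ξ ≤ c₁ / (|X| + 1) * ξ := by
        gcongr; exact min_le_right _ _
      have h2 : c₁ / (|X| + 1) * ξ ≤ c₁ / (|X| + 1) * (|X| + 1) := by
        gcongr; linarith [le_abs_self X]
      rw [div_mul_cancel₀ _ (by positivity)] at h2
      obtain ⟨m, rfl⟩ : ∃ m, n = m + 1 := ⟨n - 1, by omega⟩
      have hpos : 0 < posZero t (m + 1) := strictMono_posZero hf hinf (Nat.succ_pos m)
      have h3 := hfirst t ⟨by linarith [ht.neg_le], ht.nonpos⟩ _ hpos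
        (posZero_succ_isLeast hf hinf m).1.2
      linarith
  · have h1 := logPlus_le_two_mul hξ.le
    have h2 : D * logPlus ξ ≤ D * (2 * ξ) := by gcongr
    linarith [h.2]

/-- `x_n(t)` is comparable to `n / log ξ_n`, uniformly along the heat flow. -/
lemma posZero_comparable_div (T₀ : ℝ) (hT₀ : 0 ≤ T₀) : ∃ c C : ℝ, 0 < c ∧ 0 < C ∧
    ∀ t, RealSimpleFrom T₀ t → ∀ n : ℕ, 1 ≤ n →
      c * ((n : ℝ) / logPlus (classicalLocationNat n)) ≤ posZero t n ∧
      posZero t n ≤ C * ((n : ℝ) / logPlus (classicalLocationNat n)) := by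
  obtain ⟨c, C, hc, hC, h⟩ := exists_posZero_comparable T₀ hT₀
  have hd := densityConst_pos
  refine ⟨c, C / densityConst, hc, by positivity, fun t ht n hn => ?_⟩
  obtain ⟨h1, h2⟩ := h t ht n hn
  obtain ⟨b1, b2⟩ := classicalLocationNat_bounds hn
  have hL := half_lt_logPlus (classicalLocationNat n)
  have hξ := (classicalLocationNat_spec n).1
  set ξ := classicalLocationNat n
  set L := logPlus ξ
  have hL0 : 0 < L := by linarith
  constructor
  · refine le_trans ?_ h1
    gcongr
    rw [div_le_iff₀ hL0]; exact b2
  · refine h2.trans ?_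
    have h3 : ξ ≤ 1 / densityConst * (n / L) := by
      rw [one_div_mul_eq_div, le_div_iff₀ hd, le_div_iff₀ hL0]; linarith
    calc C * ξ ≤ C * (1 / densityConst * (n / L)) := by gcongr
      _ = _ := by ring

/-- `log ξ_n` is comparable to `log n`. -/
lemma logPlus_classicalLocationNat_comparable : ∃ C : ℝ, 0 < C ∧ ∀ n : ℕ, 1 ≤ n →
    logPlus (classicalLocationNat n) ≤ C * logPlus n ∧
    logPlus (n : ℝ) ≤ C * logPlus (classicalLocationNat n) := by
  have hd := densityConst_pos
  set a := 2 / densityConst + 1 with ha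
  have ha1 : 1 ≤ a := by have : 0 < 2 / densityConst := by positivity
                         linarith
  have hla := Real.log_nonneg ha1
  refine ⟨1 + 2 * log a + 2, by positivity, fun n hn => ?_⟩
  have h1 := classicalLocationNat_le hn
  have h2 := le_two_mul_classicalLocationNat_sq hn
  have hξ := (classicalLocationNat_spec n).1
  set ξ := classicalLocationNat n
  have hLn := half_lt_logPlus (n : ℝ)
  have hLξ := half_lt_logPlus ξ
  have hn0 : (0 : ℝ) ≤ n := Nat.cast_nonneg n
  constructor
  · have := logPlus_mul_le (x := n) (y := ξ) (c := a) hn0 (by linarith) ha1 (by rw [ha]; nlinarith)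
    nlinarith
  · have h3 : logPlus (n : ℝ) ≤ 3 * logPlus ξ := by
      rw [logPlus_nonneg_eq hn0, logPlus_nonneg_eq (by linarith : 0 ≤ ξ)]
      have : (3 : ℝ) * log (2 + ξ) = log ((2 + ξ) ^ 3) := by rw [Real.log_pow]; norm_num
      rw [this]
      refine Real.log_le_log (by linarith) ?_
      nlinarith [pow_pos (by linarith : 0 < ξ) 3]
    nlinarith

/-- The deviation of the gap `x_k - x_j` from `4π (k - j) / log ξ_j`. -/
def gapError (t : ℝ) (j k : ℕ) : ℝ := |posZero t k - posZero t j
  - 4 * π * ((k : ℝ) - j) / logPlus (classicalLocationNat j)|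

/-- For a fixed index `j` everything is bounded, uniformly in `t`: only finitely many `k` are
admissible, and `x_k` is comparable to `ξ_k`. -/
lemma exists_gapError_le (T₀ : ℝ) (hT₀ : 0 ≤ T₀) (j : ℕ) (hj : 1 ≤ j) : ∃ M : ℝ, ∀ t,
    RealSimpleFrom T₀ t → ∀ k : ℕ, j < k → (k : ℝ) ≤ j + logPlus (classicalLocationNat j) ^ 2 →
      gapError t j k ≤ M * logPlus (classicalLocationNat j) := by
  obtain ⟨c, C, hc, hC, h⟩ := exists_posZero_comparable T₀ hT₀
  have hξ := (classicalLocationNat_spec j).1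
  have hL := half_lt_logPlus (classicalLocationNat j)
  have hd := densityConst_pos
  set ξ := classicalLocationNat j with hξdef
  set L := logPlus ξ with hLdef
  refine ⟨2 * (C * (ξ + 1 / densityConst * L) + C * ξ + 8 * π * L ^ 2), fun t ht k hjk hk => ?_⟩
  obtain ⟨h1, h2⟩ := h t ht j hj
  obtain ⟨h3, h4⟩ := h t ht k (by omega)
  obtain ⟨h5, h6⟩ := classicalLocationNat_sub_le hj hjk hk
  have hjk' : (j : ℝ) < k := by exact_mod_cast hjk
  have h7 : C * classicalLocationNat k ≤ C * (ξ + 1 / densityConst * L) := by gcongr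
  have h8 : 0 ≤ c * ξ := by positivity
  have h9 : 0 ≤ c * classicalLocationNat k := mul_nonneg hc.le (by linarith)
  have h10 : 4 * π * ((k : ℝ) - j) / L ≤ 8 * π * L ^ 2 := by
    rw [div_le_iff₀ (by linarith)]
    have : (k : ℝ) - j ≤ L ^ 2 := by linarith
    have : 4 * π * ((k : ℝ) - j) ≤ 4 * π * L ^ 2 := by gcongr
    have : 0 < π * L ^ 2 := by positivity
    nlinarith
  have h11 : 0 ≤ 4 * π * ((k : ℝ) - j) / L :=
    div_nonneg (mul_nonneg (by positivity) (by linarith)) (by linarith)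
  have h12 : gapError t j k ≤ C * (ξ + 1 / densityConst * L) + C * ξ + 8 * π * L ^ 2 := by
    unfold gapError
    rw [abs_le, ← hξdef, ← hLdef]
    have : 0 ≤ 8 * π * L ^ 2 := by positivity
    have : 0 ≤ C * ξ := by positivity
    have : 0 ≤ C * (ξ + 1 / densityConst * L) := by positivity
    constructor <;> linarith
  have h13 : 0 ≤ C * (ξ + 1 / densityConst * L) + C * ξ + 8 * π * L ^ 2 := by positivity
  nlinarith

/-- Equidistribution of the zeros at the scale `log ξ_j`, applied between `x_j` and `x_k`. -/
lemma eventually_gapError_le (T₀ : ℝ) (hT₀ : 0 ≤ T₀) {ε : ℝ} (hε : 0 < ε) :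
    ∀ᶠ j : ℕ in atTop, ∀ t, RealSimpleFrom T₀ t → ∀ k : ℕ, j < k →
      (k : ℝ) ≤ j + logPlus (classicalLocationNat j) ^ 2 →
      gapError t j k ≤ ε * logPlus (classicalLocationNat j) := by
  obtain ⟨D, hD, hloc⟩ := exists_abs_posZero_sub_le T₀ hT₀
  have hd := densityConst_pos
  set a := 1 + 1 / densityConst with ha
  have ha1 : 1 ≤ a := by have : 0 < 1 / densityConst := by positivity
                         linarith
  have hla := Real.log_nonneg ha1
  have hev := eventually_abs_zeroCount_sub_le T₀ hT₀
    (B := 1 / densityConst + D * (1 + 2 * log a)) (ε := ε / (4 * π)) (by positivity) (by positivity)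
  filter_upwards [tendsto_classicalLocationNat.eventually hev, eventually_ge_atTop 1] with j hj hj1 t ht k
    hjk hk
  obtain ⟨hinf, hx⟩ := hloc t ht
  have hf := ht.good t ⟨le_rfl, ht.nonpos⟩
  have hξ := (classicalLocationNat_spec j).1
  have hL := half_lt_logPlus (classicalLocationNat j)
  obtain ⟨h5, h6⟩ := classicalLocationNat_sub_le hj1 hjk hk
  have hxj := hx j hj1
  have hxk := hx k (by omega)
  set ξ := classicalLocationNat j with hξdef
  set ζ := classicalLocationNat k
  set L := logPlus ξ with hLdef
  have hLle : L ≤ 2 + ξ := by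
    rw [hLdef, logPlus_nonneg_eq (by linarith)]; exact Real.log_le_self (by linarith)
  have hLζ : logPlus ζ ≤ (1 + 2 * log a) * L := by
    refine logPlus_mul_le (by linarith) (by linarith) ha1 ?_
    have : 1 / densityConst * L ≤ 1 / densityConst * (2 + ξ) := by gcongr
    rw [ha]; linarith
  have hDLζ : D * logPlus ζ ≤ D * (1 + 2 * log a) * L := by
    rw [mul_assoc]; gcongr
  have hnn : 0 ≤ 1 / densityConst * L := by positivity
  have hDL : D * L ≤ D * (1 + 2 * log a) * L := by
    have : 0 ≤ D * L * log a := by positivity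
    linarith
  have hmain := hj t ht (posZero t j) (posZero t k)
    (by refine hxj.trans ?_; linarith)
    (by
      have : posZero t k - ξ = (posZero t k - ζ) + (ζ - ξ) := by ring
      rw [this]
      refine (abs_add_le _ _).trans ?_
      rw [abs_of_nonneg (sub_nonneg.2 h5)]
      linarith)
  rw [zeroCount_posZero hf hinf, zeroCount_posZero hf hinf] at hmain
  have hL0 : 0 < L := by linarith
  have hscale : posZero t k - posZero t j - 4 * π * ((k : ℝ) - j) / L
      = -(4 * π / L) * ((k : ℝ) - j - (posZero t k - posZero t j) * L / (4 * π)) := by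
    field_simp; ring
  rw [gapError, hscale, abs_mul, abs_neg, abs_of_pos (by positivity : 0 < 4 * π / L)]
  calc 4 * π / L * |(k : ℝ) - j - (posZero t k - posZero t j) * L / (4 * π)|
      ≤ 4 * π / L * (ε / (4 * π) * L ^ 2) := by gcongr
    _ = ε * L := by field_simp

/-- A bound which is uniform for each index and arbitrarily good eventually is given by a single
null sequence. -/
lemma exists_tendsto_zero_of_eventually_le {ι : Type*} (P : ι → ℕ → Prop) (v : ι → ℕ → ℝ)
    (hbdd : ∀ j, ∃ M, ∀ i, P i j → v i j ≤ M)
    (hev : ∀ ε > 0, ∀ᶠ j in atTop, ∀ i, P i j → v i j ≤ ε) (hv : ∀ i j, 0 ≤ v i j) :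
    ∃ δ : ℕ → ℝ, Tendsto δ atTop (𝓝 0) ∧ ∀ i j, P i j → v i j ≤ δ j := by
  refine ⟨fun j => sSup {x | ∃ i, P i j ∧ x = v i j}, ?_, fun i j h => ?_⟩
  · rw [Metric.tendsto_atTop']
    intro ε hε
    obtain ⟨N, hN⟩ := eventually_atTop.1 (hev (ε / 2) (half_pos hε))
    refine ⟨N, fun j hj => ?_⟩
    rw [Real.dist_0_eq_abs, abs_of_nonneg]
    · refine lt_of_le_of_lt (Real.sSup_le ?_ (half_pos hε).le) (half_lt_self hε)
      rintro x ⟨i, hi, rfl⟩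
      exact hN j hj.le i hi
    · refine Real.sSup_nonneg ?_
      rintro x ⟨i, -, rfl⟩
      exact hv i j
  · obtain ⟨M, hM⟩ := hbdd j
    refine le_csSup ⟨M, ?_⟩ ⟨i, h, rfl⟩
    rintro x ⟨i, hi, rfl⟩
    exact hM i hi

lemma exists_gapError_tendsto (T₀ : ℝ) (hT₀ : 0 ≤ T₀) : ∃ δ : ℕ → ℝ, Tendsto δ atTop (𝓝 0) ∧
    ∀ t, RealSimpleFrom T₀ t → ∀ j k : ℕ, 1 ≤ j → j < k →
      (k : ℝ) ≤ j + logPlus (classicalLocationNat j) ^ 2 →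
      gapError t j k ≤ δ j * logPlus (classicalLocationNat j) := by
  have hL : ∀ j, 0 < logPlus (classicalLocationNat j) := fun j => by
    linarith [half_lt_logPlus (classicalLocationNat j)]
  obtain ⟨δ, hδ, h⟩ := exists_tendsto_zero_of_eventually_le (ι := ℝ × ℕ)
    (fun i j => RealSimpleFrom T₀ i.1 ∧ 1 ≤ j ∧ j < i.2 ∧
      (i.2 : ℝ) ≤ j + logPlus (classicalLocationNat j) ^ 2)
    (fun i j => gapError i.1 j i.2 / logPlus (classicalLocationNat j))
    (fun j => by
      rcases Nat.lt_or_ge j 1 with hj | hj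
      · exact ⟨0, fun i hi => absurd hi.2.1 (by omega)⟩
      · obtain ⟨M, hM⟩ := exists_gapError_le T₀ hT₀ j hj
        exact ⟨M, fun i hi => (div_le_iff₀ (hL j)).2 (hM i.1 hi.1 i.2 hi.2.2.1 hi.2.2.2)⟩)
    (fun ε hε => by
      filter_upwards [eventually_gapError_le T₀ hT₀ hε] with j hj i hi
      exact (div_le_iff₀ (hL j)).2 (hj i.1 hi.1 i.2 hi.2.2.1 hi.2.2.2))
    (fun i j => div_nonneg (abs_nonneg _) (hL j).le)
  exact ⟨δ, hδ, fun t ht j k hj hjk hk => (div_le_iff₀ (hL j)).1 (h (t, k) j ⟨ht, hj, hjk, hk⟩)⟩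

lemma classicalLocation_natCast {n : ℕ} (hn : 1 ≤ n) :
    classicalLocation n = classicalLocationNat n := by
  unfold classicalLocation
  rw [Int.sign_eq_one_of_pos (by omega)]
  simp

lemma abs_zeroAt_sub_classicalLocation (t : ℝ) {j : ℤ} (hj : j ≠ 0) :
    |zeroAt t j - classicalLocation j| = |posZero t j.natAbs - classicalLocationNat j.natAbs| ∧
      logPlus (classicalLocation j) = logPlus (classicalLocationNat j.natAbs) := by
  have hs : |((j.sign : ℤ) : ℝ)| = 1 := by
    rcases lt_or_gt_of_ne hj with h | h
    · rw [Int.sign_eq_neg_one_of_neg h]; simp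
    · rw [Int.sign_eq_one_of_pos h]; simp
  unfold zeroAt classicalLocation logPlus
  rw [← mul_sub, abs_mul, abs_mul, hs, one_mul, one_mul]
  exact ⟨rfl, rfl⟩

end

end DBN

theorem corollary3p3 (hneg : DBN.deBruijnNewman < 0) :
    -- the zeros `x_j(t)` are well defined
    (∀ t : ℝ, DBN.deBruijnNewman < t → t ≤ 0 →
      DBN.IsZeroEnumeration (DBN.H t) (DBN.zeroAt t)) ∧
    -- `x_j(t) = ξ_j + O(log_+ ξ_j)`
    (∃ C : ℝ, 0 < C ∧ ∀ t : ℝ, DBN.deBruijnNewman < t → t ≤ 0 → ∀ j : ℤ, j ≠ 0 →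
      |DBN.zeroAt t j - DBN.classicalLocation j|
        ≤ C * DBN.logPlus (DBN.classicalLocation j)) ∧
    -- `x_j(t) ≍ j / log_+ ξ_j ≍ j / log_+ j`
    (∃ c C : ℝ, 0 < c ∧ 0 < C ∧
      ∀ t : ℝ, DBN.deBruijnNewman < t → t ≤ 0 → ∀ j : ℤ, 1 ≤ j →
        c * ((j : ℝ) / DBN.logPlus (DBN.classicalLocation j)) ≤ DBN.zeroAt t j ∧
        DBN.zeroAt t j ≤ C * ((j : ℝ) / DBN.logPlus (DBN.classicalLocation j)) ∧
        c * ((j : ℝ) / DBN.logPlus (j : ℝ))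
          ≤ (j : ℝ) / DBN.logPlus (DBN.classicalLocation j) ∧
        (j : ℝ) / DBN.logPlus (DBN.classicalLocation j)
          ≤ C * ((j : ℝ) / DBN.logPlus (j : ℝ))) ∧
    -- `x_k(t) - x_j(t) = 4π(k - j) / log_+ ξ_j + o_{j → ∞}(log_+ ξ_j)`
    (∃ δ : ℤ → ℝ, Filter.Tendsto δ Filter.atTop (nhds 0) ∧
      ∀ t : ℝ, DBN.deBruijnNewman < t → t ≤ 0 → ∀ j k : ℤ, 1 ≤ j → j < k →
        (k : ℝ) ≤ (j : ℝ) + DBN.logPlus (DBN.classicalLocation j) ^ 2 →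
        |DBN.zeroAt t k - DBN.zeroAt t j
            - 4 * Real.pi * ((k : ℝ) - (j : ℝ)) / DBN.logPlus (DBN.classicalLocation j)|
          ≤ δ j * DBN.logPlus (DBN.classicalLocation j)) := by
  have hT₀ : 0 ≤ -DBN.deBruijnNewman := by linarith
  have hfrom : ∀ t : ℝ, DBN.deBruijnNewman < t → t ≤ 0 →
      DBN.RealSimpleFrom (-DBN.deBruijnNewman) t := fun t ht ht0 =>
    DBN.RealSimpleFrom.of_deBruijnNewman_lt hneg ht ht0
  obtain ⟨D, hD, hloc⟩ := DBN.exists_abs_posZero_sub_le _ hT₀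
  refine ⟨fun t ht ht0 => ?_, ⟨D, hD, fun t ht ht0 j hj => ?_⟩, ?_, ?_⟩
  · have h := hfrom t ht ht0
    exact DBN.isZeroEnumeration_zeroAt (h.good t ⟨le_rfl, ht0⟩) (hloc t h).1
  · obtain ⟨h1, h2⟩ := DBN.abs_zeroAt_sub_classicalLocation t hj
    rw [h1, h2]
    exact (hloc t (hfrom t ht ht0)).2 _ (by omega)
  · obtain ⟨c, C, hc, hC, hcomp⟩ := DBN.posZero_comparable_div _ hT₀
    obtain ⟨K, hK, hlog⟩ := DBN.logPlus_classicalLocationNat_comparable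
    refine ⟨min c (1 / K), max C K, lt_min hc (by positivity), lt_max_of_lt_left hC,
      fun t ht ht0 j hj => ?_⟩
    lift j to ℕ using by omega
    have hj1 : 1 ≤ j := by omega
    rw [DBN.zeroAt_natCast hj1, DBN.classicalLocation_natCast hj1, Int.cast_natCast]
    obtain ⟨h1, h2⟩ := hcomp t (hfrom t ht ht0) j hj1
    obtain ⟨h3, h4⟩ := hlog j hj1
    have hLξ := DBN.half_lt_logPlus (DBN.classicalLocationNat j)
    have hLj := DBN.half_lt_logPlus (j : ℝ)
    have hj0 : (0 : ℝ) ≤ j := Nat.cast_nonneg j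
    have hL1 : 0 < DBN.logPlus (DBN.classicalLocationNat j) := by linarith
    have hL2 : 0 < DBN.logPlus (j : ℝ) := by linarith
    refine ⟨le_trans ?_ h1, h2.trans ?_, ?_, ?_⟩
    · gcongr; exact min_le_left _ _
    · gcongr; exact le_max_left _ _
    · calc min c (1 / K) * (j / DBN.logPlus j) ≤ 1 / K * (j / DBN.logPlus j) := by
            gcongr; exact min_le_right _ _
        _ = j / (K * DBN.logPlus j) := by field_simp
        _ ≤ _ := by gcongr
    · calc (j : ℝ) / DBN.logPlus (DBN.classicalLocationNat j)
          = K * (j / (K * DBN.logPlus (DBN.classicalLocationNat j))) := by field_simp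
        _ ≤ K * (j / DBN.logPlus j) := by gcongr
        _ ≤ _ := by gcongr; exact le_max_right _ _
  · obtain ⟨δ, hδ, hgap⟩ := DBN.exists_gapError_tendsto _ hT₀
    refine ⟨fun j => δ j.toNat, ?_, fun t ht ht0 j k hj hjk hk => ?_⟩
    · refine hδ.comp (Filter.tendsto_atTop.2 fun n => ?_)
      filter_upwards [Filter.eventually_ge_atTop (n : ℤ)] with j hj
      omega
    lift j to ℕ using by omega
    lift k to ℕ using by omega
    have hj1 : 1 ≤ j := by omega
    have hk1 : 1 ≤ k := by omega
    rw [DBN.classicalLocation_natCast hj1] at hk ⊢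
    rw [DBN.zeroAt_natCast hj1, DBN.zeroAt_natCast hk1]
    simp only [Int.cast_natCast, Int.toNat_natCast] at hk ⊢
    exact hgap t (hfrom t ht ht0) j k hj1 (by omega) hk
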